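/- **Setting.** Let $T>0$, $c_0,c_1:\mathbb R\times[0,T)\to\mathbb R$, $u_0:\mathbb R\to\mathbb R$. A function $u$, Lipschitz continuous on $\mathbb R\times[0,T)$, is a *weak solution* on $[0,T)$ of $$u_t=\big(c_0(\cdot,t)\star \mathbf 1_{\{u(\cdot,t)\ge 0\}}(x)+c_1(x,t)\big)\,|u_x|,\qquad u(\cdot,0)=u_0 \tag{E}$$ if there is a measurable $\chi:\mathbb R\times(0,T)\to[0,1]$ with $\mathbf 1_{\{u(\cdot,t)>0\}}(x)\le\chi(x,t)\le \mathbf 1_{\{u(\cdot,t)\ge0\}}(x)$ for a.e. $(x,t)\in\mathbb R\times(0,T)$ such that $u$ is an $L^1$-viscosity solution of $u_t=\bar c(x,t)|u_x|$, $u(\cdot,0)=u_0$, where $\bar c(x,t)=\int c_0(x-y,t)\chi(y,t)\,dy+c_1(x,t)$. Here $u$ is an $L^1$-viscosity subsolution (resp. supersolution) if it is upper (resp. lower) semicontinuous, $u(\cdot,0)\le u_0$ (resp. $\ge$), and for all $(x_0,t_0)\in\mathbb R\times(0,T)$, $b\in L^1(0,T)$, $\varphi\in C^\infty(\mathbb R\times(0,T))$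 and continuous $G:\mathbb R\times(0,T)\times\mathbb R\to\mathbb R$ such that $u(x,t)-\int_0^tb-\varphi(x,t)$ has a local maximum (resp. minimum) at $(x_0,t_0)$ and $\bar c(x,t)|p|-b(t)\le G(x,t,p)$ (resp. $\ge$) for a.e. $t$ near $t_0$ and all $(x,p)$ near $(x_0,\varphi_x(x_0,t_0))$, one has $\varphi_t(x_0,t_0)\le G(x_0,t_0,\varphi_x(x_0,t_0))$ (resp. $\ge$); a solution is both. A weak solution is *classical* if moreover $\mathbf 1_{\{u(\cdot,t)>0\}}(x)=\mathbf 1_{\{u(\cdot,t)\ge0\}}(x)$ for a.e. $(x,t)\in\mathbb R\times(0,T)$. Take $c_1(t)=2(t-1)(2-t)$, $u_0(x)=1-|x|$, $x_1(t)=(t-1)^2$. For a measurable $\gamma$ with values in $[0,1]$ on $[1,2]$, let $y_\gamma$ be the (Carathéodory) solution of $\dot y=c_1+2\gamma y$ on $[1,2]$, $y(1)=0$. Put $U_\gamma(x,t)=u_0(|x|-x_1(t)+1)=x_1(t)-|x|$ for $0\le t\le1$; for $1<t\le2$ put $U_\gamma(x,t)=0$ if $|x|\le y_\gamma(t)$ and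 $U_\gamma(x,t)=U_\gamma(|x|-y_\gamma(t),1)=y_\gamma(t)-|x|$ otherwise. **Statement.** 1. ($c_0\equiv1$.) For every such $\gamma$, $y_\gamma$ exists and is unique, and $U_\gamma$ is a weak solution of (E) on $[0,T)$ for every $1<T\le2$. For $0\le t\le1$, $\{U_\gamma(\cdot,t)>0\}=(-x_1(t),x_1(t))$ and $\{U_\gamma(\cdot,t)\ge0\}=[-x_1(t),x_1(t)]$; for $1\le t\le 2$, $\{U_\gamma(\cdot,t)>0\}=\emptyset$ and $\{U_\gamma(\cdot,t)\ge0\}=\{U_\gamma(\cdot,t)=0\}=[-y_\gamma(t),y_\gamma(t)]$, with $y_\gamma(t)>0$ for $1<t\le2$. 2. ($c_0\equiv1$.) For every $1<T\le2$: for each $t\in(1,T)$ the weak solutions of (E) on $[0,T)$ take infinitely many different values $u(\cdot,t)$ at time $t$ (in particular there are infinitely many weak solutions), and (E) has no classical solution on $[0,T)$. 3. (Compactly supported $c_0$.) For every $\rho>0$ there is $R_0$ such that for all $R\ge R_0$ and $1<T\le 2$ the following holds. There exist kernels $c_0$ with $c_0(x,t)=1$ for $|x|\le R$ and $c_0(x,t)=0$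 for $x$ outside a bounded set independent of $t$, satisfying: $c_0\in C([0,T);L^1(\mathbb R))$ with bounded $L^1$ norm, and $\partial_xc_0\in L^\infty([0,T);L^1(\mathbb R))$. For each such $c_0$: for every $\gamma$ as above there is a weak solution $V$ of (E) on $[0,T)$ with $V=U_\gamma$ on $\{|x|\le\rho\}\times[0,T)$; for each $t\in(1,T)$ the weak solutions take infinitely many different values $u(\cdot,t)$; and (E) has no classical solution on $[0,T)$. -/

import Mathlib

open Set Filter Topology MeasureTheory
open scoped ContDiff

noncomputable section

namespace Dislocation

/-! Functions of space and time are written `u x t`, with `x : ℝ` (space dimension one). -/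

/-- `L¹`-viscosity subsolution of `v_t = c(x,t) |v_x|` in `ℝ × (0,T)`, `v(·,0) = u₀`, where
`c` is only measurable in time. -/
def IsL1Subsolution (T : ℝ) (c : ℝ → ℝ → ℝ) (u₀ : ℝ → ℝ) (v : ℝ → ℝ → ℝ) : Prop :=
  UpperSemicontinuousOn (fun z : ℝ × ℝ => v z.1 z.2) (univ ×ˢ Ico 0 T) ∧
  (∀ x, v x 0 ≤ u₀ x) ∧
  ∀ (x₀ t₀ : ℝ) (b : ℝ → ℝ) (φ : ℝ → ℝ → ℝ) (G : ℝ → ℝ → ℝ → ℝ),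
    t₀ ∈ Ioo 0 T →
    IntegrableOn b (Ioo 0 T) →
    ContDiffOn ℝ ∞ (fun z : ℝ × ℝ => φ z.1 z.2) (univ ×ˢ Ioo 0 T) →
    ContinuousOn (fun z : ℝ × ℝ × ℝ => G z.1 z.2.1 z.2.2) (univ ×ˢ Ioo 0 T ×ˢ univ) →
    IsLocalMaxOn (fun z : ℝ × ℝ => v z.1 z.2 - (∫ s in (0 : ℝ)..z.2, b s) - φ z.1 z.2)
      (univ ×ˢ Ioo 0 T) (x₀, t₀) →
    (∃ δ > 0, ∀ᵐ t : ℝ, t ∈ Ioo 0 T → |t - t₀| < δ → ∀ x p : ℝ, |x - x₀| < δ →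
      |p - deriv (fun x' => φ x' t₀) x₀| < δ → c x t * |p| - b t ≤ G x t p) →
    deriv (fun t' => φ x₀ t') t₀ ≤ G x₀ t₀ (deriv (fun x' => φ x' t₀) x₀)

/-- `L¹`-viscosity supersolution of `v_t = c(x,t) |v_x|` in `ℝ × (0,T)`, `v(·,0) = u₀`. -/
def IsL1Supersolution (T : ℝ) (c : ℝ → ℝ → ℝ) (u₀ : ℝ → ℝ) (v : ℝ → ℝ → ℝ) : Prop :=
  LowerSemicontinuousOn (fun z : ℝ × ℝ => v z.1 z.2) (univ ×ˢ Ico 0 T) ∧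
  (∀ x, u₀ x ≤ v x 0) ∧
  ∀ (x₀ t₀ : ℝ) (b : ℝ → ℝ) (φ : ℝ → ℝ → ℝ) (G : ℝ → ℝ → ℝ → ℝ),
    t₀ ∈ Ioo 0 T →
    IntegrableOn b (Ioo 0 T) →
    ContDiffOn ℝ ∞ (fun z : ℝ × ℝ => φ z.1 z.2) (univ ×ˢ Ioo 0 T) →
    ContinuousOn (fun z : ℝ × ℝ × ℝ => G z.1 z.2.1 z.2.2) (univ ×ˢ Ioo 0 T ×ˢ univ) →
    IsLocalMinOn (fun z : ℝ × ℝ => v z.1 z.2 - (∫ s in (0 : ℝ)..z.2, b s) - φ z.1 z.2)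
      (univ ×ˢ Ioo 0 T) (x₀, t₀) →
    (∃ δ > 0, ∀ᵐ t : ℝ, t ∈ Ioo 0 T → |t - t₀| < δ → ∀ x p : ℝ, |x - x₀| < δ →
      |p - deriv (fun x' => φ x' t₀) x₀| < δ → G x t p ≤ c x t * |p| - b t) →
    G x₀ t₀ (deriv (fun x' => φ x' t₀) x₀) ≤ deriv (fun t' => φ x₀ t') t₀

/-- `L¹`-viscosity solution; it is used for continuous functions only, which coincide with
their semicontinuous envelopes. -/
def IsL1Solution (T : ℝ) (c : ℝ → ℝ → ℝ) (u₀ : ℝ → ℝ) (v : ℝ → ℝ → ℝ) : Prop :=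
  IsL1Subsolution T c u₀ v ∧ IsL1Supersolution T c u₀ v

/-- The velocity `c₀(·,t) ⋆ χ(·,t) (x) + c₁(x,t)`. -/
def velocity (c₀ c₁ χ : ℝ → ℝ → ℝ) (x t : ℝ) : ℝ :=
  (∫ y, c₀ (x - y) t * χ y t) + c₁ x t

/-- The indicator function of `{u(·,t) > 0}` at `x`. -/
def indPos (u : ℝ → ℝ → ℝ) (x t : ℝ) : ℝ := indicator {z | 0 < u z t} (fun _ => (1 : ℝ)) x

/-- The indicator function of `{u(·,t) ≥ 0}` at `x`. -/
def indNonneg (u : ℝ → ℝ → ℝ) (x t : ℝ) : ℝ := indicator {z | 0 ≤ u z t} (fun _ => (1 : ℝ)) x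

/-- Weak solutions on `[0,T)` of `u_t = (c₀(·,t) ⋆ 1_{u(·,t) ≥ 0}(x) + c₁(x,t)) |u_x|`,
`u(·,0) = u₀`. Solutions are Lipschitz continuous on `ℝ × [0,T)`; they need not be bounded,
since the initial datum need not be. -/
def IsWeakSolution (T : ℝ) (c₀ c₁ : ℝ → ℝ → ℝ) (u₀ : ℝ → ℝ) (u : ℝ → ℝ → ℝ) : Prop :=
  (∃ K, LipschitzOnWith K (fun z : ℝ × ℝ => u z.1 z.2) (univ ×ˢ Ico 0 T)) ∧
  ∃ χ : ℝ → ℝ → ℝ,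
    Measurable (fun z : ℝ × ℝ => χ z.1 z.2) ∧
    (∀ x, ∀ t ∈ Ioo 0 T, χ x t ∈ Icc (0 : ℝ) 1) ∧
    (∀ᵐ z : ℝ × ℝ ∂(volume.restrict (univ ×ˢ Ioo 0 T)),
      indPos u z.1 z.2 ≤ χ z.1 z.2 ∧ χ z.1 z.2 ≤ indNonneg u z.1 z.2) ∧
    IsL1Solution T (velocity c₀ c₁ χ) u₀ u

/-- Classical solutions: weak solutions whose zero set does not fatten. -/
def IsClassicalSolution (T : ℝ) (c₀ c₁ : ℝ → ℝ → ℝ) (u₀ : ℝ → ℝ) (u : ℝ → ℝ → ℝ) : Prop :=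
  IsWeakSolution T c₀ c₁ u₀ u ∧
  ∀ᵐ z : ℝ × ℝ ∂(volume.restrict (univ ×ˢ Ioo 0 T)), indPos u z.1 z.2 = indNonneg u z.1 z.2

/-- `g` is the weak derivative of `f` on `ℝ`. -/
def HasWeakDeriv (f g : ℝ → ℝ) : Prop :=
  ∀ ψ : ℝ → ℝ, ContDiff ℝ ∞ ψ → HasCompactSupport ψ →
    ∫ x, f x * deriv ψ x = - ∫ x, g x * ψ x

/-- The standing regularity assumptions on `(c₀, c₁)`: `c₀ ∈ C([0,T); L¹)` is bounded with
values in `L¹`, `∂ₓ c₀ ∈ L^∞([0,T); L¹)`, and `c₁` is continuous, bounded and Lipschitz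
continuous in space. -/
structure Regular (T : ℝ) (c₀ c₁ : ℝ → ℝ → ℝ) : Prop where
  integrable : ∀ t ∈ Ico 0 T, Integrable (fun x => c₀ x t)
  continuous : ∀ t ∈ Ico 0 T,
    Tendsto (fun s => ∫ x, |c₀ x s - c₀ x t|) (𝓝[Ico 0 T] t) (𝓝 0)
  bounded : ∃ M₀ : ℝ, ∀ t ∈ Ico 0 T, ∫ x, |c₀ x t| ≤ M₀
  deriv_bounded : ∃ L₀ : ℝ, ∀ᵐ t : ℝ, t ∈ Ico 0 T →
    ∃ g : ℝ → ℝ, Integrable g ∧ HasWeakDeriv (fun x => c₀ x t) g ∧ ∫ x, |g x| ≤ L₀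
  c₁_continuous : ContinuousOn (fun z : ℝ × ℝ => c₁ z.1 z.2) (univ ×ˢ Ico 0 T)
  c₁_bounded : ∃ M₁ : ℝ, ∀ x, ∀ t ∈ Icc 0 T, |c₁ x t| ≤ M₁
  c₁_lipschitz : ∃ L₁ : ℝ, ∀ x y, ∀ t ∈ Icc 0 T, |c₁ x t - c₁ y t| ≤ L₁ * |x - y|

/-- `c₀` vanishes outside a bounded set of space and equals `1` for `|x| ≤ R`. -/
def IsCutoffOfOne (T R : ℝ) (c₀ : ℝ → ℝ → ℝ) : Prop :=
  (∃ R', ∀ x, ∀ t ∈ Ico 0 T, R' ≤ |x| → c₀ x t = 0) ∧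
  ∀ x, ∀ t ∈ Ico 0 T, |x| ≤ R → c₀ x t = 1

/-! ### The data of the example -/

/-- The kernel `c₀ ≡ 1`. -/
def one (_x _t : ℝ) : ℝ := 1

/-- The driving force `c₁(t) = 2 (t - 1) (2 - t)`. -/
def force (_x t : ℝ) : ℝ := 2 * (t - 1) * (2 - t)

/-- The initial datum `u₀(x) = 1 - |x|`. -/
def datum (x : ℝ) : ℝ := 1 - |x|

/-- The half-length `x₁(t) = (t - 1)²` of the front for `0 ≤ t ≤ 1`. -/
def x₁ (t : ℝ) : ℝ := (t - 1) ^ 2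

/-- Admissible parameters: measurable functions with values in `[0,1]` on `[1,2]`. -/
def Admissible (γ : ℝ → ℝ) : Prop := Measurable γ ∧ ∀ t ∈ Icc (1 : ℝ) 2, γ t ∈ Icc (0 : ℝ) 1

/-- `y` solves `y' = c₁(t) + 2 γ(t) y` on `[1,2]`, `y(1) = 0`, in the sense of Carathéodory. -/
def IsFront (γ y : ℝ → ℝ) : Prop :=
  ContinuousOn y (Icc 1 2) ∧
  ∀ t ∈ Icc (1 : ℝ) 2, y t = ∫ s in (1 : ℝ)..t, (2 * (s - 1) * (2 - s) + 2 * γ s * y s)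

/-- The solution `u(x,t) = u₀(|x| - x₁(t) + 1)` before the fattening time. -/
def uBefore (x t : ℝ) : ℝ := datum (|x| - x₁ t + 1)

/-- The function `U_γ`, where `y = y_γ` is the half-length of the zero set after `t = 1`. -/
def U (y : ℝ → ℝ) (x t : ℝ) : ℝ :=
  if t ≤ 1 then uBefore x t
  else if |x| ≤ y t then 0
  else uBefore (|x| - y t) 1

end Dislocation

end

/-!
Along a front `|x| = ξ(t)` the law of motion is `ξ' = ∫ c₀ χ + c₁`. For `c₀ ≡ 1` near the front and
`{u ≥ 0} = [-ξ, ξ]` it reads `ξ' = 2ξ + c₁` before `t = 1`, whose solution `(t - 1)²` shrinks to a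
point exactly at `t = 1`. From then on `u ≤ 0`, the phase `χ` may be any function `γ` of time on
the zero set `{|x| ≤ y_γ}`, and `c₁ > 0` makes this set grow.

*Existence.* For the velocity `field` generated by a phase, which is Lipschitz in space and
measurable in time, the datum `1 - |x|` is transported outwards along the flow from both sides and
cut off at its maximal value (`bump`). The viscosity inequalities are checked through
`isL1Subsolution_of_paths`: a function satisfies the subsolution inequality at a point as soon as,
for every slope touching it there from above, some path of admissible speed ends at that point and
carries, at earlier times, values at least as large as the one at its end. Near the origin the flow
is a translation, so `bump` coincides with `U_γ` there (`bump_field_eq_U`); for `c₀ ≡ 1` it does so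
everywhere. Since the zero set of the bump is `[-y_γ, y_γ]` after `t = 1`, the phase is consistent
with it (`isWeakSolution_bump`). The parameters
`parameter θ` give the explicit fronts `(t - 1)² - (2/3) θ (t - 1)³`, hence infinitely many values
at every time after `1`.

*No classical solution.* Let `u` be any weak solution. Comparison with smooth strict barriers
(`IsL1Subsolution.le_barrier`) and continuation in time (`bootstrap`) show that `{u ≥ 0}` lies in
`[-x₁, x₁]` (`WeakPair.neg_of_lt_abs`): if it does so approximately, the nonlocal velocity is at most
that of the exact front, and `(t - 1)² + ε exp (5 t)` is a strict supersolution of the law of the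
front. (After `t = 1` this bound is not sharp, but still controls the velocity.) In the same way
`u(0, t) > 0` for `t < 1` (`WeakPair.pos_at_zero`), so `u(0, 1) ≥ 0`, while
`u(·, 1) ≤ 0` because `x₁(1) = 0`. After `t = 1` the bound `u ≤ 0` is propagated by constants
(`WeakPair.nonpos`). From below, the velocity is at least `c₁`, so parabolas sliding with speed at
most `c₁` give `u ≥ 0` for `|x| ≤ ∫₁ᵗ c₁` (`WeakPair.nonneg_of_le`). Thus `u = 0` on a nonempty open
set, where the two indicator functions differ.
-/

namespace Dislocation

/-! ### Test functions, slopes and paths -/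

/-- `p` is the slope at `x₀` of a function touching `w` from above at `x₀`. -/
def TouchesAbove (w : ℝ → ℝ) (x₀ p : ℝ) : Prop :=
  ∃ φ : ℝ → ℝ, HasDerivAt φ p x₀ ∧ IsLocalMax (fun x => w x - φ x) x₀

theorem TouchesAbove.nonneg {w : ℝ → ℝ} {x₀ p : ℝ} (h : TouchesAbove w x₀ p)
    (hw : ∀ᶠ x in 𝓝[>] x₀, w x₀ ≤ w x) : 0 ≤ p := by
  obtain ⟨φ, hφ, hmax⟩ := h
  have h1 : Tendsto (slope φ x₀) (𝓝[>] x₀) (𝓝 p) :=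
    (hasDerivAt_iff_tendsto_slope.1 hφ).mono_left
      (nhdsWithin_mono _ fun x hx => ne_of_gt hx)
  refine ge_of_tendsto h1 ?_
  filter_upwards [hw, hmax.filter_mono nhdsWithin_le_nhds, self_mem_nhdsWithin] with x h2 h3 h4
  have h4' : x₀ < x := h4
  rw [slope_def_field]
  apply div_nonneg <;> linarith

theorem TouchesAbove.comp_neg {w : ℝ → ℝ} {x₀ p : ℝ} (h : TouchesAbove w x₀ p) :
    TouchesAbove (fun x => w (-x)) (-x₀) (-p) := by
  obtain ⟨φ, hφ, hmax⟩ := h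
  refine ⟨fun x => φ (-x), ?_, ?_⟩
  · have h1 : HasDerivAt φ p (-(-x₀)) := by simpa using hφ
    have h2 := h1.comp (-x₀) (hasDerivAt_neg (-x₀))
    rw [mul_neg_one] at h2
    exact h2
  · have h1 : Tendsto (fun x : ℝ => -x) (𝓝 (-x₀)) (𝓝 x₀) := by
      simpa using (continuous_neg (G := ℝ)).tendsto (-x₀)
    have h2 := h1.eventually hmax
    filter_upwards [h2] with x hx
    simpa using hx

theorem TouchesAbove.nonpos {w : ℝ → ℝ} {x₀ p : ℝ} (h : TouchesAbove w x₀ p)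
    (hw : ∀ᶠ x in 𝓝[<] x₀, w x₀ ≤ w x) : p ≤ 0 := by
  have h1 : Tendsto (fun x : ℝ => -x) (𝓝[>] (-x₀)) (𝓝[<] x₀) := by
    simpa using tendsto_neg_nhdsGT (a := -x₀)
  have h2 := h.comp_neg.nonneg (by
    filter_upwards [h1.eventually hw] with x hx
    simpa using hx)
  linarith

/-- A path `X` ending at `(x₀, t₀)`, with velocity `g`, along which `v` is at least `v x₀ t₀` and
which does not move faster in the direction `-p` than the speed `c` allows. The existence of such
paths, for all slopes `p`, is a dynamic programming form of `v_t ≤ c |v_x|`. -/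
def HasSubPath (c v : ℝ → ℝ → ℝ) (x₀ t₀ p : ℝ) : Prop :=
  ∃ (X g : ℝ → ℝ) (h C : ℝ), 0 < h ∧ Measurable g ∧ (∀ s, |g s| ≤ C) ∧
    (∀ t ∈ Icc (t₀ - h) t₀, X t = x₀ - ∫ s in t..t₀, g s) ∧
    (∀ t ∈ Icc (t₀ - h) t₀, v x₀ t₀ ≤ v (X t) t) ∧
    ∀ᵐ s : ℝ, s ∈ Ioo (t₀ - h) t₀ → -(p * g s) ≤ c (X s) s * |p|

theorem HasSubPath.of_reflection {c v : ℝ → ℝ → ℝ} {x₀ t₀ p : ℝ}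
    (h : HasSubPath (fun x t => c (-x) t) (fun x t => v (-x) t) (-x₀) t₀ (-p)) :
    HasSubPath c v x₀ t₀ p := by
  obtain ⟨X, g, h, C, hh, hg, hgC, hX, hv, hc⟩ := h
  refine ⟨fun t => -X t, fun s => -g s, h, C, hh, hg.neg, by simpa using hgC, ?_, ?_, ?_⟩
  · intro t ht
    simp only [hX t ht, intervalIntegral.integral_neg]
    ring
  · intro t ht
    simpa using hv t ht
  · filter_upwards [hc] with s hs hs'
    simpa using hs hs'

theorem deriv_fst_of_hasFDerivAt {F : ℝ × ℝ → ℝ} {F' : ℝ × ℝ →L[ℝ] ℝ} {x t : ℝ}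
    (h : HasFDerivAt F F' (x, t)) : HasDerivAt (fun x' => F (x', t)) (F' (1, 0)) x := by
  have h1 : HasDerivAt (fun x' : ℝ => (x', t)) ((1 : ℝ), (0 : ℝ)) x :=
    (hasDerivAt_id x).prodMk (hasDerivAt_const x t)
  exact h.comp_hasDerivAt x h1

theorem deriv_snd_of_hasFDerivAt {F : ℝ × ℝ → ℝ} {F' : ℝ × ℝ →L[ℝ] ℝ} {x t : ℝ}
    (h : HasFDerivAt F F' (x, t)) : HasDerivAt (fun t' => F (x, t')) (F' (0, 1)) t := by
  have h1 : HasDerivAt (fun t' : ℝ => (x, t')) ((0 : ℝ), (1 : ℝ)) t :=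
    (hasDerivAt_const t x).prodMk (hasDerivAt_id t)
  exact h.comp_hasDerivAt t h1

theorem strip_mem_nhds {T x t : ℝ} (ht : t ∈ Ioo 0 T) :
    (univ ×ˢ Ioo 0 T : Set (ℝ × ℝ)) ∈ 𝓝 (x, t) :=
  (isOpen_univ.prod isOpen_Ioo).mem_nhds ⟨mem_univ _, ht⟩

/-- If every slope touching `v` from above is matched by a path, then `v` is a subsolution: the
test function plus the primitive of `b` does not increase backwards along the path, and the first
order expansion of the test function at the end point of the path, together with the integrated
bound on `c |p| - b`, gives the viscosity inequality. -/
theorem isL1Subsolution_of_paths {T : ℝ} {c : ℝ → ℝ → ℝ} {u₀ : ℝ → ℝ} {v : ℝ → ℝ → ℝ}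
    (hv : ContinuousOn (fun z : ℝ × ℝ => v z.1 z.2) (univ ×ˢ Ico 0 T))
    (h0 : ∀ x, v x 0 ≤ u₀ x)
    (hp : ∀ x₀, ∀ t₀ ∈ Ioo 0 T, ∀ p, TouchesAbove (fun x => v x t₀) x₀ p →
      HasSubPath c v x₀ t₀ p) :
    IsL1Subsolution T c u₀ v := by
  refine ⟨hv.upperSemicontinuousOn, h0, ?_⟩
  intro x₀ t₀ b φ G ht₀ hb hφ hG hmax hcG
  have hmem : (univ ×ˢ Ioo 0 T : Set (ℝ × ℝ)) ∈ 𝓝 (x₀, t₀) := strip_mem_nhds ht₀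
  have hdiff : DifferentiableAt ℝ (fun z : ℝ × ℝ => φ z.1 z.2) (x₀, t₀) :=
    (hφ.contDiffAt hmem).differentiableAt (by simp)
  obtain ⟨F', hF'⟩ := hdiff
  have hx := deriv_fst_of_hasFDerivAt hF'
  have ht := deriv_snd_of_hasFDerivAt hF'
  rw [hx.deriv] at hcG ⊢
  rw [ht.deriv]
  set p := F' (1, 0) with hpdef
  set q := F' (0, 1) with hqdef
  have hmax' : IsLocalMax
      (fun z : ℝ × ℝ => v z.1 z.2 - (∫ s in (0 : ℝ)..z.2, b s) - φ z.1 z.2) (x₀, t₀) :=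
    hmax.isLocalMax hmem
  have htouch : TouchesAbove (fun x => v x t₀) x₀ p := by
    refine ⟨fun x => φ x t₀, hx, ?_⟩
    have hc1 : Tendsto (fun x : ℝ => (x, t₀)) (𝓝 x₀) (𝓝 (x₀, t₀)) :=
      (Continuous.prodMk_left t₀).tendsto x₀
    filter_upwards [hc1.eventually hmax'] with x hx'
    linarith
  obtain ⟨X, g, h, C, hh, hg, hgC, hX, hvX, hpath⟩ := hp x₀ t₀ ht₀ p htouch
  by_contra! hlt
  set ε := (q - G x₀ t₀ p) / 4 with hε
  have hε0 : 0 < ε := by rw [hε]; linarith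
  have hC0 : 0 ≤ C := (abs_nonneg _).trans (hgC 0)
  have hXlip : ∀ t ∈ Icc (t₀ - h) t₀, |X t - x₀| ≤ C * (t₀ - t) := by
    intro t ht'
    rw [hX t ht']
    have := intervalIntegral.norm_integral_le_of_norm_le_const (a := t) (b := t₀) (f := g) (C := C)
      (fun s _ => hgC s)
    rw [Real.norm_eq_abs, abs_of_nonneg (by linarith [ht'.2] : 0 ≤ t₀ - t)] at this
    rwa [show x₀ - (∫ s in t..t₀, g s) - x₀ = -∫ s in t..t₀, g s by ring, abs_neg]
  have hIcc : ∀ᶠ t in 𝓝[<] t₀, t ∈ Ico (t₀ - h) t₀ :=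
    Ico_mem_nhdsLT (by linarith)
  -- the path is continuous at its end point
  have hXtend : Tendsto X (𝓝[<] t₀) (𝓝 x₀) := by
    rw [tendsto_iff_norm_sub_tendsto_zero]
    have h1 : Tendsto (fun t => C * (t₀ - t)) (𝓝[<] t₀) (𝓝 0) := by
      have : Tendsto (fun t => C * (t₀ - t)) (𝓝 t₀) (𝓝 (C * (t₀ - t₀))) :=
        (Continuous.tendsto (by fun_prop) t₀)
      simpa using this.mono_left nhdsWithin_le_nhds
    refine squeeze_zero' (Eventually.of_forall fun _ => norm_nonneg _) ?_ h1
    filter_upwards [hIcc] with t ht'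
    exact hXlip t ⟨ht'.1, ht'.2.le⟩
  have hpair : Tendsto (fun t => (X t, t)) (𝓝[<] t₀) (𝓝 (x₀, t₀)) :=
    hXtend.prodMk_nhds (tendsto_id.mono_left nhdsWithin_le_nhds)
  have hfr := hpair.eventually ((hasFDerivAt_iff_isLittleO.1 hF').def
    (show 0 < ε / (C + 1) by positivity))
  have hGev : ∀ᶠ t in 𝓝[<] t₀, G (X t) t p < G x₀ t₀ p + ε := by
    have hGc : ContinuousAt (fun z : ℝ × ℝ × ℝ => G z.1 z.2.1 z.2.2) (x₀, t₀, p) :=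
      hG.continuousAt ((isOpen_univ.prod (isOpen_Ioo.prod isOpen_univ)).mem_nhds
        ⟨mem_univ _, ht₀, mem_univ _⟩)
    have h2 : Tendsto (fun t => (X t, t, p)) (𝓝[<] t₀) (𝓝 (x₀, t₀, p)) :=
      hXtend.prodMk_nhds ((tendsto_id.mono_left nhdsWithin_le_nhds).prodMk_nhds tendsto_const_nhds)
    have h3 := hGc.tendsto.comp h2
    exact h3.eventually (gt_mem_nhds (by simp only; linarith))
  obtain ⟨δ, hδ, hcG⟩ := hcG
  have hnear : ∀ᶠ t in 𝓝[<] t₀, |X t - x₀| < δ ∧ |t - t₀| < δ := by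
    have h1 := hXtend.eventually (Metric.ball_mem_nhds x₀ hδ)
    have h2 : ∀ᶠ t in 𝓝[<] t₀, t ∈ Metric.ball t₀ δ :=
      (tendsto_id.mono_left nhdsWithin_le_nhds).eventually (Metric.ball_mem_nhds t₀ hδ)
    filter_upwards [h1, h2] with t h3 h4
    exact ⟨h3, h4⟩
  have hpos : ∀ᶠ t in 𝓝[<] t₀, t ∈ Ioo 0 t₀ := Ioo_mem_nhdsLT ht₀.1
  have hall := hIcc.and (hGev.and (hnear.and hpos))
  -- on a left neighbourhood all the estimates hold
  obtain ⟨a, ha, hsub⟩ := (mem_nhdsLT_iff_exists_Ioo_subset).1 hall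
  have hevent : ∀ᶠ t in 𝓝[<] t₀, t ∈ Ioo a t₀ := Ioo_mem_nhdsLT ha
  obtain ⟨t, hta, hfrt, hmt, htt⟩ :=
    (hevent.and (hfr.and ((hpair.eventually hmax').and hall))).exists
  obtain ⟨htI, -, -, htpos⟩ := htt
  have htI' : t ∈ Icc (t₀ - h) t₀ := ⟨htI.1, htI.2.le⟩
  have hbi : IntegrableOn b (Ioo 0 t₀) := hb.mono_set (Ioo_subset_Ioo_right ht₀.2.le)
  have hb0 : IntervalIntegrable b volume 0 t :=
    (intervalIntegrable_iff_integrableOn_Ioo_of_le htpos.1.le).2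
      (hbi.mono_set (Ioo_subset_Ioo_right htpos.2.le))
  have hb1 : IntervalIntegrable b volume t t₀ :=
    (intervalIntegrable_iff_integrableOn_Ioo_of_le htpos.2.le).2
      (hbi.mono_set (Ioo_subset_Ioo_left htpos.1.le))
  have hgi : IntervalIntegrable g volume t t₀ := by
    refine (intervalIntegrable_const (c := C)).mono_fun hg.aestronglyMeasurable ?_
    filter_upwards with s
    rw [Real.norm_eq_abs, Real.norm_eq_abs, abs_of_nonneg hC0]
    exact hgC s
  have hint : ∫ s in t..t₀, (-(p * g s) - b s) ≤ ∫ s in t..t₀, (G x₀ t₀ p + ε) := by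
    refine intervalIntegral.integral_mono_ae_restrict htpos.2.le
      ((hgi.const_mul p).neg.sub hb1) intervalIntegrable_const ?_
    filter_upwards [ae_restrict_of_ae hpath, ae_restrict_of_ae hcG,
      ae_restrict_mem measurableSet_Icc, ae_restrict_of_ae (Measure.ae_ne volume t),
      ae_restrict_of_ae (Measure.ae_ne volume t₀)] with s h1 h2 h3 h4 h5
    have hs : s ∈ Ioo t t₀ := ⟨lt_of_le_of_ne h3.1 (Ne.symm h4), lt_of_le_of_ne h3.2 h5⟩
    obtain ⟨hsI, hsG, ⟨hsX, hst⟩, hspos⟩ := hsub ⟨hta.1.trans hs.1, hs.2⟩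
    have h6 := h1 ⟨htI.1.trans_lt hs.1, hs.2⟩
    have h7 := h2 ⟨hspos.1, hspos.2.trans ht₀.2⟩ hst (X s) p hsX (by simpa using hδ)
    linarith
  have hsplit : ∫ s in t..t₀, (-(p * g s) - b s) =
      -(p * ∫ s in t..t₀, g s) - ∫ s in t..t₀, b s := by
    rw [← intervalIntegral.integral_const_mul, ← intervalIntegral.integral_neg]
    exact intervalIntegral.integral_sub (hgi.const_mul p).neg hb1
  rw [intervalIntegral.integral_const, hsplit, smul_eq_mul] at hint
  have hadd := intervalIntegral.integral_add_adjacent_intervals hb0 hb1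
  have hXt := hX t htI'
  have hvt := hvX t htI'
  have hnorm : ‖(X t, t) - (x₀, t₀)‖ ≤ (C + 1) * (t₀ - t) := by
    rw [Prod.mk_sub_mk, Prod.norm_mk]
    have h1 : 0 < t₀ - t := by linarith [htpos.2]
    refine max_le ?_ ?_
    · rw [Real.norm_eq_abs]
      exact (hXlip t htI').trans (by nlinarith)
    · rw [Real.norm_eq_abs, abs_sub_comm, abs_of_pos h1]
      nlinarith
  have hFv : F' ((X t, t) - (x₀, t₀)) = (X t - x₀) * p + (t - t₀) * q := by
    have h1 : ((X t, t) - (x₀, t₀) : ℝ × ℝ) = (X t - x₀) • (1, 0) + (t - t₀) • (0, 1) := by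
      simp
    rw [h1, map_add, map_smul, map_smul, smul_eq_mul, smul_eq_mul]
  have hbound : ε / (C + 1) * ‖(X t, t) - (x₀, t₀)‖ ≤ ε * (t₀ - t) := by
    calc _ ≤ ε / (C + 1) * ((C + 1) * (t₀ - t)) := by gcongr
      _ = ε * (t₀ - t) := by field_simp
  rw [hFv, Real.norm_eq_abs] at hfrt
  have hfr1 := (abs_le.1 (hfrt.trans hbound)).2
  have hX' : (∫ s in t..t₀, g s) = x₀ - X t := by rw [hXt]; ring
  rw [hX'] at hint
  simp only at hmt hfr1
  have hpos' : 0 < t₀ - t := by linarith [htpos.2]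
  have hfinal : (q - G x₀ t₀ p - 2 * ε) * (t₀ - t) ≤ 0 := by nlinarith
  have h3 : 0 < q - G x₀ t₀ p - 2 * ε := by rw [hε]; linarith
  nlinarith [mul_pos h3 hpos']

theorem IsL1Subsolution.neg {T : ℝ} {c : ℝ → ℝ → ℝ} {u₀ : ℝ → ℝ} {v : ℝ → ℝ → ℝ}
    (h : IsL1Subsolution T (fun x t => -c x t) (fun x => -u₀ x) (fun x t => -v x t)) :
    IsL1Supersolution T c u₀ v := by
  obtain ⟨h1, h2, h3⟩ := h
  refine ⟨?_, fun x => by simpa using h2 x, ?_⟩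
  · intro z hz y hy
    have := h1 z hz (-y) (by simpa using hy)
    filter_upwards [this] with w hw
    simpa using hw
  · intro x₀ t₀ b φ G ht₀ hb hφ hG hmin ⟨δ, hδ, hcG⟩
    have hd1 : deriv (fun x' => -φ x' t₀) x₀ = -deriv (fun x' => φ x' t₀) x₀ := deriv.fun_neg
    have hd2 : deriv (fun t' => -φ x₀ t') t₀ = -deriv (fun t' => φ x₀ t') t₀ := deriv.fun_neg
    have := h3 x₀ t₀ (fun t => -b t) (fun x t => -φ x t) (fun x t p => -G x t (-p)) ht₀ hb.neg
      hφ.neg ?_ ?_ ?_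
    · rw [hd1, hd2, neg_neg] at this
      linarith
    · have hm : ContinuousOn (fun z : ℝ × ℝ × ℝ => (z.1, z.2.1, -z.2.2))
          (univ ×ˢ Ioo 0 T ×ˢ univ) := by fun_prop
      refine (hG.comp hm ?_).neg
      intro z hz
      exact ⟨mem_univ _, hz.2.1, mem_univ _⟩
    · refine (hmin.neg).congr ?_ ?_
      · filter_upwards with z
        simp only [intervalIntegral.integral_neg]
        ring
      · exact ⟨mem_univ _, ht₀⟩
    · refine ⟨δ, hδ, ?_⟩
      rw [hd1]
      filter_upwards [hcG] with t ht h1 h2 x p hx hp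
      have := ht h1 h2 x (-p) hx (by rw [← abs_neg]; convert hp using 2; ring)
      rw [abs_neg] at this
      linarith

theorem IsL1Supersolution.neg {T : ℝ} {c : ℝ → ℝ → ℝ} {u₀ : ℝ → ℝ} {v : ℝ → ℝ → ℝ}
    (h : IsL1Supersolution T c u₀ v) :
    IsL1Subsolution T (fun x t => -c x t) (fun x => -u₀ x) (fun x t => -v x t) := by
  obtain ⟨h1, h2, h3⟩ := h
  refine ⟨?_, fun x => by simpa using h2 x, ?_⟩
  · intro z hz y hy
    have := h1 z hz (-y) (by simpa using (neg_lt.1 hy))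
    filter_upwards [this] with w hw
    simpa using (neg_lt.1 hw)
  · intro x₀ t₀ b φ G ht₀ hb hφ hG hmax ⟨δ, hδ, hcG⟩
    have hd1 : deriv (fun x' => -φ x' t₀) x₀ = -deriv (fun x' => φ x' t₀) x₀ := deriv.fun_neg
    have hd2 : deriv (fun t' => -φ x₀ t') t₀ = -deriv (fun t' => φ x₀ t') t₀ := deriv.fun_neg
    have := h3 x₀ t₀ (fun t => -b t) (fun x t => -φ x t) (fun x t p => -G x t (-p)) ht₀ hb.neg
      hφ.neg ?_ ?_ ?_
    · rw [hd1, hd2, neg_neg] at this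
      linarith
    · have hm : ContinuousOn (fun z : ℝ × ℝ × ℝ => (z.1, z.2.1, -z.2.2))
          (univ ×ˢ Ioo 0 T ×ˢ univ) := by fun_prop
      refine (hG.comp hm ?_).neg
      intro z hz
      exact ⟨mem_univ _, hz.2.1, mem_univ _⟩
    · refine (hmax.neg).congr ?_ ?_
      · filter_upwards with z
        simp only [intervalIntegral.integral_neg]
        ring
      · exact ⟨mem_univ _, ht₀⟩
    · refine ⟨δ, hδ, ?_⟩
      rw [hd1]
      filter_upwards [hcG] with t ht h1 h2 x p hx hp
      have := ht h1 h2 x (-p) hx (by rw [← abs_neg]; convert hp using 2; ring)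
      rw [abs_neg] at this
      linarith

/-! ### Comparison with smooth barriers -/

/-- Comparison of a subsolution with a smooth strict supersolution `Φ` on a box. Only a local
constant upper bound `κ` of the velocity enters, so that no nonlocal quantity appears. -/
theorem IsL1Subsolution.le_barrier {T : ℝ} {c : ℝ → ℝ → ℝ} {u₀ : ℝ → ℝ} {v : ℝ → ℝ → ℝ}
    (hsub : IsL1Subsolution T c u₀ v)
    (hv : ContinuousOn (fun z : ℝ × ℝ => v z.1 z.2) (univ ×ˢ Ico 0 T))
    {s τ B : ℝ} (hs : 0 ≤ s) (hτ : τ ≤ T) {Φ : ℝ → ℝ → ℝ}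
    (hΦ : ContDiff ℝ ∞ (fun z : ℝ × ℝ => Φ z.1 z.2))
    (hinit : ∀ x ∈ Icc (-B) B, v x s ≤ Φ x s)
    (hlat : ∀ t ∈ Ico s τ, v (-B) t ≤ Φ (-B) t ∧ v B t ≤ Φ B t)
    (hint : ∀ x₀ ∈ Ioo (-B) B, ∀ t₀ ∈ Ioo s τ, ∃ κ : ℝ, ∃ δ > 0,
      (∀ᵐ t : ℝ, t ∈ Ioo s τ → |t - t₀| < δ → ∀ x, |x - x₀| < δ → c x t ≤ κ) ∧
      κ * |deriv (fun x => Φ x t₀) x₀| < deriv (fun t => Φ x₀ t) t₀) :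
    ∀ t ∈ Ico s τ, ∀ x ∈ Icc (-B) B, v x t ≤ Φ x t := by
  intro t₁ ht₁ x₁ hx₁
  by_contra! hlt
  have hst₁ : s < t₁ := by
    rcases ht₁.1.lt_or_eq with h | h
    · exact h
    · subst h; exact absurd (hinit x₁ hx₁) (not_le.2 hlt)
  obtain ⟨t₂, ht₁₂, ht₂τ⟩ := exists_between ht₁.2
  obtain ⟨t₃, ht₂₃, ht₃τ⟩ := exists_between ht₂τ
  set K : Set (ℝ × ℝ) := Icc (-B) B ×ˢ Icc s t₃ with hK
  have hKc : IsCompact K := isCompact_Icc.prod isCompact_Icc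
  have hKsub : K ⊆ univ ×ˢ Ico 0 T := by
    rintro ⟨x, t⟩ ⟨-, h2⟩
    exact ⟨mem_univ _, hs.trans h2.1, lt_of_le_of_lt h2.2 (ht₃τ.trans_le hτ)⟩
  have hdc : ContinuousOn (fun z : ℝ × ℝ => v z.1 z.2 - Φ z.1 z.2) K :=
    (hv.mono hKsub).sub hΦ.continuous.continuousOn
  have hne : (x₁, t₁) ∈ K := ⟨hx₁, ht₁.1, (ht₁₂.trans ht₂₃).le⟩
  obtain ⟨A, hA⟩ := (hKc.image_of_continuousOn hdc).bddAbove
  set η := v x₁ t₁ - Φ x₁ t₁ with hη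
  have hη0 : 0 < η := by rw [hη]; linarith
  -- a penalisation in time, small at `t₁` and large at `t₃`, keeps the maximum away from `t₃`
  obtain ⟨lam, hlam0, hlam1, hlam2⟩ : ∃ lam : ℝ, 0 < lam ∧ Real.exp (lam * (t₁ - t₂)) < η ∧
      A < Real.exp (lam * (t₃ - t₂)) := by
    have h1 : Tendsto (fun l : ℝ => Real.exp (l * (t₁ - t₂))) atTop (𝓝 0) :=
      Real.tendsto_exp_atBot.comp (tendsto_id.atTop_mul_const_of_neg (by linarith))
    have h2 : Tendsto (fun l : ℝ => Real.exp (l * (t₃ - t₂))) atTop atTop :=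
      Real.tendsto_exp_atTop.comp (tendsto_id.atTop_mul_const (by linarith))
    obtain ⟨l, h3, h4, h5⟩ := ((eventually_gt_atTop (0 : ℝ)).and
      ((h1.eventually (gt_mem_nhds hη0)).and (h2.eventually (eventually_gt_atTop A)))).exists
    exact ⟨l, h3, h4, h5⟩
  set Ψ : ℝ → ℝ → ℝ := fun x t => Φ x t + Real.exp (lam * (t - t₂)) with hΨ
  have hΨc : ContDiff ℝ ∞ (fun z : ℝ × ℝ => Ψ z.1 z.2) := by
    refine hΦ.add (Real.contDiff_exp.comp ?_)
    exact contDiff_const.mul (contDiff_snd.sub contDiff_const)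
  have hFc : ContinuousOn (fun z : ℝ × ℝ => v z.1 z.2 - Ψ z.1 z.2) K :=
    (hv.mono hKsub).sub hΨc.continuous.continuousOn
  obtain ⟨⟨x₀, t₀⟩, hz₀, hmax⟩ := hKc.exists_isMaxOn ⟨_, hne⟩ hFc
  have hpos : 0 < v x₀ t₀ - Ψ x₀ t₀ := by
    have h1 : v x₁ t₁ - Ψ x₁ t₁ ≤ v x₀ t₀ - Ψ x₀ t₀ := hmax hne
    refine lt_of_lt_of_le ?_ h1
    simp only [hΨ]
    linarith
  have hpos' : Φ x₀ t₀ < v x₀ t₀ := by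
    have := Real.exp_pos (lam * (t₀ - t₂))
    simp only [hΨ] at hpos
    linarith
  have ht₀I : t₀ ∈ Ico s τ := ⟨hz₀.2.1, hz₀.2.2.trans_lt ht₃τ⟩
  have h1 : t₀ ≠ s := by
    rintro rfl
    exact absurd (hinit x₀ hz₀.1) (not_le.2 hpos')
  have h2 : x₀ ≠ -B := by
    rintro rfl
    exact absurd (hlat t₀ ht₀I).1 (not_le.2 hpos')
  have h3 : x₀ ≠ B := by
    rintro rfl
    exact absurd (hlat t₀ ht₀I).2 (not_le.2 hpos')
  have h4 : t₀ ≠ t₃ := by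
    rintro rfl
    have h5 : v x₀ t₀ - Φ x₀ t₀ ≤ A := hA ⟨(x₀, t₀), hz₀, rfl⟩
    simp only [hΨ] at hpos
    linarith
  have hx₀ : x₀ ∈ Ioo (-B) B := ⟨lt_of_le_of_ne hz₀.1.1 (Ne.symm h2), lt_of_le_of_ne hz₀.1.2 h3⟩
  have hst₀ : s < t₀ := lt_of_le_of_ne hz₀.2.1 (Ne.symm h1)
  have ht₀₃ : t₀ < t₃ := lt_of_le_of_ne hz₀.2.2 h4
  have ht₀T : t₀ ∈ Ioo 0 T := ⟨hs.trans_lt hst₀, ht₀I.2.trans_le hτ⟩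
  have hKn : K ∈ 𝓝 (x₀, t₀) := by
    rw [hK]
    exact prod_mem_nhds (Icc_mem_nhds hx₀.1 hx₀.2) (Icc_mem_nhds hst₀ ht₀₃)
  have hloc : IsLocalMax (fun z : ℝ × ℝ => v z.1 z.2 - Ψ z.1 z.2) (x₀, t₀) :=
    hmax.isLocalMax hKn
  obtain ⟨κ, δ, hδ, hcκ, hκ⟩ := hint x₀ hx₀ t₀ ⟨hst₀, ht₀I.2⟩
  have hdx : deriv (fun x => Ψ x t₀) x₀ = deriv (fun x => Φ x t₀) x₀ := by
    simp only [hΨ]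
    exact deriv_add_const _
  have hΦd := (hΦ.differentiable (by simp)) (x₀, t₀)
  have hΦt : DifferentiableAt ℝ (fun t => Φ x₀ t) t₀ :=
    (deriv_snd_of_hasFDerivAt hΦd.hasFDerivAt).differentiableAt
  have hexp : HasDerivAt (fun t => Real.exp (lam * (t - t₂)))
      (Real.exp (lam * (t₀ - t₂)) * lam) t₀ := by
    have := (((hasDerivAt_id t₀).sub_const t₂).const_mul lam).exp
    simpa using this
  have hdt : deriv (fun t => Ψ x₀ t) t₀ =
      deriv (fun t => Φ x₀ t) t₀ + Real.exp (lam * (t₀ - t₂)) * lam :=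
    (hΦt.hasDerivAt.add hexp).deriv
  have key := hsub.2.2 x₀ t₀ (fun _ => 0) Ψ (fun _ _ p => κ * |p|) ht₀T
    (integrable_zero _ _ _) hΨc.contDiffOn (by fun_prop) ?_ ?_
  · rw [hdx, hdt] at key
    have := mul_pos (Real.exp_pos (lam * (t₀ - t₂))) hlam0
    linarith
  · have : IsLocalMax (fun z : ℝ × ℝ => v z.1 z.2 - (∫ _s in (0 : ℝ)..z.2, (0 : ℝ)) - Ψ z.1 z.2)
        (x₀, t₀) := by simpa using hloc
    exact this.on _
  · refine ⟨min δ (min (t₀ - s) (τ - t₀)),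
      lt_min hδ (lt_min (by linarith) (by linarith [ht₀I.2])), ?_⟩
    filter_upwards [hcκ] with t ht _ hδt x p hx _
    have h5 := abs_lt.1 (hδt.trans_le (min_le_right _ _))
    have h6 := min_le_left (t₀ - s) (τ - t₀)
    have h7 := min_le_right (t₀ - s) (τ - t₀)
    have := ht ⟨by linarith [h5.1], by linarith [h5.2]⟩ (hδt.trans_le (min_le_left _ _)) x
      (hx.trans_le (min_le_left _ _))
    rw [sub_zero]
    exact mul_le_mul_of_nonneg_right this (abs_nonneg p)

/-- Comparison of a supersolution with a smooth strict subsolution on a box. -/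
theorem IsL1Supersolution.barrier_le {T : ℝ} {c : ℝ → ℝ → ℝ} {u₀ : ℝ → ℝ} {v : ℝ → ℝ → ℝ}
    (hsup : IsL1Supersolution T c u₀ v)
    (hv : ContinuousOn (fun z : ℝ × ℝ => v z.1 z.2) (univ ×ˢ Ico 0 T))
    {s τ B : ℝ} (hs : 0 ≤ s) (hτ : τ ≤ T) {Φ : ℝ → ℝ → ℝ}
    (hΦ : ContDiff ℝ ∞ (fun z : ℝ × ℝ => Φ z.1 z.2))
    (hinit : ∀ x ∈ Icc (-B) B, Φ x s ≤ v x s)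
    (hlat : ∀ t ∈ Ico s τ, Φ (-B) t ≤ v (-B) t ∧ Φ B t ≤ v B t)
    (hint : ∀ x₀ ∈ Ioo (-B) B, ∀ t₀ ∈ Ioo s τ, ∃ κ : ℝ, ∃ δ > 0,
      (∀ᵐ t : ℝ, t ∈ Ioo s τ → |t - t₀| < δ → ∀ x, |x - x₀| < δ → κ ≤ c x t) ∧
      deriv (fun t => Φ x₀ t) t₀ < κ * |deriv (fun x => Φ x t₀) x₀|) :
    ∀ t ∈ Ico s τ, ∀ x ∈ Icc (-B) B, Φ x t ≤ v x t := by
  intro t ht x hx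
  have := hsup.neg.le_barrier (s := s) (τ := τ) (B := B) hv.neg hs hτ (Φ := fun x t => -Φ x t)
    hΦ.neg (fun x hx => neg_le_neg (hinit x hx))
    (fun t ht => ⟨neg_le_neg (hlat t ht).1, neg_le_neg (hlat t ht).2⟩) ?_ t ht x hx
  · exact neg_le_neg_iff.1 this
  · intro x₀ hx₀ t₀ ht₀
    obtain ⟨κ, δ, hδ, h1, h2⟩ := hint x₀ hx₀ t₀ ht₀
    refine ⟨-κ, δ, hδ, ?_, ?_⟩
    · filter_upwards [h1] with t ht h3 h4 x hx
      exact neg_le_neg (ht h3 h4 x hx)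
    · rw [deriv.fun_neg, deriv.fun_neg, abs_neg]
      linarith

/-! ### Carathéodory differential equations -/

/-- Right-hand sides that are measurable in time and uniformly Lipschitz continuous in space. -/
structure Caratheodory (f : ℝ → ℝ → ℝ) (L M : ℝ) : Prop where
  meas : ∀ x, Measurable (f x)
  lip : ∀ t x y, |f x t - f y t| ≤ L * |x - y|
  bound_zero : ∀ t, |f 0 t| ≤ M

/-- `X` solves `X' = f(X, t)`, `X(t₀) = x₀`, in integrated form on the whole line. -/
def IsCurve (f : ℝ → ℝ → ℝ) (t₀ x₀ : ℝ) (X : ℝ → ℝ) : Prop :=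
  Continuous X ∧ ∀ t, X t = x₀ + ∫ s in t₀..t, f (X s) s

section

variable {f : ℝ → ℝ → ℝ} {L M : ℝ}

theorem Caratheodory.nonneg (hf : Caratheodory f L M) : 0 ≤ L := by
  have := (abs_nonneg _).trans (hf.lip 0 1 0)
  simpa using this

theorem Caratheodory.measurable_comp (hf : Caratheodory f L M) {X : ℝ → ℝ} (hX : Continuous X) :
    Measurable fun s => f (X s) s := by
  have h1 : Measurable (Function.uncurry f) := by
    refine measurable_uncurry_of_continuous_of_measurable (fun t => ?_) hf.meas
    refine LipschitzWith.continuous (K := L.toNNReal) (LipschitzWith.of_dist_le_mul fun x y => ?_)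
    rw [Real.dist_eq, Real.dist_eq, Real.coe_toNNReal _ hf.nonneg]
    exact hf.lip t x y
  exact h1.comp (hX.measurable.prodMk measurable_id)

theorem Caratheodory.intervalIntegrable (hf : Caratheodory f L M) {X : ℝ → ℝ} (hX : Continuous X)
    (a b : ℝ) : IntervalIntegrable (fun s => f (X s) s) volume a b := by
  have h1 : IntervalIntegrable (fun s => M + L * |X s|) volume a b :=
    Continuous.intervalIntegrable (by fun_prop) a b
  refine h1.mono_fun (hf.measurable_comp hX).aestronglyMeasurable ?_
  filter_upwards with s
  have h2 := hf.lip s (X s) 0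
  have h3 := hf.bound_zero s
  rw [sub_zero] at h2
  rw [Real.norm_eq_abs, Real.norm_eq_abs]
  refine le_trans ?_ (le_abs_self _)
  calc |f (X s) s| = |(f (X s) s - f 0 s) + f 0 s| := by ring_nf
    _ ≤ |f (X s) s - f 0 s| + |f 0 s| := abs_add_le _ _
    _ ≤ _ := by linarith

theorem gronwall_integral {g : ℝ → ℝ} (hg : Continuous g) (hg0 : ∀ t, 0 ≤ g t) {d L a b : ℝ}
    (hL : 0 ≤ L) (h : ∀ t ∈ Icc a b, g t ≤ d + L * ∫ s in a..t, g s) :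
    ∀ t ∈ Icc a b, g t ≤ d * Real.exp (L * (t - a)) := by
  have hd : ∀ t, HasDerivAt (fun t => d + L * ∫ s in a..t, g s) (L * g t) t := fun t =>
    ((intervalIntegral.integral_hasDerivAt_right (hg.intervalIntegrable _ _)
      hg.stronglyMeasurable.stronglyMeasurableAtFilter hg.continuousAt).const_mul L).const_add d
  intro t ht
  have h0 : 0 ≤ d := by
    have := h a ⟨le_rfl, ht.1.trans ht.2⟩
    simp only [intervalIntegral.integral_same, mul_zero, add_zero] at this
    exact (hg0 a).trans this
  have key := norm_le_gronwallBound_of_norm_deriv_right_le (f := fun t => d + L * ∫ s in a..t, g s)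
    (f' := fun t => L * g t) (δ := d) (K := L) (ε := 0) (a := a) (b := b)
    (fun t _ => (hd t).continuousAt.continuousWithinAt) (fun t _ => (hd t).hasDerivWithinAt)
    (by simp [abs_of_nonneg h0]) ?_ t ht
  · rw [gronwallBound_ε0] at key
    exact (h t ht).trans ((le_abs_self _).trans key)
  · intro t ht
    have h1 := h t ⟨ht.1, ht.2.le⟩
    rw [Real.norm_eq_abs, Real.norm_eq_abs, abs_of_nonneg (mul_nonneg hL (hg0 t)), add_zero]
    exact mul_le_mul_of_nonneg_left (h1.trans (le_abs_self _)) hL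

theorem IsCurve.sub_eq (hf : Caratheodory f L M) {t₀ x₀ : ℝ} {X : ℝ → ℝ} (hX : IsCurve f t₀ x₀ X)
    (s t : ℝ) : X t - X s = ∫ r in s..t, f (X r) r := by
  rw [hX.2 t, hX.2 s]
  have := intervalIntegral.integral_add_adjacent_intervals
    (hf.intervalIntegrable hX.1 t₀ s) (hf.intervalIntegrable hX.1 s t)
  linarith

theorem IsCurve.rebase (hf : Caratheodory f L M) {t₀ x₀ : ℝ} {X : ℝ → ℝ} (hX : IsCurve f t₀ x₀ X)
    (s : ℝ) : IsCurve f s (X s) X :=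
  ⟨hX.1, fun t => by rw [← hX.sub_eq hf s t]; ring⟩

theorem IsCurve.self_eq {t₀ x₀ : ℝ} {X : ℝ → ℝ} (hX : IsCurve f t₀ x₀ X) : X t₀ = x₀ := by
  rw [hX.2 t₀]; simp

theorem IsCurve.abs_sub_le (hf : Caratheodory f L M) {t₀ x₀ t₁ x₁ : ℝ} {X Y : ℝ → ℝ}
    (hX : IsCurve f t₀ x₀ X) (hY : IsCurve f t₁ x₁ Y) (s t : ℝ) :
    |X t - Y t| ≤ |X s - Y s| * Real.exp (L * |t - s|) := by
  have hc : Continuous fun r => |X r - Y r| := (hX.1.sub hY.1).abs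
  -- the integral inequality on an interval with either end point as base
  have hbase : ∀ a b, |X b - Y b| ≤ |X a - Y a| + |∫ r in a..b, (L * |X r - Y r|)| := by
    intro a b
    have h1 : X b - Y b = (X a - Y a) + ∫ r in a..b, (f (X r) r - f (Y r) r) := by
      rw [intervalIntegral.integral_sub (hf.intervalIntegrable hX.1 a b)
        (hf.intervalIntegrable hY.1 a b), ← hX.sub_eq hf, ← hY.sub_eq hf]
      ring
    rw [h1]
    refine (abs_add_le _ _).trans (add_le_add_right ?_ _)
    exact intervalIntegral.norm_integral_le_abs_of_norm_le
      (f := fun r => f (X r) r - f (Y r) r) (μ := volume)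
      (Eventually.of_forall fun r => hf.lip r _ _)
      (Continuous.intervalIntegrable (by fun_prop) _ _)
  rcases le_total s t with hst | hst
  · have := gronwall_integral hc (fun _ => abs_nonneg _) (d := |X s - Y s|) (a := s) (b := t)
      hf.nonneg (fun r hr => ?_) t ⟨hst, le_rfl⟩
    · rwa [abs_of_nonneg (by linarith : 0 ≤ t - s)]
    · have h1 := hbase s r
      have h0 : 0 ≤ L * ∫ w in s..r, |X w - Y w| :=
        mul_nonneg hf.nonneg (intervalIntegral.integral_nonneg hr.1 fun _ _ => abs_nonneg _)
      rwa [intervalIntegral.integral_const_mul, abs_of_nonneg h0] at h1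
  · have := gronwall_integral (g := fun r => |X (-r) - Y (-r)|) (hc.comp continuous_neg)
      (fun _ => abs_nonneg _) (d := |X s - Y s|) (a := -s) (b := -t)
      hf.nonneg (fun r hr => ?_) (-t) ⟨by linarith, le_rfl⟩
    · rw [abs_of_nonpos (by linarith : t - s ≤ 0)]
      simpa [neg_add_eq_sub] using this
    · have h1 := hbase s (-r)
      have h0 : 0 ≤ L * ∫ w in (-r)..s, |X w - Y w| :=
        mul_nonneg hf.nonneg (intervalIntegral.integral_nonneg (by linarith [hr.1])
          fun _ _ => abs_nonneg _)
      rw [intervalIntegral.integral_symm, abs_neg, intervalIntegral.integral_const_mul,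
        abs_of_nonneg h0] at h1
      rwa [intervalIntegral.integral_comp_neg (fun r => |X r - Y r|), neg_neg]

theorem IsCurve.eq (hf : Caratheodory f L M) {t₀ x₀ : ℝ} {X Y : ℝ → ℝ}
    (hX : IsCurve f t₀ x₀ X) (hY : IsCurve f t₀ x₀ Y) : X = Y := by
  funext t
  have := hX.abs_sub_le hf hY t₀ t
  rw [hX.self_eq, hY.self_eq, sub_self, abs_zero, zero_mul] at this
  exact sub_eq_zero.1 (abs_nonpos_iff.1 this)

theorem abs_integral_exp_le {lam : ℝ} (hlam : 0 < lam) (t₀ t : ℝ) :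
    |∫ s in t₀..t, Real.exp (lam * |s - t₀|)| ≤ Real.exp (lam * |t - t₀|) / lam := by
  rcases le_total t₀ t with h | h
  · have h1 : ∫ s in t₀..t, Real.exp (lam * |s - t₀|) =
        ∫ s in t₀..t, Real.exp (lam * (s - t₀)) := by
      refine intervalIntegral.integral_congr fun s hs => ?_
      rw [uIcc_of_le h] at hs
      simp only [abs_of_nonneg (by linarith [hs.1] : 0 ≤ s - t₀)]
    have h2 : ∫ s in t₀..t, Real.exp (lam * (s - t₀)) =
        Real.exp (lam * (t - t₀)) / lam - Real.exp (lam * (t₀ - t₀)) / lam := by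
      refine intervalIntegral.integral_eq_sub_of_hasDerivAt
        (f := fun s => Real.exp (lam * (s - t₀)) / lam) (fun s _ => ?_)
        (Continuous.intervalIntegrable (by fun_prop) _ _)
      have := ((((hasDerivAt_id s).sub_const t₀).const_mul lam).exp).div_const lam
      refine this.congr_deriv ?_
      simp only [id]
      field_simp
    have h3 : 0 ≤ ∫ s in t₀..t, Real.exp (lam * |s - t₀|) :=
      intervalIntegral.integral_nonneg h fun s _ => (Real.exp_pos _).le
    rw [abs_of_nonneg h3, h1, h2, abs_of_nonneg (by linarith : 0 ≤ t - t₀)]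
    have : 0 ≤ Real.exp (lam * (t₀ - t₀)) / lam := by positivity
    linarith
  · have h1 : ∫ s in t..t₀, Real.exp (lam * |s - t₀|) =
        ∫ s in t..t₀, Real.exp (lam * (t₀ - s)) := by
      refine intervalIntegral.integral_congr fun s hs => ?_
      rw [uIcc_of_le h] at hs
      simp only [abs_of_nonpos (by linarith [hs.2] : s - t₀ ≤ 0), neg_sub]
    have h2 : ∫ s in t..t₀, Real.exp (lam * (t₀ - s)) =
        -Real.exp (lam * (t₀ - t₀)) / lam - -Real.exp (lam * (t₀ - t)) / lam := by
      refine intervalIntegral.integral_eq_sub_of_hasDerivAt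
        (f := fun s => -Real.exp (lam * (t₀ - s)) / lam) (fun s _ => ?_)
        (Continuous.intervalIntegrable (by fun_prop) _ _)
      have := ((((hasDerivAt_id s).const_sub t₀).const_mul lam).exp).neg.div_const lam
      refine this.congr_deriv ?_
      simp only [id]
      field_simp
    have h3 : 0 ≤ ∫ s in t..t₀, Real.exp (lam * |s - t₀|) :=
      intervalIntegral.integral_nonneg h fun s _ => (Real.exp_pos _).le
    rw [intervalIntegral.integral_symm, abs_neg, abs_of_nonneg h3, h1, h2,
      abs_of_nonpos (by linarith : t - t₀ ≤ 0), neg_sub]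
    have : 0 ≤ Real.exp (lam * (t₀ - t₀)) / lam := by positivity
    rw [neg_div, neg_div]
    linarith

/-- The Picard map for `X' = f(X, t)`, `X(t₀) = x₀`, written for the rescaled unknown
`Z(t) = exp (-lam |t - t₀|) X(t)`. -/
noncomputable def picard (f : ℝ → ℝ → ℝ) (t₀ x₀ lam : ℝ) (Z : ℝ → ℝ) (t : ℝ) : ℝ :=
  Real.exp (-(lam * |t - t₀|)) * (x₀ + ∫ s in t₀..t, f (Real.exp (lam * |s - t₀|) * Z s) s)

theorem continuous_picard (hf : Caratheodory f L M) (t₀ x₀ lam : ℝ) {Z : ℝ → ℝ}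
    (hZ : Continuous Z) : Continuous (picard f t₀ x₀ lam Z) := by
  have h1 : Continuous fun s => Real.exp (lam * |s - t₀|) * Z s := by fun_prop
  have h2 := intervalIntegral.continuous_primitive (fun a b => hf.intervalIntegrable h1 a b) t₀
  unfold picard
  fun_prop

theorem abs_picard_sub_le (hf : Caratheodory f L M) (t₀ x₀ : ℝ) {lam : ℝ} (hlam : 0 < lam)
    {Z Z' : ℝ → ℝ} (hZ : Continuous Z) (hZ' : Continuous Z') {D : ℝ} (hD : ∀ s, |Z s - Z' s| ≤ D)
    (t : ℝ) : |picard f t₀ x₀ lam Z t - picard f t₀ x₀ lam Z' t| ≤ L / lam * D := by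
  have hD0 : 0 ≤ D := (abs_nonneg _).trans (hD 0)
  have h1 : Continuous fun s => Real.exp (lam * |s - t₀|) * Z s := by fun_prop
  have h1' : Continuous fun s => Real.exp (lam * |s - t₀|) * Z' s := by fun_prop
  have h0 : Continuous fun s => L * D * Real.exp (lam * |s - t₀|) := by fun_prop
  have h2 : |∫ s in t₀..t, (f (Real.exp (lam * |s - t₀|) * Z s) s -
      f (Real.exp (lam * |s - t₀|) * Z' s) s)| ≤
      |∫ s in t₀..t, L * D * Real.exp (lam * |s - t₀|)| := by
    refine intervalIntegral.norm_integral_le_abs_of_norm_le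
      (f := fun s => f (Real.exp (lam * |s - t₀|) * Z s) s - f (Real.exp (lam * |s - t₀|) * Z' s) s)
      (μ := volume) (Eventually.of_forall fun s => ?_) (h0.intervalIntegrable _ _)
    refine (hf.lip s _ _).trans ?_
    rw [← mul_sub, abs_mul, abs_of_pos (Real.exp_pos _)]
    have := mul_le_mul_of_nonneg_left (hD s)
      (mul_nonneg hf.nonneg (Real.exp_pos (lam * |s - t₀|)).le)
    linarith
  rw [intervalIntegral.integral_const_mul, abs_mul, abs_of_nonneg (mul_nonneg hf.nonneg hD0)] at h2
  have h3 := mul_le_mul_of_nonneg_left (abs_integral_exp_le hlam t₀ t) (mul_nonneg hf.nonneg hD0)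
  unfold picard
  rw [← mul_sub, add_sub_add_left_eq_sub, ← intervalIntegral.integral_sub
    (hf.intervalIntegrable h1 _ _) (hf.intervalIntegrable h1' _ _), abs_mul,
    abs_of_pos (Real.exp_pos _)]
  calc _ ≤ Real.exp (-(lam * |t - t₀|)) * (L * D * (Real.exp (lam * |t - t₀|) / lam)) := by
        gcongr
        exact h2.trans h3
    _ = L / lam * D * (Real.exp (-(lam * |t - t₀|)) * Real.exp (lam * |t - t₀|)) := by ring
    _ = L / lam * D := by rw [← Real.exp_add]; simp

theorem abs_picard_zero_le (hf : Caratheodory f L M) (t₀ x₀ : ℝ) {lam : ℝ} (hlam : 0 < lam)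
    (t : ℝ) : |picard f t₀ x₀ lam (fun _ => 0) t| ≤ |x₀| + M / lam := by
  have hM : 0 ≤ M := (abs_nonneg _).trans (hf.bound_zero 0)
  have h1 : |∫ s in t₀..t, f 0 s| ≤ M * |t - t₀| :=
    intervalIntegral.norm_integral_le_of_norm_le_const (f := f 0) fun s _ => hf.bound_zero s
  have h2 : |t - t₀| ≤ Real.exp (lam * |t - t₀|) / lam := by
    rw [le_div_iff₀ hlam]
    have := Real.add_one_le_exp (lam * |t - t₀|)
    linarith
  unfold picard
  simp only [mul_zero]
  rw [abs_mul, abs_of_pos (Real.exp_pos _)]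
  have h3 : Real.exp (-(lam * |t - t₀|)) ≤ 1 := Real.exp_le_one_iff.2 (by
    have := mul_nonneg hlam.le (abs_nonneg (t - t₀)); linarith)
  calc _ ≤ Real.exp (-(lam * |t - t₀|)) * (|x₀| + M * (Real.exp (lam * |t - t₀|) / lam)) := by
        gcongr
        refine (abs_add_le _ _).trans ?_
        gcongr
        exact h1.trans (by gcongr)
    _ = Real.exp (-(lam * |t - t₀|)) * |x₀| +
          M / lam * (Real.exp (-(lam * |t - t₀|)) * Real.exp (lam * |t - t₀|)) := by ring
    _ ≤ 1 * |x₀| + M / lam * 1 := by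
        rw [← Real.exp_add]
        simp only [neg_add_cancel, Real.exp_zero]
        gcongr
    _ = _ := by ring

/-- For `lam > L` the rescaled Picard map is a contraction on bounded functions on the whole line,
so that solutions exist globally in one step. -/
theorem exists_isCurve (hf : Caratheodory f L M) (t₀ x₀ : ℝ) : ∃ X, IsCurve f t₀ x₀ X := by
  have hL := hf.nonneg
  set lam := 2 * L + 2 with hlam_def
  have hlam : 0 < lam := by positivity
  have hbd : ∀ (Z : BoundedContinuousFunction ℝ ℝ) t,
      ‖picard f t₀ x₀ lam Z t‖ ≤ L / lam * ‖Z‖ + (|x₀| + M / lam) := by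
    intro Z t
    have h1 := abs_picard_sub_le hf t₀ x₀ hlam Z.continuous continuous_const (Z' := fun _ => 0)
      (D := ‖Z‖) (fun s => by simpa using Z.norm_coe_le_norm s) t
    have h2 := abs_picard_zero_le hf t₀ x₀ hlam t
    rw [Real.norm_eq_abs]
    calc |picard f t₀ x₀ lam Z t| = |(picard f t₀ x₀ lam Z t - picard f t₀ x₀ lam (fun _ => 0) t)
          + picard f t₀ x₀ lam (fun _ => 0) t| := by ring_nf
      _ ≤ _ := (abs_add_le _ _).trans (add_le_add h1 h2)
  let P : BoundedContinuousFunction ℝ ℝ → BoundedContinuousFunction ℝ ℝ := fun Z =>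
    BoundedContinuousFunction.ofNormedAddCommGroup (picard f t₀ x₀ lam Z)
      (continuous_picard hf t₀ x₀ lam Z.continuous) _ (hbd Z)
  have hP : ContractingWith (1 / 2) P := by
    refine ⟨by norm_num, LipschitzWith.of_dist_le_mul fun Z Z' => ?_⟩
    refine (BoundedContinuousFunction.dist_le (by positivity)).2 fun t => ?_
    have h1 := abs_picard_sub_le hf t₀ x₀ hlam Z.continuous Z'.continuous
      (D := dist Z Z') (fun s => BoundedContinuousFunction.dist_coe_le_dist (f := Z) (g := Z') s) t
    have h2 : L / lam ≤ 1 / 2 := by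
      rw [div_le_div_iff₀ hlam two_pos]; linarith
    refine h1.trans ?_
    push_cast
    gcongr
  obtain ⟨Z, hZ⟩ : ∃ Z, P Z = Z := ⟨_, hP.fixedPoint_isFixedPt⟩
  refine ⟨fun t => Real.exp (lam * |t - t₀|) * Z t, by fun_prop, fun t => ?_⟩
  have h1 : Z t = picard f t₀ x₀ lam Z t := by
    conv_lhs => rw [← hZ]
    rfl
  beta_reduce
  rw [h1]
  unfold picard
  rw [← mul_assoc, ← Real.exp_add]
  simp

end

/-! ### Transport of the datum along characteristics -/

/-- The position at time `0` of the solution of `X' = f(X, ·)` through `x` at time `t`; the choice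
of the solution is harmless, since `IsCurve` determines it. -/
noncomputable def foot (f : ℝ → ℝ → ℝ) (x t : ℝ) : ℝ := Classical.epsilon (IsCurve f t x) 0

/-- The function `1 - x` transported by the flow of `f`. -/
noncomputable def transported (f : ℝ → ℝ → ℝ) (x t : ℝ) : ℝ := 1 - foot f x t

section

variable {f : ℝ → ℝ → ℝ} {L M : ℝ}

theorem foot_eq (hf : Caratheodory f L M) {x t : ℝ} {X : ℝ → ℝ} (hX : IsCurve f t x X) :
    foot f x t = X 0 := by
  have h1 : IsCurve f t x (Classical.epsilon (IsCurve f t x)) := Classical.epsilon_spec ⟨X, hX⟩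
  unfold foot
  rw [h1.eq hf hX]

theorem foot_along (hf : Caratheodory f L M) {x t : ℝ} {X : ℝ → ℝ} (hX : IsCurve f t x X)
    (s : ℝ) : foot f (X s) s = foot f x t := by
  rw [foot_eq hf hX, foot_eq hf (hX.rebase hf s)]

theorem transported_along (hf : Caratheodory f L M) {x t : ℝ} {X : ℝ → ℝ} (hX : IsCurve f t x X)
    (s : ℝ) : transported f (X s) s = transported f x t := by
  unfold transported
  rw [foot_along hf hX]

theorem transported_zero (hf : Caratheodory f L M) (x : ℝ) : transported f x 0 = 1 - x := by
  obtain ⟨X, hX⟩ := exists_isCurve hf 0 x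
  unfold transported
  rw [foot_eq hf hX, hX.self_eq]

/-- Characteristics do not cross. -/
theorem transported_antitone (hf : Caratheodory f L M) (t : ℝ) :
    Antitone fun x => transported f x t := by
  intro x x' hxx
  obtain ⟨X, hX⟩ := exists_isCurve hf t x
  obtain ⟨Y, hY⟩ := exists_isCurve hf t x'
  suffices X 0 ≤ Y 0 by
    simp only [transported, foot_eq hf hX, foot_eq hf hY]
    linarith
  by_contra! hlt
  have hc : Continuous fun s => Y s - X s := hY.1.sub hX.1
  have hmem : (0 : ℝ) ∈ uIcc (Y 0 - X 0) (Y t - X t) := by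
    rw [hX.self_eq, hY.self_eq]
    exact mem_uIcc.2 (Or.inl ⟨by linarith, by linarith⟩)
  obtain ⟨s, -, hs⟩ := intermediate_value_uIcc hc.continuousOn hmem
  have h1 := hX.rebase hf s
  have h2 := hY.rebase hf s
  rw [show Y s = X s by linarith] at h2
  rw [h1.eq hf h2] at hlt
  exact lt_irrefl _ hlt

theorem IsCurve.abs_sub_le_mul (hf : Caratheodory f L M) (hb : ∀ x t, |f x t| ≤ M) {t₀ x₀ : ℝ}
    {X : ℝ → ℝ} (hX : IsCurve f t₀ x₀ X) (s t : ℝ) : |X t - X s| ≤ M * |t - s| := by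
  rw [hX.sub_eq hf]
  exact intervalIntegral.norm_integral_le_of_norm_le_const (f := fun r => f (X r) r)
    fun r _ => hb _ _

theorem transported_lipschitz (hf : Caratheodory f L M) (hb : ∀ x t, |f x t| ≤ M) :
    ∃ K : NNReal, LipschitzOnWith K (fun z : ℝ × ℝ => transported f z.1 z.2)
      (univ ×ˢ Icc 0 2) := by
  have hM : 0 ≤ M := (abs_nonneg _).trans (hb 0 0)
  refine ⟨(Real.exp (L * 2) * (1 + M)).toNNReal, LipschitzOnWith.of_dist_le_mul ?_⟩
  rintro ⟨x, t⟩ ⟨-, ht⟩ ⟨x', t'⟩ -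
  obtain ⟨X, hX⟩ := exists_isCurve hf t x
  obtain ⟨Y, hY⟩ := exists_isCurve hf t' x'
  simp only [transported, foot_eq hf hX, foot_eq hf hY] at ht ⊢
  rw [Real.coe_toNNReal _ (by positivity), Prod.dist_eq, Real.dist_eq, Real.dist_eq, Real.dist_eq]
  have h1 := hX.abs_sub_le hf hY t 0
  have h2 := hY.abs_sub_le_mul hf hb t' t
  rw [hY.self_eq] at h2
  rw [hX.self_eq] at h1
  set D := max |x - x'| |t - t'| with hD
  have hxD : |x - x'| ≤ D := le_max_left _ _
  have htD : |t - t'| ≤ D := le_max_right _ _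
  have hD0 : 0 ≤ D := (abs_nonneg _).trans hxD
  have h3 : |x - Y t| ≤ (1 + M) * D := by
    calc |x - Y t| = |(x - x') - (Y t - x')| := by ring_nf
      _ ≤ |x - x'| + |Y t - x'| := abs_sub _ _
      _ ≤ D + M * D := add_le_add hxD (h2.trans (by gcongr))
      _ = _ := by ring
  have h4 : Real.exp (L * |0 - t|) ≤ Real.exp (L * 2) := by
    rw [zero_sub, abs_neg, abs_of_nonneg ht.1]
    exact Real.exp_le_exp.2 (mul_le_mul_of_nonneg_left ht.2 hf.nonneg)
  calc |1 - X 0 - (1 - Y 0)| = |X 0 - Y 0| := by rw [← abs_neg]; ring_nf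
    _ ≤ |x - Y t| * Real.exp (L * |0 - t|) := h1
    _ ≤ ((1 + M) * D) * Real.exp (L * 2) := by gcongr
    _ = _ := by ring

end

/-- The velocity field seen after the reflection `x ↦ -x`. -/
def mirror (f : ℝ → ℝ → ℝ) (x t : ℝ) : ℝ := f (-x) t

theorem Caratheodory.comp_neg {f : ℝ → ℝ → ℝ} {L M : ℝ} (hf : Caratheodory f L M) :
    Caratheodory (mirror f) L M := by
  refine ⟨fun x => hf.meas (-x), fun t x y => ?_, fun t => ?_⟩
  · have := hf.lip t (-x) (-y)
    rwa [← abs_neg (-x - -y), show -(-x - -y) = x - y by ring] at this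
  · simpa [mirror] using hf.bound_zero t

/-! ### The solution with a fattening zero set -/

/-- The largest value of the solution at time `t`: `(1 - t)²` until the front has shrunk to a
point at `t = 1`, and `0` afterwards. -/
def cap (t : ℝ) : ℝ := (max (1 - t) 0) ^ 2

/-- The datum transported outwards by `f` from both sides and truncated at its maximal value. -/
noncomputable def bump (f : ℝ → ℝ → ℝ) (x t : ℝ) : ℝ :=
  min (min (transported f x t) (transported (mirror f) (-x) t)) (cap t)

theorem bump_neg (f : ℝ → ℝ → ℝ) (x t : ℝ) : bump f (-x) t = bump (mirror f) x t := by
  have : mirror (mirror f) = f := by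
    funext x t
    simp [mirror]
  unfold bump
  rw [this, neg_neg, min_comm (transported f (-x) t)]

theorem cap_antitone : Antitone cap := by
  intro s t hst
  unfold cap
  gcongr

theorem cap_of_le {t : ℝ} (ht : t ≤ 1) : cap t = x₁ t := by
  unfold cap x₁
  rw [max_eq_left (by linarith)]
  ring

theorem cap_of_ge {t : ℝ} (ht : 1 ≤ t) : cap t = 0 := by
  unfold cap
  rw [max_eq_right (by linarith)]
  ring

/-- A velocity field `f` which for `|x| ≤ r + 2` is a function `h` of time only, such that the front
issued from `1` with speed `h` has half-length `l` shrinking to `0` at `t = 1` and positive later.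
As `l` takes values in `[0, 1]`, a characteristic ending in `|x| ≤ r + 1` stays in `|x| ≤ r + 2`. -/
structure FrontData (r : ℝ) (f : ℝ → ℝ → ℝ) (h l : ℝ → ℝ) : Prop where
  r_nonneg : 0 ≤ r
  f_eq : ∀ x s, |x| ≤ r + 2 → f x s = h s
  h_eq : ∀ s ∈ Ioo (0 : ℝ) 1, h s = 2 * (s - 1)
  l_eq : ∀ t, l t = 1 + ∫ s in (0 : ℝ)..t, h s
  l_mem : ∀ t, l t ∈ Icc (0 : ℝ) 1
  l_before : ∀ t ∈ Icc (0 : ℝ) 1, l t = x₁ t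
  l_after : ∀ t, 1 < t → 0 < l t

section

variable {f : ℝ → ℝ → ℝ} {L M r : ℝ} {h l : ℝ → ℝ}

theorem FrontData.comp_neg (hd : FrontData r f h l) : FrontData r (mirror f) h l where
  r_nonneg := hd.r_nonneg
  f_eq x s hx := hd.f_eq (-x) s (by rwa [abs_neg])
  h_eq := hd.h_eq
  l_eq := hd.l_eq
  l_mem := hd.l_mem
  l_before := hd.l_before
  l_after := hd.l_after

theorem FrontData.intervalIntegrable (hf : Caratheodory f L M) (hd : FrontData r f h l)
    (a b : ℝ) : IntervalIntegrable h volume a b := by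
  have := hf.intervalIntegrable (continuous_const (y := (0 : ℝ))) a b
  refine this.congr fun s _ => hd.f_eq 0 s ?_
  rw [abs_zero]; linarith [hd.r_nonneg]

theorem FrontData.l_sub (hf : Caratheodory f L M) (hd : FrontData r f h l) (s t : ℝ) :
    l t - l s = ∫ w in s..t, h w := by
  have := intervalIntegral.integral_add_adjacent_intervals
    (hd.intervalIntegrable hf 0 s) (hd.intervalIntegrable hf s t)
  rw [hd.l_eq t, hd.l_eq s]
  linarith

theorem FrontData.continuous_l (hf : Caratheodory f L M) (hd : FrontData r f h l) :
    Continuous l := by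
  have := intervalIntegral.continuous_primitive (hd.intervalIntegrable hf) 0
  rw [show l = fun t => 1 + ∫ s in (0 : ℝ)..t, h s from funext hd.l_eq]
  fun_prop

/-- Near the origin characteristics are translates of the front. -/
theorem FrontData.transported_eq (hf : Caratheodory f L M) (hd : FrontData r f h l) {x t : ℝ}
    (hx : |x| ≤ r + 1) : transported f x t = l t - x := by
  have hX : IsCurve f t x (fun s => x - l t + l s) := by
    refine ⟨continuous_const.add (hd.continuous_l hf), fun s => ?_⟩
    have h1 : ∫ w in t..s, f (x - l t + l w) w = ∫ w in t..s, h w := by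
      refine intervalIntegral.integral_congr fun w _ => hd.f_eq _ _ ?_
      have h2 := hd.l_mem t
      have h3 := hd.l_mem w
      have h4 := abs_le.1 hx
      exact abs_le.2 ⟨by linarith [h2.2, h3.1, h4.1], by linarith [h2.1, h3.2, h4.2]⟩
    rw [h1, ← hd.l_sub hf]
    ring
  unfold transported
  rw [foot_eq hf hX, hd.l_eq 0]
  simp

theorem FrontData.bump_eq (hf : Caratheodory f L M) (hd : FrontData r f h l) {x t : ℝ}
    (hx : |x| ≤ r + 1) : bump f x t = min (l t - |x|) (cap t) := by
  unfold bump
  rw [hd.transported_eq hf hx, hd.comp_neg.transported_eq hf.comp_neg (by rwa [abs_neg]),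
    abs_eq_max_neg, min_sub_sub_left]

theorem FrontData.transported_le (hf : Caratheodory f L M) (hd : FrontData r f h l) {x t : ℝ}
    (hx : 0 ≤ x) : transported f x t ≤ transported (mirror f) (-x) t := by
  have h0 : |(0 : ℝ)| ≤ r + 1 := by rw [abs_zero]; linarith [hd.r_nonneg]
  calc transported f x t ≤ transported f 0 t := transported_antitone hf t hx
    _ = transported (mirror f) 0 t := by
        rw [hd.transported_eq hf h0, hd.comp_neg.transported_eq hf.comp_neg h0]
    _ ≤ _ := transported_antitone hf.comp_neg t (by linarith)

theorem FrontData.bump_of_nonneg (hf : Caratheodory f L M) (hd : FrontData r f h l) {x t : ℝ}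
    (hx : 0 ≤ x) : bump f x t = min (transported f x t) (cap t) := by
  unfold bump
  rw [min_eq_left (hd.transported_le hf hx)]

theorem FrontData.transported_le_cap (hf : Caratheodory f L M) (hd : FrontData r f h l) {x t : ℝ}
    (hx : 0 ≤ x) (ht : t ∈ Icc (0 : ℝ) 1) : transported f x t ≤ cap t := by
  have h0 : |(0 : ℝ)| ≤ r + 1 := by rw [abs_zero]; linarith [hd.r_nonneg]
  calc transported f x t ≤ transported f 0 t := transported_antitone hf t hx
    _ = cap t := by rw [hd.transported_eq hf h0, hd.l_before t ht, cap_of_le ht.2, sub_zero]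

theorem _root_.LipschitzOnWith.min_real {α : Type*} [PseudoMetricSpace α] {F G : α → ℝ}
    {K K' : NNReal} {s : Set α} (hF : LipschitzOnWith K F s) (hG : LipschitzOnWith K' G s) :
    LipschitzOnWith (max K K') (fun z => min (F z) (G z)) s := by
  refine LipschitzOnWith.of_dist_le_mul fun z hz w hw => ?_
  have h1 := hF.dist_le_mul z hz w hw
  have h2 := hG.dist_le_mul z hz w hw
  rw [Real.dist_eq] at h1 h2 ⊢
  refine (abs_min_sub_min_le_max _ _ _ _).trans (max_le ?_ ?_)
  · exact h1.trans (by gcongr; exact le_max_left _ _)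
  · exact h2.trans (by gcongr; exact le_max_right _ _)

theorem bump_lipschitz (hf : Caratheodory f L M) (hb : ∀ x t, |f x t| ≤ M) :
    ∃ K : NNReal, LipschitzOnWith K (fun z : ℝ × ℝ => bump f z.1 z.2) (univ ×ˢ Icc 0 2) := by
  obtain ⟨K₁, h1⟩ := transported_lipschitz hf hb
  obtain ⟨K₂, h2⟩ := transported_lipschitz hf.comp_neg (fun x t => hb (-x) t)
  have h2' : LipschitzOnWith K₂ (fun z : ℝ × ℝ => transported (mirror f) (-z.1) z.2)
      (univ ×ˢ Icc 0 2) := by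
    refine LipschitzOnWith.of_dist_le_mul fun z hz w hw => ?_
    have := h2.dist_le_mul (-z.1, z.2) ⟨mem_univ _, hz.2⟩ (-w.1, w.2) ⟨mem_univ _, hw.2⟩
    rwa [Prod.dist_eq, dist_neg_neg, ← Prod.dist_eq] at this
  have h3 : LipschitzOnWith 2 (fun z : ℝ × ℝ => cap z.2) (univ ×ˢ Icc 0 2) := by
    refine LipschitzOnWith.of_dist_le_mul fun z hz w hw => ?_
    have ha : ∀ t ∈ Icc (0 : ℝ) 2, max (1 - t) 0 ∈ Icc (0 : ℝ) 1 := fun t ht =>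
      ⟨le_max_right _ _, max_le (by linarith [ht.1]) zero_le_one⟩
    have hz' := ha _ hz.2
    have hw' := ha _ hw.2
    have h4 : |max (1 - z.2) 0 - max (1 - w.2) 0| ≤ |z.2 - w.2| := by
      refine (abs_max_sub_max_le_abs _ _ _).trans ?_
      rw [← abs_neg]; ring_nf; rfl
    have h5 : dist z.2 w.2 ≤ dist z w := le_max_right _ _
    rw [Real.dist_eq] at h5
    rw [Real.dist_eq]
    unfold cap
    rw [sq_sub_sq, abs_mul]
    have h6 : |max (1 - z.2) 0 + max (1 - w.2) 0| ≤ 2 :=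
      abs_le.2 ⟨by linarith [hz'.1, hw'.1], by linarith [hz'.2, hw'.2]⟩
    push_cast
    exact mul_le_mul h6 (h4.trans h5) (abs_nonneg _) zero_le_two
  exact ⟨_, (h1.min_real h2').min_real h3⟩

/-- On the right half line the characteristic through the point is a path as required. -/
theorem FrontData.hasSubPath_transported (hf : Caratheodory f L M) (hb : ∀ x t, |f x t| ≤ M)
    (hd : FrontData r f h l) {x₀ t₀ p : ℝ} (hx₀ : 0 < x₀)
    (hp : TouchesAbove (fun x => bump f x t₀) x₀ p) : HasSubPath f (bump f) x₀ t₀ p := by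
  obtain ⟨X, hX⟩ := exists_isCurve hf t₀ x₀
  have hXpos : ∀ᶠ s in 𝓝 t₀, 0 < X s :=
    hX.1.continuousAt.eventually (lt_mem_nhds (by rwa [hX.self_eq]))
  obtain ⟨δ, hδ, hball⟩ := Metric.eventually_nhds_iff.1 hXpos
  have hp0 : p ≤ 0 := by
    refine hp.nonpos ?_
    filter_upwards [Ioo_mem_nhdsLT hx₀] with x hx
    rw [hd.bump_of_nonneg hf hx₀.le, hd.bump_of_nonneg hf hx.1.le]
    exact min_le_min_right _ (transported_antitone hf t₀ hx.2.le)
  refine ⟨X, fun s => f (X s) s, δ / 2, M, by positivity, hf.measurable_comp hX.1,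
    fun s => hb _ _, ?_, ?_, ae_of_all _ fun s _ => ?_⟩
  · intro t _
    have := hX.sub_eq hf t t₀
    rw [hX.self_eq] at this
    linarith
  · intro t ht
    have h1 : 0 < X t := hball (by
      rw [Real.dist_eq]
      exact abs_lt.2 ⟨by linarith [ht.1], by linarith [ht.2]⟩)
    rw [hd.bump_of_nonneg hf hx₀.le, hd.bump_of_nonneg hf h1.le, transported_along hf hX]
    exact min_le_min_left _ (cap_antitone ht.2)
  · rw [abs_of_nonpos hp0]
    linarith

/-- Up to the fattening time the tip of the solution moves down with the front: followed backwards
in time, a path leaving the tip with the speed of the front, on the side prescribed by the sign of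
the slope, stays on the graph's level at the tip or above it. -/
theorem FrontData.hasSubPath_tip (hf : Caratheodory f L M) (hb : ∀ x t, |f x t| ≤ M)
    (hd : FrontData r f h l) {t₀ p : ℝ} (ht₀ : t₀ ∈ Ioc (0 : ℝ) 1) :
    HasSubPath f (bump f) 0 t₀ p := by
  have hr := hd.r_nonneg
  have h0 : |(0 : ℝ)| ≤ r + 2 := by rw [abs_zero]; linarith
  have hh : h = f 0 := funext fun s => (hd.f_eq 0 s h0).symm
  obtain ⟨σ, hσ, hσp⟩ : ∃ σ : ℝ, |σ| = 1 ∧ p * σ = |p| := by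
    rcases le_total 0 p with hp | hp
    · exact ⟨1, abs_one, by rw [abs_of_nonneg hp, mul_one]⟩
    · exact ⟨-1, by simp, by rw [abs_of_nonpos hp]; ring⟩
  have hX : ∀ t, |0 - ∫ s in t..t₀, -σ * h s| = |l t₀ - l t| := by
    intro t
    rw [intervalIntegral.integral_const_mul, ← hd.l_sub hf, zero_sub, abs_neg, abs_mul, abs_neg,
      hσ, one_mul]
  have hX1 : ∀ t, |0 - ∫ s in t..t₀, -σ * h s| ≤ r + 1 := by
    intro t
    rw [hX]
    have h1 := hd.l_mem t
    have h2 := hd.l_mem t₀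
    exact abs_le.2 ⟨by linarith [h1.2, h2.1], by linarith [h1.1, h2.2]⟩
  refine ⟨fun t => 0 - ∫ s in t..t₀, -σ * h s, fun s => -σ * h s, t₀, M, ht₀.1, ?_, ?_,
    fun t _ => rfl, ?_, ae_of_all _ fun s hs => ?_⟩
  · rw [hh]
    exact (hf.meas 0).const_mul _
  · intro s
    rw [abs_mul, abs_neg, hσ, one_mul, hh]
    exact hb 0 s
  · intro t ht
    rw [sub_self] at ht
    have ht1 : t ≤ 1 := ht.2.trans ht₀.2
    have hl : l t₀ ≤ l t := by
      rw [hd.l_before t ⟨ht.1, ht1⟩, hd.l_before t₀ ⟨ht₀.1.le, ht₀.2⟩]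
      unfold x₁
      nlinarith [ht.2, ht₀.2]
    beta_reduce
    rw [hd.bump_eq hf (by rw [abs_zero]; linarith), hd.bump_eq hf (hX1 t), hX,
      abs_of_nonpos (by linarith : l t₀ - l t ≤ 0), abs_zero, cap_of_le ht₀.2, cap_of_le ht1,
      ← hd.l_before t ⟨ht.1, ht1⟩, ← hd.l_before t₀ ⟨ht₀.1.le, ht₀.2⟩]
    simp [hl]
  · beta_reduce
    rw [hd.f_eq _ _ ((hX1 s).trans (by linarith)), ← hσp]
    exact le_of_eq (by ring)

/-- After the fattening time the solution vanishes near the origin, so that the only touching slope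
there is zero. -/
theorem FrontData.hasSubPath_plateau (hf : Caratheodory f L M) (hd : FrontData r f h l)
    {t₀ p : ℝ} (ht₀ : 1 < t₀) (hp : TouchesAbove (fun x => bump f x t₀) 0 p) :
    HasSubPath f (bump f) 0 t₀ p := by
  have hr := hd.r_nonneg
  have hev : ∀ᶠ z : ℝ × ℝ in 𝓝 (0, t₀), bump f z.1 z.2 = 0 := by
    have h3 : ∀ᶠ z : ℝ × ℝ in 𝓝 (0, t₀), 1 < z.2 :=
      continuousAt_snd.eventually (lt_mem_nhds ht₀)
    have h4 : Continuous fun z : ℝ × ℝ => l z.2 - |z.1| :=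
      ((hd.continuous_l hf).comp continuous_snd).sub continuous_fst.abs
    have h5 : ∀ᶠ z : ℝ × ℝ in 𝓝 (0, t₀), 0 < l z.2 - |z.1| :=
      h4.continuousAt.eventually (lt_mem_nhds (by simpa using hd.l_after t₀ ht₀))
    filter_upwards [h3, h5] with z h6 h7
    have h8 := (hd.l_mem z.2).2
    rw [hd.bump_eq hf (by linarith), cap_of_ge h6.le]
    exact min_eq_right h7.le
  have hev1 : ∀ᶠ x in 𝓝 0, bump f x t₀ = 0 :=
    ((Continuous.prodMk_left t₀).tendsto (0 : ℝ)).eventually hev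
  have hev2 : ∀ᶠ t in 𝓝 t₀, bump f 0 t = 0 :=
    ((Continuous.prodMk_right (0 : ℝ)).tendsto t₀).eventually hev
  have hp1 : 0 ≤ p := hp.nonneg (by
    filter_upwards [hev1.filter_mono nhdsWithin_le_nhds] with x hx
    rw [hx, hev1.self_of_nhds])
  have hp2 : p ≤ 0 := hp.nonpos (by
    filter_upwards [hev1.filter_mono nhdsWithin_le_nhds] with x hx
    rw [hx, hev1.self_of_nhds])
  obtain ⟨δ, hδ, hball⟩ := Metric.eventually_nhds_iff.1 hev2
  refine ⟨fun _ => 0, fun _ => 0, δ / 2, 0, by positivity, measurable_const, by simp, by simp,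
    ?_, ae_of_all _ fun s _ => ?_⟩
  · intro t ht
    rw [hev2.self_of_nhds, hball (by
      rw [Real.dist_eq]
      exact abs_lt.2 ⟨by linarith [ht.1], by linarith [ht.2]⟩)]
  · rw [le_antisymm hp2 hp1]
    simp

theorem FrontData.hasSubPath_bump (hf : Caratheodory f L M) (hb : ∀ x t, |f x t| ≤ M)
    (hd : FrontData r f h l) {x₀ t₀ p : ℝ} (hx₀ : 0 ≤ x₀) (ht₀ : 0 < t₀)
    (hp : TouchesAbove (fun x => bump f x t₀) x₀ p) : HasSubPath f (bump f) x₀ t₀ p := by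
  rcases hx₀.eq_or_lt with rfl | hx₀
  · rcases le_or_gt t₀ 1 with h1 | h1
    · exact hd.hasSubPath_tip hf hb ⟨ht₀, h1⟩
    · exact hd.hasSubPath_plateau hf h1 hp
  · exact hd.hasSubPath_transported hf hb hx₀ hp

/-- For the supersolution property a minimum is favourable: where `bump` coincides with the
transported datum, the characteristic is a path as required. -/
theorem FrontData.hasSubPath_neg_transported (hf : Caratheodory f L M) (hb : ∀ x t, |f x t| ≤ M)
    {x₀ t₀ p : ℝ} (heq : bump f x₀ t₀ = transported f x₀ t₀)
    (hp : TouchesAbove (fun x => -bump f x t₀) x₀ p) :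
    HasSubPath (fun x t => -f x t) (fun x t => -bump f x t) x₀ t₀ p := by
  obtain ⟨X, hX⟩ := exists_isCurve hf t₀ x₀
  have hle : ∀ x t, bump f x t ≤ transported f x t := fun x t =>
    (min_le_left _ _).trans (min_le_left _ _)
  have hp0 : 0 ≤ p := by
    refine hp.nonneg ?_
    filter_upwards [self_mem_nhdsWithin] with x hx
    rw [heq]
    exact neg_le_neg ((hle x t₀).trans (transported_antitone hf t₀ (le_of_lt hx)))
  refine ⟨X, fun s => f (X s) s, 1, M, one_pos, hf.measurable_comp hX.1,
    fun s => hb _ _, ?_, ?_, ae_of_all _ fun s _ => ?_⟩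
  · intro t _
    have := hX.sub_eq hf t t₀
    rw [hX.self_eq] at this
    linarith
  · intro t ht
    beta_reduce
    rw [heq]
    refine neg_le_neg ((hle _ _).trans ?_)
    rw [transported_along hf hX]
  · rw [abs_of_nonneg hp0]
    exact le_of_eq (by ring)

/-- Where `bump` takes its maximal value, the only slope touching from below is zero. -/
theorem FrontData.hasSubPath_neg_cap {x₀ t₀ p : ℝ} (h1 : 1 < t₀) (heq : bump f x₀ t₀ = cap t₀)
    (hp : TouchesAbove (fun x => -bump f x t₀) x₀ p) :
    HasSubPath (fun x t => -f x t) (fun x t => -bump f x t) x₀ t₀ p := by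
  have hle : ∀ x t, bump f x t ≤ cap t := fun x t => min_le_right _ _
  have hall : ∀ x, -bump f x₀ t₀ ≤ -bump f x t₀ := fun x => by
    rw [heq]
    exact neg_le_neg (hle x t₀)
  have hp0 : p = 0 := le_antisymm (hp.nonpos (Eventually.of_forall hall))
    (hp.nonneg (Eventually.of_forall hall))
  refine ⟨fun _ => x₀, fun _ => 0, t₀ - 1, 0, by linarith, measurable_const, by simp, by simp,
    ?_, ae_of_all _ fun s _ => by simp [hp0]⟩
  intro t ht
  beta_reduce
  rw [heq, cap_of_ge h1.le, ← cap_of_ge (show 1 ≤ t by linarith [ht.1])]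
  exact neg_le_neg (hle _ _)

theorem FrontData.hasSubPath_neg_bump (hf : Caratheodory f L M) (hb : ∀ x t, |f x t| ≤ M)
    (hd : FrontData r f h l) {x₀ t₀ p : ℝ} (hx₀ : 0 ≤ x₀) (ht₀ : 0 < t₀)
    (hp : TouchesAbove (fun x => -bump f x t₀) x₀ p) :
    HasSubPath (fun x t => -f x t) (fun x t => -bump f x t) x₀ t₀ p := by
  have h1 := hd.bump_of_nonneg hf (t := t₀) hx₀
  rcases le_or_gt (transported f x₀ t₀) (cap t₀) with h2 | h2
  · exact FrontData.hasSubPath_neg_transported hf hb (by rw [h1, min_eq_left h2]) hp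
  · refine FrontData.hasSubPath_neg_cap ?_ (by rw [h1, min_eq_right h2.le]) hp
    by_contra! h3
    exact absurd (hd.transported_le_cap hf hx₀ ⟨ht₀.le, h3⟩) (not_le.2 h2)

theorem FrontData.bump_zero (hf : Caratheodory f L M) (hd : FrontData r f h l) (x : ℝ) :
    bump f x 0 = datum x := by
  have key : ∀ {f : ℝ → ℝ → ℝ}, Caratheodory f L M → FrontData r f h l → ∀ x, 0 ≤ x →
      bump f x 0 = datum x := by
    intro f hf hd x hx
    rw [hd.bump_of_nonneg hf hx, transported_zero hf, cap_of_le zero_le_one]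
    simp [datum, x₁, abs_of_nonneg hx, hx]
  rcases le_total 0 x with hx | hx
  · exact key hf hd x hx
  · have := key hf.comp_neg hd.comp_neg (-x) (by linarith)
    rw [← bump_neg, neg_neg] at this
    simpa [datum] using this

theorem isL1Solution_bump (hf : Caratheodory f L M) (hb : ∀ x t, |f x t| ≤ M)
    (hd : FrontData r f h l) {T : ℝ} (hT : T ≤ 2) : IsL1Solution T f datum (bump f) := by
  have hcont : ContinuousOn (fun z : ℝ × ℝ => bump f z.1 z.2) (univ ×ˢ Ico 0 T) := by
    obtain ⟨K, hK⟩ := bump_lipschitz hf hb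
    exact hK.continuousOn.mono (prod_mono subset_rfl
      (fun t ht => ⟨ht.1, ht.2.le.trans hT⟩))
  have hb' : ∀ x t, |mirror f x t| ≤ M := fun x t => hb (-x) t
  refine ⟨isL1Subsolution_of_paths hcont (fun x => (hd.bump_zero hf x).le) ?_,
    (isL1Subsolution_of_paths hcont.neg (fun x => by rw [hd.bump_zero hf x]) ?_).neg⟩
  · intro x₀ t₀ ht₀ p hp
    rcases le_total 0 x₀ with hx | hx
    · exact hd.hasSubPath_bump hf hb hx ht₀.1 hp
    · refine HasSubPath.of_reflection ?_
      have := hp.comp_neg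
      simp only [bump_neg] at this ⊢
      exact hd.comp_neg.hasSubPath_bump hf.comp_neg hb' (by linarith) ht₀.1 this
  · intro x₀ t₀ ht₀ p hp
    rcases le_total 0 x₀ with hx | hx
    · exact hd.hasSubPath_neg_bump hf hb hx ht₀.1 hp
    · refine HasSubPath.of_reflection ?_
      have := hp.comp_neg
      simp only [bump_neg] at this ⊢
      exact hd.comp_neg.hasSubPath_neg_bump hf.comp_neg hb' (by linarith) ht₀.1 this

end

/-! ### Fronts after the fattening time -/

theorem gronwall_Icc {g : ℝ → ℝ} {L a b : ℝ} (hab : a ≤ b) (hg : ContinuousOn g (Icc a b))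
    (hg0 : ∀ t ∈ Icc a b, 0 ≤ g t) (hL : 0 ≤ L) (h : ∀ t ∈ Icc a b, g t ≤ L * ∫ s in a..t, g s) :
    ∀ t ∈ Icc a b, g t = 0 := by
  intro t ht
  have hext : ∀ s ∈ Icc a b, IccExtend hab (domRestrict (Icc a b) g) s = g s := fun s hs =>
    IccExtend_of_mem hab _ hs
  have := gronwall_integral (g := IccExtend hab (domRestrict (Icc a b) g)) (d := 0) (L := L)
    (a := a) (b := b) (continuous_IccExtend_iff.2 (continuousOn_iff_continuous_domRestrict.1 hg))
    (fun s => hg0 _ (projIcc a b hab s).2) hL (fun s hs => ?_) t ht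
  · rw [hext t ht, zero_mul] at this
    exact le_antisymm this (hg0 t ht)
  · rw [hext s hs, zero_add]
    refine (h s hs).trans (le_of_eq ?_)
    congr 1
    refine intervalIntegral.integral_congr fun w hw => (hext w ?_).symm
    rw [uIcc_of_le hs.1] at hw
    exact ⟨hw.1, hw.2.trans hs.2⟩

theorem integral_two_mul_sub_one (a t : ℝ) :
    ∫ s in a..t, 2 * (s - 1) = (t - 1) ^ 2 - (a - 1) ^ 2 := by
  refine intervalIntegral.integral_eq_sub_of_hasDerivAt (f := fun s => (s - 1) ^ 2)
    (fun s _ => ?_) (Continuous.intervalIntegrable (by fun_prop) _ _)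
  refine (((hasDerivAt_id s).sub_const 1).pow 2).congr_deriv ?_
  simp

theorem integral_force (t : ℝ) :
    ∫ s in (1 : ℝ)..t, 2 * (s - 1) * (2 - s) = (t - 1) ^ 2 - 2 / 3 * (t - 1) ^ 3 := by
  rw [intervalIntegral.integral_eq_sub_of_hasDerivAt
    (f := fun s => (s - 1) ^ 2 - 2 / 3 * (s - 1) ^ 3)
    (fun s _ => ?_) (Continuous.intervalIntegrable (by fun_prop) _ _)]
  · ring
  · refine ((((hasDerivAt_id s).sub_const 1).pow 2).sub
      ((((hasDerivAt_id s).sub_const 1).pow 3).const_mul (2 / 3))).congr_deriv ?_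
    simp only [id]
    push_cast
    ring

section

variable {γ y : ℝ → ℝ}

theorem IsFront.intervalIntegrable_mul (hγ : Admissible γ) (hy : ContinuousOn y (Icc 1 2))
    {a b : ℝ} (ha : a ∈ Icc (1 : ℝ) 2) (hb : b ∈ Icc (1 : ℝ) 2) :
    IntervalIntegrable (fun s => 2 * γ s * y s) volume a b := by
  have hsub : uIcc a b ⊆ Icc 1 2 := uIcc_subset_Icc ha hb
  have hyi : IntervalIntegrable y volume a b := (hy.mono hsub).intervalIntegrable
  refine (hyi.const_mul 2).mono_fun ?_ ?_
  · exact (hγ.1.const_mul 2).aestronglyMeasurable.mul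
      (intervalIntegrable_iff.1 hyi).aestronglyMeasurable
  · filter_upwards [ae_restrict_mem measurableSet_uIoc] with s hs
    have h1 := hγ.2 s (hsub (uIoc_subset_uIcc hs))
    rw [norm_mul, norm_mul, norm_mul]
    have : ‖γ s‖ ≤ 1 := by
      rw [Real.norm_eq_abs]; exact abs_le.2 ⟨by linarith [h1.1], h1.2⟩
    have h2 : ‖(2 : ℝ)‖ * ‖γ s‖ ≤ ‖(2 : ℝ)‖ * 1 := by gcongr
    rw [mul_one] at h2
    exact mul_le_mul_of_nonneg_right h2 (norm_nonneg _)

theorem IsFront.intervalIntegrable (hγ : Admissible γ) (hy : ContinuousOn y (Icc 1 2)) {a b : ℝ}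
    (ha : a ∈ Icc (1 : ℝ) 2) (hb : b ∈ Icc (1 : ℝ) 2) :
    IntervalIntegrable (fun s => 2 * (s - 1) * (2 - s) + 2 * γ s * y s) volume a b :=
  (Continuous.intervalIntegrable (by fun_prop) _ _).add
    (IsFront.intervalIntegrable_mul hγ hy ha hb)

theorem IsFront.one (hy : IsFront γ y) : y 1 = 0 := by
  rw [hy.2 1 ⟨le_rfl, one_le_two⟩, intervalIntegral.integral_same]

theorem IsFront.nonneg (hγ : Admissible γ) (hy : IsFront γ y) {t : ℝ} (ht : t ∈ Icc (1 : ℝ) 2) :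
    0 ≤ y t := by
  have hc : ContinuousOn (fun s => max (-y s) 0) (Icc 1 2) :=
    ContinuousOn.sup hy.1.neg continuousOn_const
  have key := gronwall_Icc one_le_two hc (fun s _ => le_max_right _ _) zero_le_two ?_ t ht
  · have := le_max_left (-y t) 0
    linarith
  · intro s hs
    have hi : IntervalIntegrable (fun w => 2 * max (-y w) 0) volume 1 s :=
      ((hc.mono (uIcc_subset_Icc ⟨le_rfl, one_le_two⟩ hs)).intervalIntegrable).const_mul 2
    rw [← intervalIntegral.integral_const_mul]
    refine max_le ?_ (intervalIntegral.integral_nonneg hs.1 fun w _ => by positivity)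
    rw [hy.2 s hs, ← intervalIntegral.integral_neg]
    refine intervalIntegral.integral_mono_on hs.1
      (IsFront.intervalIntegrable hγ hy.1 ⟨le_rfl, one_le_two⟩ hs).neg hi fun w hw => ?_
    have h1 := hγ.2 w ⟨hw.1, hw.2.trans hs.2⟩
    have h2 : 0 ≤ (w - 1) * (2 - w) := mul_nonneg (by linarith [hw.1]) (by linarith [hw.2, hs.2])
    have h3 := mul_le_mul_of_nonneg_left (le_max_left (-y w) 0) h1.1
    have h4 := mul_le_mul_of_nonneg_right h1.2 (le_max_right (-y w) 0)
    linarith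

/-- The largest front `(t - 1)²` belongs to `γ = 1`. -/
theorem IsFront.le_sq (hγ : Admissible γ) (hy : IsFront γ y) {t : ℝ} (ht : t ∈ Icc (1 : ℝ) 2) :
    y t ≤ (t - 1) ^ 2 := by
  have hc : ContinuousOn (fun s => max (y s - (s - 1) ^ 2) 0) (Icc 1 2) :=
    ContinuousOn.sup (hy.1.sub (g := fun s : ℝ => (s - 1) ^ 2) (by fun_prop)) continuousOn_const
  have key := gronwall_Icc one_le_two hc (fun s _ => le_max_right _ _) zero_le_two ?_ t ht
  · have := le_max_left (y t - (t - 1) ^ 2) 0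
    linarith
  · intro s hs
    have hi : IntervalIntegrable (fun w => 2 * max (y w - (w - 1) ^ 2) 0) volume 1 s :=
      ((hc.mono (uIcc_subset_Icc ⟨le_rfl, one_le_two⟩ hs)).intervalIntegrable).const_mul 2
    rw [← intervalIntegral.integral_const_mul]
    refine max_le ?_ (intervalIntegral.integral_nonneg hs.1 fun w _ => by positivity)
    have h0 := integral_two_mul_sub_one 1 s
    rw [sub_self, zero_pow two_ne_zero, sub_zero] at h0
    have hi1 := IsFront.intervalIntegrable hγ hy.1 ⟨le_rfl, one_le_two⟩ hs
    have hi2 : IntervalIntegrable (fun w : ℝ => 2 * (w - 1)) volume 1 s :=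
      Continuous.intervalIntegrable (by fun_prop) _ _
    rw [hy.2 s hs, ← h0, ← intervalIntegral.integral_sub hi1 hi2]
    refine intervalIntegral.integral_mono_on hs.1 (hi1.sub hi2) hi fun w hw => ?_
    have hw' : w ∈ Icc (1 : ℝ) 2 := ⟨hw.1, hw.2.trans hs.2⟩
    have h1 := hγ.2 w hw'
    have h2 := mul_le_mul_of_nonneg_right h1.2 (hy.nonneg hγ hw')
    have h3 := le_max_left (y w - (w - 1) ^ 2) 0
    nlinarith

/-- The front is at least the one driven by `c₁` alone, which is `γ = 0`. -/
theorem IsFront.pos (hγ : Admissible γ) (hy : IsFront γ y) {t : ℝ} (ht : t ∈ Ioc (1 : ℝ) 2) :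
    0 < y t := by
  have ht' : t ∈ Icc (1 : ℝ) 2 := ⟨ht.1.le, ht.2⟩
  have hi : IntervalIntegrable (fun s : ℝ => 2 * (s - 1) * (2 - s)) volume 1 t :=
    Continuous.intervalIntegrable (by fun_prop) _ _
  have h1 : ∫ s in (1 : ℝ)..t, 2 * (s - 1) * (2 - s) ≤ y t := by
    rw [hy.2 t ht']
    refine intervalIntegral.integral_mono_on ht.1.le hi
      (IsFront.intervalIntegrable hγ hy.1 ⟨le_rfl, one_le_two⟩ ht') fun w hw => ?_
    have hw' : w ∈ Icc (1 : ℝ) 2 := ⟨hw.1, hw.2.trans ht.2⟩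
    have := mul_nonneg (hγ.2 w hw').1 (hy.nonneg hγ hw')
    linarith
  rw [integral_force] at h1
  have h2 : 0 < t - 1 := by linarith [ht.1]
  have h3 : 0 < (t - 1) ^ 2 * (1 - 2 / 3 * (t - 1)) :=
    mul_pos (by positivity) (by linarith [ht.2])
  nlinarith

theorem IsFront.eqOn (hγ : Admissible γ) (hy : IsFront γ y) {z : ℝ → ℝ} (hz : IsFront γ z) :
    EqOn y z (Icc 1 2) := by
  intro t ht
  have hc : ContinuousOn (fun s => |y s - z s|) (Icc 1 2) := (hy.1.sub hz.1).abs
  have key := gronwall_Icc one_le_two hc (fun s _ => abs_nonneg _) zero_le_two ?_ t ht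
  · exact sub_eq_zero.1 (abs_eq_zero.1 key)
  · intro s hs
    have h1 : (1 : ℝ) ∈ Icc (1 : ℝ) 2 := ⟨le_rfl, one_le_two⟩
    have hi : IntervalIntegrable (fun w => 2 * |y w - z w|) volume 1 s :=
      ((hc.mono (uIcc_subset_Icc h1 hs)).intervalIntegrable).const_mul 2
    rw [← intervalIntegral.integral_const_mul, hy.2 s hs, hz.2 s hs,
      ← intervalIntegral.integral_sub (IsFront.intervalIntegrable hγ hy.1 h1 hs)
        (IsFront.intervalIntegrable hγ hz.1 h1 hs), ← Real.norm_eq_abs]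
    refine intervalIntegral.norm_integral_le_of_norm_le hs.1 (ae_of_all _ fun w hw => ?_) hi
    have h2 := hγ.2 w ⟨hw.1.le, hw.2.trans hs.2⟩
    rw [show 2 * (w - 1) * (2 - w) + 2 * γ w * y w - (2 * (w - 1) * (2 - w) + 2 * γ w * z w) =
      γ w * (2 * (y w - z w)) by ring, norm_mul, norm_mul, Real.norm_eq_abs, Real.norm_eq_abs,
      Real.norm_eq_abs, abs_of_nonneg h2.1, abs_two]
    exact mul_le_of_le_one_left (by positivity) h2.2

theorem exists_isFront (hγ : Admissible γ) : ∃ y, IsFront γ y := by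
  set f : ℝ → ℝ → ℝ := fun x => indicator (Icc 1 2) fun t => 2 * (t - 1) * (2 - t) + 2 * γ t * x
    with hf
  have hfc : Caratheodory f 2 2 := by
    refine ⟨fun x => ?_, fun t x x' => ?_, fun t => ?_⟩
    · exact Measurable.indicator (by have := hγ.1; fun_prop) measurableSet_Icc
    · by_cases ht : t ∈ Icc (1 : ℝ) 2
      · have h1 := hγ.2 t ht
        simp only [hf, indicator_of_mem ht]
        rw [show 2 * (t - 1) * (2 - t) + 2 * γ t * x - (2 * (t - 1) * (2 - t) + 2 * γ t * x') =
          γ t * (2 * (x - x')) by ring, abs_mul, abs_mul, abs_of_nonneg h1.1, abs_two]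
        exact mul_le_of_le_one_left (by positivity) h1.2
      · simp only [hf, indicator_of_notMem ht]
        simp
    · by_cases ht : t ∈ Icc (1 : ℝ) 2
      · simp only [hf, indicator_of_mem ht]
        rw [mul_zero, add_zero]
        exact abs_le.2 ⟨by nlinarith [ht.1, ht.2], by nlinarith [ht.1, ht.2]⟩
      · simp only [hf, indicator_of_notMem ht]
        simp
  obtain ⟨X, hX⟩ := exists_isCurve hfc 1 0
  refine ⟨X, hX.1.continuousOn, fun t ht => ?_⟩
  rw [hX.2 t, zero_add]
  refine intervalIntegral.integral_congr fun s hs => ?_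
  rw [uIcc_of_le ht.1] at hs
  exact indicator_of_mem (show s ∈ Icc (1 : ℝ) 2 from ⟨hs.1, hs.2.trans ht.2⟩) _

end

/-- A parameter for which the front is the polynomial `(t - 1)² - (2 θ / 3) (t - 1)³`. -/
noncomputable def parameter (θ t : ℝ) : ℝ :=
  if t ∈ Icc (1 : ℝ) 2 then (1 - θ) / (1 - 2 / 3 * θ * (t - 1)) else 0

theorem admissible_parameter {θ : ℝ} (hθ : θ ∈ Icc (0 : ℝ) 1) : Admissible (parameter θ) := by
  refine ⟨Measurable.ite measurableSet_Icc (by fun_prop) measurable_const, fun t ht => ?_⟩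
  have h1 : θ * (t - 1) ≤ θ := mul_le_of_le_one_right hθ.1 (by linarith [ht.2])
  have h2 := hθ.2
  have h3 : 0 ≤ θ * (t - 1) := mul_nonneg hθ.1 (by linarith [ht.1])
  unfold parameter
  rw [if_pos ht]
  exact ⟨div_nonneg (by linarith) (by linarith),
    (div_le_one (by linarith)).2 (by linarith)⟩

theorem isFront_parameter {θ : ℝ} (hθ : θ ∈ Icc (0 : ℝ) 1) :
    IsFront (parameter θ) fun t => (t - 1) ^ 2 - 2 / 3 * θ * (t - 1) ^ 3 := by
  refine ⟨by fun_prop, fun t ht => ?_⟩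
  have h1 : ∫ s in (1 : ℝ)..t, (2 * (s - 1) * (2 - s) + 2 * parameter θ s *
      ((s - 1) ^ 2 - 2 / 3 * θ * (s - 1) ^ 3)) =
      ∫ s in (1 : ℝ)..t, (2 * (s - 1) - 2 * θ * (s - 1) ^ 2) := by
    refine intervalIntegral.integral_congr fun s hs => ?_
    rw [uIcc_of_le ht.1] at hs
    have hs' : s ∈ Icc (1 : ℝ) 2 := ⟨hs.1, hs.2.trans ht.2⟩
    have h2 : θ * (s - 1) ≤ 1 := mul_le_one₀ hθ.2 (by linarith [hs.1]) (by linarith [hs'.2])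
    have h3 : 1 - 2 / 3 * θ * (s - 1) ≠ 0 := by
      have : 0 < 1 - 2 / 3 * θ * (s - 1) := by linarith
      exact this.ne'
    simp only [parameter, if_pos hs']
    have h4 : (1 - θ) / (1 - 2 / 3 * θ * (s - 1)) * (1 - 2 / 3 * θ * (s - 1)) = 1 - θ :=
      div_mul_cancel₀ _ h3
    linear_combination (2 * (s - 1) ^ 2) * h4
  rw [h1, intervalIntegral.integral_eq_sub_of_hasDerivAt
    (f := fun s => (s - 1) ^ 2 - 2 / 3 * θ * (s - 1) ^ 3)
    (fun s _ => ?_) (Continuous.intervalIntegrable (by fun_prop) _ _)]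
  · ring
  · refine ((((hasDerivAt_id s).sub_const 1).pow 2).sub
      ((((hasDerivAt_id s).sub_const 1).pow 3).const_mul (2 / 3 * θ))).congr_deriv ?_
    simp only [id]
    push_cast
    ring

/-! ### The nonlocal velocity of the fattening solution -/

/-- The half-length at time `t ≤ 2` of the zero superlevel set. The truncation of `t` makes it a
continuous function on the whole line. -/
noncomputable def len (y : ℝ → ℝ) (t : ℝ) : ℝ := if t ≤ 1 then x₁ t else y (min t 2)

/-- The density of the phase on the zero superlevel set. -/
noncomputable def strength (γ : ℝ → ℝ) (t : ℝ) : ℝ := if t ≤ 1 then 1 else γ t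

/-- The phase `χ` associated with the parameter `γ`. -/
noncomputable def phase (γ y : ℝ → ℝ) (x t : ℝ) : ℝ := if |x| ≤ len y t then strength γ t else 0

/-- The mass of the kernel seen from `x` in the zero superlevel set. -/
noncomputable def window (c₀ : ℝ → ℝ → ℝ) (y : ℝ → ℝ) (x t : ℝ) : ℝ :=
  ∫ z in (-len y t)..(len y t), c₀ (x - z) t

/-- The velocity generated by `phase`, extended by zero outside the time interval. -/
noncomputable def field (T : ℝ) (c₀ : ℝ → ℝ → ℝ) (γ y : ℝ → ℝ) (x : ℝ) : ℝ → ℝ :=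
  indicator (Ioo 0 T) fun t => velocity c₀ force (phase γ y) x t

/-- The velocity of the front: `field` near the origin, where the kernel is `1` at all relevant
distances. -/
noncomputable def frontSpeed (T : ℝ) (γ y : ℝ → ℝ) : ℝ → ℝ :=
  indicator (Ioo 0 T) fun s => if s ≤ 1 then 2 * (s - 1) else 2 * (s - 1) * (2 - s) + 2 * γ s * y s

section

variable {T L M r : ℝ} {c₀ : ℝ → ℝ → ℝ} {γ y : ℝ → ℝ}

theorem continuous_len (hy : IsFront γ y) : Continuous (len y) := by
  have h : Continuous fun t => y (max 1 (min t 2)) := by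
    refine hy.1.comp_continuous (by fun_prop) fun t => ⟨le_max_left _ _, ?_⟩
    exact max_le one_le_two (min_le_right _ _)
  have h2 : len y = fun t => if t ≤ 1 then x₁ t else y (max 1 (min t 2)) := by
    funext t
    unfold len
    split_ifs with ht
    · rfl
    · rw [max_eq_right (le_min (not_le.1 ht).le one_le_two)]
  rw [h2]
  have h3 : Continuous x₁ := by unfold x₁; fun_prop
  refine Continuous.if_le h3 h continuous_id continuous_const fun t ht => ?_
  subst ht
  rw [min_eq_left one_le_two, max_self, hy.one]
  simp [x₁]

theorem len_mem (hγ : Admissible γ) (hy : IsFront γ y) {t : ℝ} (ht : t ∈ Icc (0 : ℝ) 2) :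
    len y t ∈ Icc (0 : ℝ) 1 := by
  unfold len
  split_ifs with h
  · unfold x₁
    exact ⟨by positivity, by nlinarith [ht.1]⟩
  · have ht' : t ∈ Icc (1 : ℝ) 2 := ⟨(not_le.1 h).le, ht.2⟩
    rw [min_eq_left ht.2]
    have h1 := hy.le_sq hγ ht'
    exact ⟨hy.nonneg hγ ht', h1.trans (by nlinarith [ht'.1, ht'.2])⟩

theorem strength_mem (hγ : Admissible γ) {t : ℝ} (ht : t ≤ 2) : strength γ t ∈ Icc (0 : ℝ) 1 := by
  unfold strength
  split_ifs with h
  · exact ⟨zero_le_one, le_rfl⟩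
  · exact hγ.2 t ⟨(not_le.1 h).le, ht⟩

theorem measurable_strength (hγ : Admissible γ) : Measurable (strength γ) :=
  Measurable.ite measurableSet_Iic measurable_const hγ.1

theorem measurable_phase (hγ : Admissible γ) (hy : IsFront γ y) :
    Measurable fun z : ℝ × ℝ => phase γ y z.1 z.2 := by
  refine Measurable.ite ?_ ((measurable_strength hγ).comp measurable_snd) measurable_const
  exact measurableSet_le measurable_fst.abs ((continuous_len hy).measurable.comp measurable_snd)

theorem velocity_phase {x t : ℝ} (ht : 0 ≤ len y t) :
    velocity c₀ force (phase γ y) x t = strength γ t * window c₀ y x t + force x t := by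
  unfold velocity window
  have h1 : ∀ z, c₀ (x - z) t * phase γ y z t =
      indicator (Icc (-len y t) (len y t)) (fun z => strength γ t * c₀ (x - z) t) z := by
    intro z
    unfold phase
    by_cases hz : |z| ≤ len y t
    · rw [if_pos hz, indicator_of_mem (show z ∈ Icc _ _ from abs_le.1 hz), mul_comm]
    · rw [if_neg hz, indicator_of_notMem (show z ∉ Icc _ _ from fun h => hz (abs_le.2 h)), mul_zero]
  simp only [h1]
  rw [integral_indicator measurableSet_Icc, integral_Icc_eq_integral_Ioc,
    ← intervalIntegral.integral_of_le (by linarith), intervalIntegral.integral_const_mul]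

/-- Regularity of the velocity generated by a kernel, in terms of `window`. -/
structure RegularWindow (T : ℝ) (c₀ : ℝ → ℝ → ℝ) (y : ℝ → ℝ) (L M : ℝ) : Prop where
  continuousOn : ∀ x, ContinuousOn (window c₀ y x) (Ico 0 T)
  lip : ∀ t ∈ Ioo 0 T, ∀ x x', |window c₀ y x t - window c₀ y x' t| ≤ L * |x - x'|
  bound : ∀ t ∈ Ioo 0 T, ∀ x, |window c₀ y x t| ≤ M

theorem abs_force_le {x t : ℝ} (ht : t ∈ Icc (0 : ℝ) 2) : |force x t| ≤ 4 := by
  unfold force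
  exact abs_le.2 ⟨by nlinarith [ht.1, ht.2], by nlinarith [ht.1, ht.2]⟩

theorem abs_field_le (hγ : Admissible γ) (hy : IsFront γ y) (hT : T ∈ Ioc (1 : ℝ) 2)
    (hw : RegularWindow T c₀ y L M) (x t : ℝ) : |field T c₀ γ y x t| ≤ M + 4 := by
  have hM : 0 ≤ M := (abs_nonneg _).trans (hw.bound 1 ⟨one_pos, hT.1⟩ 0)
  unfold field
  by_cases ht : t ∈ Ioo 0 T
  · have ht' : t ∈ Icc (0 : ℝ) 2 := ⟨ht.1.le, ht.2.le.trans hT.2⟩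
    rw [indicator_of_mem ht, velocity_phase (len_mem hγ hy ht').1]
    have h1 := strength_mem hγ ht'.2
    refine (abs_add_le _ _).trans (add_le_add ?_ (abs_force_le ht'))
    rw [abs_mul, abs_of_nonneg h1.1]
    exact (mul_le_of_le_one_left (abs_nonneg _) h1.2).trans (hw.bound t ht x)
  · rw [indicator_of_notMem ht, abs_zero]
    positivity

theorem caratheodory_field (hγ : Admissible γ) (hy : IsFront γ y) (hT : T ∈ Ioc (1 : ℝ) 2)
    (hw : RegularWindow T c₀ y L M) : Caratheodory (field T c₀ γ y) L (M + 4) := by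
  have hlen : ∀ t ∈ Ioo 0 T, 0 ≤ len y t := fun t ht =>
    (len_mem hγ hy ⟨ht.1.le, ht.2.le.trans hT.2⟩).1
  refine ⟨fun x => ?_, fun t x x' => ?_, fun t => abs_field_le hγ hy hT hw 0 t⟩
  · have h1 : Measurable ((Ioo 0 T).piecewise (window c₀ y x) fun _ => 0) :=
      ((hw.continuousOn x).mono Ioo_subset_Ico_self).measurable_piecewise continuousOn_const
        measurableSet_Ioo
    have h2 : Measurable (indicator (Ioo 0 T) (force x)) :=
      Measurable.indicator (by unfold force; fun_prop) measurableSet_Ioo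
    convert ((measurable_strength hγ).mul h1).add h2 using 1
    funext t
    by_cases ht : t ∈ Ioo 0 T
    · simp only [field, indicator_of_mem ht, Pi.add_apply, Pi.mul_apply,
        piecewise_eq_of_mem _ _ _ ht]
      exact velocity_phase (hlen t ht)
    · simp only [field, indicator_of_notMem ht, Pi.add_apply, Pi.mul_apply,
        piecewise_eq_of_notMem _ _ _ ht]
      simp
  · unfold field
    by_cases ht : t ∈ Ioo 0 T
    · rw [indicator_of_mem ht, indicator_of_mem ht, velocity_phase (hlen t ht),
        velocity_phase (hlen t ht)]
      have h1 := strength_mem hγ (ht.2.le.trans hT.2)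
      rw [show strength γ t * window c₀ y x t + force x t -
        (strength γ t * window c₀ y x' t + force x' t) =
        strength γ t * (window c₀ y x t - window c₀ y x' t) by unfold force; ring, abs_mul,
        abs_of_nonneg h1.1]
      exact (mul_le_of_le_one_left (abs_nonneg _) h1.2).trans (hw.lip t ht x x')
    · rw [indicator_of_notMem ht, indicator_of_notMem ht, sub_self, abs_zero]
      have := (abs_nonneg _).trans (hw.lip 1 ⟨one_pos, hT.1⟩ 1 0)
      rw [sub_zero, abs_one, mul_one] at this
      positivity

theorem field_eq_frontSpeed (hγ : Admissible γ) (hy : IsFront γ y) (hT : T ∈ Ioc (1 : ℝ) 2)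
    (hc : ∀ t ∈ Ico 0 T, ∀ x, |x| ≤ r + 3 → c₀ x t = 1) {x s : ℝ} (hx : |x| ≤ r + 2) :
    field T c₀ γ y x s = frontSpeed T γ y s := by
  unfold field frontSpeed
  by_cases hs : s ∈ Ioo 0 T
  · rw [indicator_of_mem hs, indicator_of_mem hs]
    have hl := len_mem hγ hy (t := s) ⟨hs.1.le, hs.2.le.trans hT.2⟩
    have hwin : window c₀ y x s = 2 * len y s := by
      unfold window
      have : ∫ z in (-len y s)..(len y s), c₀ (x - z) s =
          ∫ _z in (-len y s)..(len y s), (1 : ℝ) := by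
        refine intervalIntegral.integral_congr fun z hz => hc s ⟨hs.1.le, hs.2⟩ _ ?_
        rw [uIcc_of_le (by linarith [hl.1])] at hz
        have h1 := abs_le.1 hx
        exact abs_le.2 ⟨by linarith [hz.2, hl.2], by linarith [hz.1, hl.2]⟩
      rw [this, intervalIntegral.integral_const, smul_eq_mul]
      ring
    rw [velocity_phase hl.1, hwin]
    unfold strength len force
    split_ifs with h
    · unfold x₁
      ring
    · rw [min_eq_left (hs.2.le.trans hT.2)]
      ring
  · rw [indicator_of_notMem hs, indicator_of_notMem hs]

theorem front_before (hT : 1 < T) {t : ℝ} (ht : t ∈ Icc (0 : ℝ) 1) :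
    1 + ∫ s in (0 : ℝ)..t, frontSpeed T γ y s = x₁ t := by
  have h1 : ∫ s in (0 : ℝ)..t, frontSpeed T γ y s = ∫ s in (0 : ℝ)..t, 2 * (s - 1) := by
    refine intervalIntegral.integral_congr_Ioo_of_le ht.1 fun s hs => ?_
    have hs1 : s ≤ 1 := hs.2.le.trans ht.2
    simp only [frontSpeed, indicator_of_mem (show s ∈ Ioo 0 T from ⟨hs.1, by linarith⟩), if_pos hs1]
  rw [h1, integral_two_mul_sub_one]
  unfold x₁
  ring

theorem front_after (hy : IsFront γ y) (hT : T ∈ Ioc (1 : ℝ) 2)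
    (hi : ∀ a b, IntervalIntegrable (frontSpeed T γ y) volume a b) {t : ℝ} (ht : t ∈ Icc 1 T) :
    1 + ∫ s in (0 : ℝ)..t, frontSpeed T γ y s = y t := by
  have h1 := intervalIntegral.integral_add_adjacent_intervals (hi 0 1) (hi 1 t)
  have h2 := front_before (γ := γ) (y := y) hT.1 (right_mem_Icc.2 zero_le_one)
  have h3 : ∫ s in (1 : ℝ)..t, frontSpeed T γ y s = y t := by
    rw [hy.2 t ⟨ht.1, ht.2.trans hT.2⟩]
    refine intervalIntegral.integral_congr_Ioo_of_le ht.1 fun s hs => ?_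
    simp only [frontSpeed, indicator_of_mem
      (show s ∈ Ioo 0 T from ⟨by linarith [hs.1], hs.2.trans_le ht.2⟩), if_neg (not_le.2 hs.1)]
  rw [← h1, h3, ← add_assoc, h2]
  simp [x₁]

theorem frontData_field (hγ : Admissible γ) (hy : IsFront γ y) (hT : T ∈ Ioc (1 : ℝ) 2)
    (hw : RegularWindow T c₀ y L M) (hr : 0 ≤ r)
    (hc : ∀ t ∈ Ico 0 T, ∀ x, |x| ≤ r + 3 → c₀ x t = 1) :
    FrontData r (field T c₀ γ y) (frontSpeed T γ y)
      (fun t => 1 + ∫ s in (0 : ℝ)..t, frontSpeed T γ y s) := by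
  have hf := caratheodory_field hγ hy hT hw
  have heq : ∀ x s, |x| ≤ r + 2 → field T c₀ γ y x s = frontSpeed T γ y s := fun x s hx =>
    field_eq_frontSpeed hγ hy hT hc hx
  have hi : ∀ a b, IntervalIntegrable (frontSpeed T γ y) volume a b := fun a b =>
    (hf.intervalIntegrable (continuous_const (y := (0 : ℝ))) a b).congr fun s _ =>
      heq 0 s (by rw [abs_zero]; linarith)
  -- outside the time interval the speed vanishes, so that the front stays where it is
  have hout : ∀ s ∉ Ioo 0 T, frontSpeed T γ y s = 0 := fun s hs => indicator_of_notMem hs _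
  have hneg : ∀ t ≤ 0, 1 + ∫ s in (0 : ℝ)..t, frontSpeed T γ y s = 1 := by
    intro t ht
    rw [intervalIntegral.integral_symm,
      intervalIntegral.integral_congr_Ioo_of_le (g := fun _ => (0 : ℝ)) ht
        fun s hs => hout s fun h => absurd h.1 (not_lt.2 hs.2.le)]
    simp
  have hlate : ∀ t, T ≤ t → 1 + ∫ s in (0 : ℝ)..t, frontSpeed T γ y s = y T := by
    intro t ht
    rw [← intervalIntegral.integral_add_adjacent_intervals (hi 0 T) (hi T t), ← add_assoc,
      front_after hy hT hi (right_mem_Icc.2 hT.1.le),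
      intervalIntegral.integral_congr_Ioo_of_le (g := fun _ => (0 : ℝ)) ht
      fun s hs => hout s fun h => absurd h.2 (not_lt.2 hs.1.le)]
    simp
  have hy1 : ∀ t ∈ Icc (1 : ℝ) 2, y t ∈ Icc (0 : ℝ) 1 := fun t ht =>
    ⟨hy.nonneg hγ ht, (hy.le_sq hγ ht).trans (by nlinarith [ht.1, ht.2])⟩
  refine ⟨hr, heq, ?_, fun t => rfl, fun t => ?_, fun t ht => front_before hT.1 ht, fun t ht => ?_⟩
  · intro s hs
    simp only [frontSpeed, indicator_of_mem (show s ∈ Ioo 0 T from ⟨hs.1, hs.2.trans hT.1⟩),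
      if_pos hs.2.le]
  · rcases le_total t 0 with h0 | h0
    · simp only [hneg t h0]
      exact ⟨zero_le_one, le_rfl⟩
    rcases le_total t 1 with h1 | h1
    · simp only [front_before (γ := γ) (y := y) hT.1 ⟨h0, h1⟩]
      unfold x₁
      exact ⟨by positivity, by nlinarith⟩
    rcases le_total t T with h2 | h2
    · simp only [front_after hy hT hi ⟨h1, h2⟩]
      exact hy1 t ⟨h1, h2.trans hT.2⟩
    · simp only [hlate t h2]
      exact hy1 T ⟨hT.1.le, hT.2⟩
  · rcases le_total t T with h2 | h2
    · simp only [front_after hy hT hi ⟨ht.le, h2⟩]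
      exact hy.pos hγ ⟨ht, h2.trans hT.2⟩
    · simp only [hlate t h2]
      exact hy.pos hγ hT

theorem U_eq_min {x t : ℝ} (ht : t ∈ Icc (0 : ℝ) 2) :
    U y x t = min (len y t - |x|) (cap t) := by
  unfold U len
  split_ifs with h1 h2
  · rw [cap_of_le h1]
    have h3 : 0 ≤ |x| - x₁ t + 1 := by
      have := abs_nonneg x
      unfold x₁
      nlinarith [ht.1]
    rw [uBefore, datum, abs_of_nonneg h3, min_eq_left (by linarith [abs_nonneg x])]
    ring
  · rw [cap_of_ge (not_le.1 h1).le, min_eq_left ht.2, min_eq_right (by linarith)]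
  · rw [cap_of_ge (not_le.1 h1).le, min_eq_left ht.2, min_eq_left (by linarith)]
    have h3 : 0 ≤ |x| - y t - x₁ 1 + 1 := by
      unfold x₁
      linarith
    have h4 : 0 ≤ |x| - y t := by linarith
    rw [uBefore, datum, abs_of_nonneg h4, abs_of_nonneg h3]
    unfold x₁
    ring

theorem front_eq_len (hγ : Admissible γ) (hy : IsFront γ y) (hT : T ∈ Ioc (1 : ℝ) 2)
    (hw : RegularWindow T c₀ y L M) (hc : ∀ t ∈ Ico 0 T, ∀ x, |x| ≤ 3 → c₀ x t = 1)
    {t : ℝ} (ht : t ∈ Ico 0 T) : 1 + ∫ s in (0 : ℝ)..t, frontSpeed T γ y s = len y t := by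
  have hd := frontData_field (r := 0) hγ hy hT hw le_rfl (by simpa using hc)
  unfold len
  split_ifs with h
  · exact front_before hT.1 ⟨ht.1, h⟩
  · rw [min_eq_left (ht.2.le.trans hT.2)]
    exact front_after hy hT (hd.intervalIntegrable (caratheodory_field hγ hy hT hw))
      ⟨(not_le.1 h).le, ht.2.le⟩

theorem bump_field_eq_U (hγ : Admissible γ) (hy : IsFront γ y) (hT : T ∈ Ioc (1 : ℝ) 2)
    (hw : RegularWindow T c₀ y L M) (hr : 0 ≤ r)
    (hc : ∀ t ∈ Ico 0 T, ∀ x, |x| ≤ r + 3 → c₀ x t = 1) {x t : ℝ} (ht : t ∈ Ico 0 T)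
    (hx : |x| ≤ r + 1) : bump (field T c₀ γ y) x t = U y x t := by
  rw [(frontData_field hγ hy hT hw hr hc).bump_eq (caratheodory_field hγ hy hT hw) hx,
    U_eq_min ⟨ht.1, ht.2.le.trans hT.2⟩,
    front_eq_len hγ hy hT hw (fun t ht x hx => hc t ht x (by linarith)) ht]

theorem IsL1Solution.congr_velocity {T : ℝ} {c c' : ℝ → ℝ → ℝ} {u₀ : ℝ → ℝ} {v : ℝ → ℝ → ℝ}
    (h : IsL1Solution T c u₀ v) (hc : ∀ t ∈ Ioo 0 T, ∀ x, c x t = c' x t) :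
    IsL1Solution T c' u₀ v := by
  refine ⟨⟨h.1.1, h.1.2.1, ?_⟩, ⟨h.2.1, h.2.2.1, ?_⟩⟩
  · intro x₀ t₀ b φ G h1 h2 h3 h4 h5 ⟨δ, hδ, h6⟩
    refine h.1.2.2 x₀ t₀ b φ G h1 h2 h3 h4 h5 ⟨δ, hδ, ?_⟩
    filter_upwards [h6] with t ht h7 h8 x p h9 h10
    rw [hc t h7]
    exact ht h7 h8 x p h9 h10
  · intro x₀ t₀ b φ G h1 h2 h3 h4 h5 ⟨δ, hδ, h6⟩
    refine h.2.2.2 x₀ t₀ b φ G h1 h2 h3 h4 h5 ⟨δ, hδ, ?_⟩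
    filter_upwards [h6] with t ht h7 h8 x p h9 h10
    rw [hc t h7]
    exact ht h7 h8 x p h9 h10

theorem FrontData.abs_lt_of_bump_pos {f : ℝ → ℝ → ℝ} {h l : ℝ → ℝ} (hf : Caratheodory f L M)
    (hd : FrontData r f h l) {x t : ℝ} (hpos : 0 < bump f x t) : |x| < l t ∧ t < 1 := by
  have key : ∀ {f : ℝ → ℝ → ℝ}, Caratheodory f L M → FrontData r f h l → ∀ x, 0 ≤ x →
      0 < bump f x t → x < l t := by
    intro f hf hd x hx hpos
    by_contra! hlt
    have h1 : |l t| ≤ r + 1 := by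
      rw [abs_of_nonneg (hd.l_mem t).1]
      linarith [(hd.l_mem t).2, hd.r_nonneg]
    have h2 := transported_antitone hf t hlt
    simp only [hd.transported_eq hf h1, sub_self] at h2
    rw [hd.bump_of_nonneg hf hx] at hpos
    exact absurd (hpos.trans_le (min_le_left _ _)) (not_lt.2 h2)
  constructor
  · rcases le_total 0 x with hx | hx
    · rw [abs_of_nonneg hx]
      exact key hf hd x hx hpos
    · rw [abs_of_nonpos hx]
      refine key hf.comp_neg hd.comp_neg (-x) (by linarith) ?_
      rwa [← bump_neg, neg_neg]
  · by_contra! h1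
    have h2 := hpos.trans_le (min_le_right _ _)
    rw [cap_of_ge h1] at h2
    exact lt_irrefl _ h2

/-- The bump generated by the phase has that phase: it is positive only before `t = 1` and inside
the front, where the phase is `1`, and nonnegative wherever the phase does not vanish. -/
theorem isWeakSolution_bump (hγ : Admissible γ) (hy : IsFront γ y) (hT : T ∈ Ioc (1 : ℝ) 2)
    (hw : RegularWindow T c₀ y L M) (hc : ∀ t ∈ Ico 0 T, ∀ x, |x| ≤ 3 → c₀ x t = 1) :
    IsWeakSolution T c₀ force datum (bump (field T c₀ γ y)) := by
  have hf := caratheodory_field hγ hy hT hw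
  have hb := abs_field_le hγ hy hT hw
  have hd := frontData_field (r := 0) hγ hy hT hw le_rfl (by simpa using hc)
  refine ⟨?_, phase γ y, measurable_phase hγ hy, ?_, ?_, ?_⟩
  · obtain ⟨K, hK⟩ := bump_lipschitz hf hb
    exact ⟨K, hK.mono (prod_mono subset_rfl fun t ht => ⟨ht.1, ht.2.le.trans hT.2⟩)⟩
  · intro x t ht
    have := strength_mem hγ (ht.2.le.trans hT.2)
    unfold phase
    split_ifs
    · exact this
    · exact ⟨le_rfl, zero_le_one⟩
  · refine ae_restrict_of_forall_mem (MeasurableSet.univ.prod measurableSet_Ioo) ?_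
    rintro ⟨x, t⟩ ⟨-, ht⟩
    have ht : t ∈ Ioo 0 T := ht
    have hs := strength_mem hγ (ht.2.le.trans hT.2)
    have hl := len_mem hγ hy (t := t) ⟨ht.1.le, ht.2.le.trans hT.2⟩
    have hlen := front_eq_len hγ hy hT hw hc ⟨ht.1.le, ht.2⟩
    have hcap : 0 ≤ cap t := by unfold cap; positivity
    simp only [indPos, indNonneg, phase, indicator, mem_ofPred_eq]
    constructor
    · split_ifs with h1 h2
      · have h3 := (hd.abs_lt_of_bump_pos hf h1).2
        rw [strength, if_pos h3.le]
      · have h3 := (hd.abs_lt_of_bump_pos hf h1).1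
        rw [hlen] at h3
        exact absurd h3.le h2
      · exact hs.1
      · exact le_rfl
    · split_ifs with h1 h2 h3
      · exact hs.2
      · refine absurd ?_ h2
        rw [hd.bump_eq hf (by linarith [hl.2])]
        exact le_min (by rw [hlen]; linarith) hcap
      · exact zero_le_one
      · exact le_rfl
  · refine (isL1Solution_bump hf hb hd hT.2).congr_velocity fun t ht x => ?_
    exact indicator_of_mem ht _

theorem IsWeakSolution.congr {u v : ℝ → ℝ → ℝ} {c₁ : ℝ → ℝ → ℝ} {u₀ : ℝ → ℝ} (hT : 0 < T)
    (h : IsWeakSolution T c₀ c₁ u₀ u) (huv : ∀ t ∈ Ico 0 T, ∀ x, u x t = v x t) :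
    IsWeakSolution T c₀ c₁ u₀ v := by
  obtain ⟨⟨K, hK⟩, χ, h1, h2, h3, ⟨h4, h5, h6⟩, h7, h8, h9⟩ := h
  have h0 : (0 : ℝ) ∈ Ico 0 T := ⟨le_rfl, hT⟩
  have hcov : ∀ t ∈ Ioo 0 T, ∀ x, u x t = v x t := fun t ht => huv t ⟨ht.1.le, ht.2⟩
  have hKv : LipschitzOnWith K (fun z : ℝ × ℝ => v z.1 z.2) (univ ×ˢ Ico 0 T) :=
    fun z hz w hw => by simpa only [huv z.2 hz.2, huv w.2 hw.2] using hK hz hw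
  refine ⟨⟨K, hKv⟩, χ, h1, h2, ?_, ⟨hKv.continuousOn.upperSemicontinuousOn, fun x => ?_, ?_⟩,
    ⟨hKv.continuousOn.lowerSemicontinuousOn, fun x => ?_, ?_⟩⟩
  · filter_upwards [h3, ae_restrict_mem (MeasurableSet.univ.prod measurableSet_Ioo)] with z hz hzT
    simpa only [indPos, indNonneg, hcov z.2 hzT.2, indicator, mem_ofPred_eq] using hz
  · rw [← huv 0 h0]
    exact h5 x
  · intro x₀ t₀ b φ G ht₀ hb hφ hG hm
    refine h6 x₀ t₀ b φ G ht₀ hb hφ hG (hm.congr ?_ ⟨mem_univ _, ht₀⟩)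
    filter_upwards [self_mem_nhdsWithin] with z hz
    rw [hcov z.2 hz.2]
  · rw [← huv 0 h0]
    exact h8 x
  · intro x₀ t₀ b φ G ht₀ hb hφ hG hm
    refine h9 x₀ t₀ b φ G ht₀ hb hφ hG (hm.congr ?_ ⟨mem_univ _, ht₀⟩)
    filter_upwards [self_mem_nhdsWithin] with z hz
    rw [hcov z.2 hz.2]

end

/-! ### Kernels -/

theorem regularWindow_one {T : ℝ} {γ y : ℝ → ℝ} (hγ : Admissible γ) (hy : IsFront γ y)
    (hT : T ≤ 2) : RegularWindow T one y 0 2 := by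
  have hwin : ∀ x t, window one y x t = 2 * len y t := by
    intro x t
    simp only [window, one, intervalIntegral.integral_const, smul_eq_mul]
    ring
  refine ⟨fun x => ?_, fun t _ x x' => by simp [hwin], fun t ht x => ?_⟩
  · rw [show window one y x = fun t => 2 * len y t from funext (hwin x)]
    exact (continuous_const.mul (continuous_len hy)).continuousOn
  · have := len_mem hγ hy (t := t) ⟨ht.1.le, ht.2.le.trans hT⟩
    rw [hwin, abs_of_nonneg (by linarith [this.1])]
    linarith [this.2]

/-- A smooth approximation of the indicator function of `(a, b]`. -/
noncomputable def step (a b : ℝ) (n : ℕ) (z : ℝ) : ℝ :=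
  Real.smoothTransition (n * (z - a)) - Real.smoothTransition (n * (z - b))

theorem contDiff_step (a b : ℝ) (n : ℕ) : ContDiff ℝ ∞ (step a b n) :=
  (Real.smoothTransition.contDiff.comp (contDiff_const.mul (contDiff_id.sub contDiff_const))).sub
    (Real.smoothTransition.contDiff.comp (contDiff_const.mul (contDiff_id.sub contDiff_const)))

theorem abs_step_le (a b : ℝ) (n : ℕ) (z : ℝ) : |step a b n z| ≤ 1 := by
  unfold step
  have h1 := Real.smoothTransition.nonneg (n * (z - a))
  have h2 := Real.smoothTransition.le_one (n * (z - a))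
  have h3 := Real.smoothTransition.nonneg (n * (z - b))
  have h4 := Real.smoothTransition.le_one (n * (z - b))
  exact abs_le.2 ⟨by linarith, by linarith⟩

theorem step_eq_zero {a b : ℝ} (hab : a ≤ b) {n : ℕ} (hn : 1 ≤ n) {z : ℝ}
    (hz : z ≤ a ∨ b + 1 ≤ z) : step a b n z = 0 := by
  have hn' : (1 : ℝ) ≤ n := by exact_mod_cast hn
  unfold step
  rcases hz with hz | hz
  · rw [Real.smoothTransition.zero_of_nonpos (by nlinarith),
      Real.smoothTransition.zero_of_nonpos (by nlinarith), sub_self]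
  · rw [Real.smoothTransition.one_of_one_le (by nlinarith),
      Real.smoothTransition.one_of_one_le (by nlinarith), sub_self]

theorem tendsto_smoothTransition (a z : ℝ) :
    Tendsto (fun n : ℕ => Real.smoothTransition (n * (z - a))) atTop
      (𝓝 (indicator (Ioi a) (fun _ => 1) z)) := by
  by_cases hz : a < z
  · rw [indicator_of_mem (show z ∈ Ioi a from hz)]
    have h1 : Tendsto (fun n : ℕ => (n : ℝ) * (z - a)) atTop atTop :=
      tendsto_natCast_atTop_atTop.atTop_mul_const (by linarith)
    refine tendsto_const_nhds.congr' ?_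
    filter_upwards [h1.eventually (eventually_ge_atTop 1)] with n hn
    exact (Real.smoothTransition.one_of_one_le hn).symm
  · rw [indicator_of_notMem (show z ∉ Ioi a from hz)]
    refine tendsto_const_nhds.congr fun n => ?_
    exact (Real.smoothTransition.zero_of_nonpos (mul_nonpos_of_nonneg_of_nonpos n.cast_nonneg
      (by linarith))).symm

theorem tendsto_step {a b : ℝ} (hab : a ≤ b) (z : ℝ) :
    Tendsto (fun n : ℕ => step a b n z) atTop (𝓝 (indicator (Ioc a b) (fun _ => 1) z)) := by
  have key : indicator (Ioc a b) (fun _ => (1 : ℝ)) z =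
      indicator (Ioi a) (fun _ => 1) z - indicator (Ioi b) (fun _ => 1) z := by
    rw [← Ioi_sdiff_Ioi, indicator_sdiff (Ioi_subset_Ioi hab)]
    rfl
  rw [key]
  exact (tendsto_smoothTransition a z).sub (tendsto_smoothTransition b z)

/-- Translation of an interval changes the integral of `f` over it by at most the length of the
translation times the `L¹` norm of the weak derivative: the derivative of the difference of two
integrated steps is an admissible test function. -/
theorem HasWeakDeriv.abs_integral_shift_le {f g : ℝ → ℝ} (hf : Integrable f) (hg : Integrable g)
    (hfg : HasWeakDeriv f g) {a b : ℝ} (hab : a ≤ b) (h : ℝ) :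
    |(∫ z in (a + h)..(b + h), f z) - ∫ z in a..b, f z| ≤ (∫ z, |g z|) * |h| := by
  set ψ : ℕ → ℝ → ℝ := fun n z => ∫ w in z..(z - h), step a b n w with hψ
  have hsc : ∀ n, Continuous (step a b n) := fun n => (contDiff_step a b n).continuous
  have hF : ∀ n w, HasDerivAt (fun w => ∫ v in (0 : ℝ)..w, step a b n v) (step a b n w) w :=
    fun n w => intervalIntegral.integral_hasDerivAt_right ((hsc n).intervalIntegrable _ _)
      (hsc n).stronglyMeasurable.stronglyMeasurableAtFilter (hsc n).continuousAt
  have hψF : ∀ n, ψ n = fun z => (∫ v in (0 : ℝ)..(z - h), step a b n v) -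
      ∫ v in (0 : ℝ)..z, step a b n v := by
    intro n
    funext z
    rw [intervalIntegral.integral_interval_sub_left ((hsc n).intervalIntegrable _ _)
      ((hsc n).intervalIntegrable _ _)]
  have hψd : ∀ n z, HasDerivAt (ψ n) (step a b n (z - h) - step a b n z) z := by
    intro n z
    rw [hψF]
    exact ((hF n (z - h)).comp_sub_const z h).sub (hF n z)
  have hψc : ∀ n, ContDiff ℝ ∞ (ψ n) := by
    intro n
    rw [contDiff_infty_iff_deriv]
    refine ⟨fun z => (hψd n z).differentiableAt, ?_⟩
    rw [show deriv (ψ n) = fun z => step a b n (z - h) - step a b n z from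
      funext fun z => (hψd n z).deriv]
    exact ((contDiff_step a b n).comp (contDiff_id.sub contDiff_const)).sub (contDiff_step a b n)
  have hψs : ∀ n, 1 ≤ n → HasCompactSupport (ψ n) := by
    intro n hn
    refine HasCompactSupport.intro (isCompact_Icc (a := a - |h|) (b := b + 1 + |h|)) fun z hz => ?_
    have hh := abs_le.1 (le_refl |h|)
    have : ∀ w ∈ uIcc z (z - h), step a b n w = 0 := by
      intro w hw
      refine step_eq_zero hab hn ?_
      rw [mem_uIcc] at hw
      rw [mem_Icc, not_and_or, not_le, not_le] at hz
      rcases hz with hz | hz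
      · left
        rcases hw with hw | hw
        · linarith [hw.2]
        · linarith [hw.2, abs_nonneg h]
      · right
        rcases hw with hw | hw
        · linarith [hw.1, abs_nonneg h]
        · linarith [hw.1]
    simp only [hψ]
    rw [intervalIntegral.integral_congr this]
    simp
  have hψb : ∀ n z, |ψ n z| ≤ |h| := by
    intro n z
    have := intervalIntegral.norm_integral_le_of_norm_le_const (a := z) (b := z - h)
      (f := step a b n) (C := 1) fun w _ => abs_step_le a b n w
    rwa [one_mul, sub_sub_cancel_left, abs_neg] at this
  have hbound : ∀ n, 1 ≤ n →
      |∫ z, f z * (step a b n (z - h) - step a b n z)| ≤ (∫ z, |g z|) * |h| := by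
    intro n hn
    have h1 := hfg (ψ n) (hψc n) (hψs n hn)
    simp only [(hψd n _).deriv] at h1
    rw [h1, abs_neg, ← integral_mul_const]
    refine norm_integral_le_of_norm_le (f := fun z => g z * ψ n z) (hg.abs.mul_const _)
      (ae_of_all _ fun z => ?_)
    rw [norm_mul]
    exact mul_le_mul_of_nonneg_left (hψb n z) (norm_nonneg _)
  have hlim : Tendsto (fun n : ℕ => ∫ z, f z * (step a b n (z - h) - step a b n z)) atTop
      (𝓝 (∫ z, f z * (indicator (Ioc a b) (fun _ => 1) (z - h) -
        indicator (Ioc a b) (fun _ => 1) z))) := by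
    refine tendsto_integral_of_dominated_convergence (fun z => |f z| * 2) (fun n => ?_)
      (hf.abs.mul_const _) (fun n => ae_of_all _ fun z => ?_) (ae_of_all _ fun z => ?_)
    · refine hf.aestronglyMeasurable.mul (Continuous.aestronglyMeasurable ?_)
      exact ((hsc n).comp (continuous_id.sub continuous_const)).sub (hsc n)
    · rw [norm_mul]
      refine mul_le_mul_of_nonneg_left ((norm_sub_le _ _).trans ?_) (norm_nonneg _)
      have h1 := abs_step_le a b n (z - h)
      have h2 := abs_step_le a b n z
      simp only [Real.norm_eq_abs]
      linarith
    · exact ((tendsto_step hab _).sub (tendsto_step hab z)).const_mul _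
  have hval : ∫ z, f z * (indicator (Ioc a b) (fun _ => 1) (z - h) -
        indicator (Ioc a b) (fun _ => 1) z) =
      (∫ z in (a + h)..(b + h), f z) - ∫ z in a..b, f z := by
    have h1 : ∀ z, f z * (indicator (Ioc a b) (fun _ => 1) (z - h) -
        indicator (Ioc a b) (fun _ => 1) z) =
        indicator (Ioc (a + h) (b + h)) f z - indicator (Ioc a b) f z := by
      intro z
      have h2 : z - h ∈ Ioc a b ↔ z ∈ Ioc (a + h) (b + h) := by
        simp only [mem_Ioc]
        constructor <;> rintro ⟨h3, h4⟩ <;> constructor <;> linarith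
      rw [mul_sub]
      simp only [indicator, h2, mul_ite, mul_one, mul_zero]
      split_ifs <;> rfl
    simp only [h1]
    rw [integral_sub (hf.indicator measurableSet_Ioc) (hf.indicator measurableSet_Ioc),
      integral_indicator measurableSet_Ioc, integral_indicator measurableSet_Ioc,
      intervalIntegral.integral_of_le hab, intervalIntegral.integral_of_le (by linarith)]
  rw [← hval]
  refine le_of_tendsto hlim.abs ?_
  filter_upwards [eventually_ge_atTop 1] with n hn
  exact hbound n hn

section

variable {T : ℝ} {c₀ c₁ : ℝ → ℝ → ℝ} {γ y : ℝ → ℝ}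

theorem window_eq (x t : ℝ) :
    window c₀ y x t = ∫ z in (x - len y t)..(x + len y t), c₀ z t := by
  unfold window
  rw [intervalIntegral.integral_comp_sub_left (fun z => c₀ z t) x]
  congr 1
  ring

theorem continuousOn_window (hy : IsFront γ y) (hreg : Regular T c₀ c₁) (x : ℝ) :
    ContinuousOn (window c₀ y x) (Ico 0 T) := by
  intro t ht
  have hi := fun s hs => (hreg.integrable s hs)
  have hA : Tendsto (fun s => ∫ z in (x - len y s)..(x + len y s), (c₀ z s - c₀ z t))
      (𝓝[Ico 0 T] t) (𝓝 0) := by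
    refine squeeze_zero_norm' ?_ (hreg.continuous t ht)
    filter_upwards [self_mem_nhdsWithin] with s hs
    refine intervalIntegral.norm_integral_le_integral_norm_uIoc.trans ?_
    exact setIntegral_le_integral ((hi s hs).sub (hi t ht)).norm
      (ae_of_all _ fun z => norm_nonneg _)
  have hB : Tendsto (fun s => ∫ z in (x - len y s)..(x + len y s), c₀ z t)
      (𝓝[Ico 0 T] t) (𝓝 (window c₀ y x t)) := by
    have h1 := intervalIntegral.continuous_primitive
      (fun a b => (hi t ht).intervalIntegrable (a := a) (b := b)) 0
    have h2 := continuous_len hy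
    have h3 : Continuous fun s => (∫ z in (0 : ℝ)..(x + len y s), c₀ z t) -
        ∫ z in (0 : ℝ)..(x - len y s), c₀ z t :=
      (h1.comp (continuous_const.add h2)).sub (h1.comp (continuous_const.sub h2))
    have h4 : (fun s => ∫ z in (x - len y s)..(x + len y s), c₀ z t) =
        fun s => (∫ z in (0 : ℝ)..(x + len y s), c₀ z t) -
          ∫ z in (0 : ℝ)..(x - len y s), c₀ z t := by
      funext s
      rw [intervalIntegral.integral_interval_sub_left (hi t ht).intervalIntegrable
        (hi t ht).intervalIntegrable]
    rw [window_eq, h4]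
    have h5 := (h3.tendsto t).mono_left (nhdsWithin_le_nhds (s := Ico 0 T))
    rwa [← congrFun h4 t] at h5
  have hAB := hA.add hB
  rw [zero_add] at hAB
  refine hAB.congr' ?_
  filter_upwards [self_mem_nhdsWithin] with s hs
  rw [window_eq, intervalIntegral.integral_sub (hi s hs).intervalIntegrable
    (hi t ht).intervalIntegrable]
  ring

theorem regularWindow_of_regular (hγ : Admissible γ) (hy : IsFront γ y) (hT : T ≤ 2)
    (hreg : Regular T c₀ c₁) : ∃ L M, RegularWindow T c₀ y L M := by
  obtain ⟨M, hM⟩ := hreg.bounded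
  obtain ⟨L, hL⟩ := hreg.deriv_bounded
  have hcont := continuousOn_window hy hreg
  refine ⟨L, M, hcont, ?_, fun t ht x => ?_⟩
  · intro t ht x x'
    -- the bound holds for almost every `t`, hence on a dense set of times
    set F : ℝ → ℝ := fun s => |window c₀ y x s - window c₀ y x' s| with hF
    have hFc : ContinuousOn F (Ioo 0 T) :=
      (((hcont x).sub (hcont x')).abs).mono Ioo_subset_Ico_self
    have hae : ∀ᵐ s : ℝ, s ∈ Ioo 0 T → F s ≤ L * |x - x'| := by
      filter_upwards [hL] with s hs hsT
      have hs' : s ∈ Ico 0 T := ⟨hsT.1.le, hsT.2⟩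
      obtain ⟨g, hg, hw, hgL⟩ := hs hs'
      have hlen := (len_mem hγ hy (t := s) ⟨hsT.1.le, hsT.2.le.trans hT⟩).1
      have := hw.abs_integral_shift_le (hreg.integrable s hs') hg
        (a := x' - len y s) (b := x' + len y s) (by linarith) (x - x')
      simp only [hF, window_eq]
      rw [show x' - len y s + (x - x') = x - len y s by ring,
        show x' + len y s + (x - x') = x + len y s by ring] at this
      exact this.trans (mul_le_mul_of_nonneg_right hgL (abs_nonneg _))
    by_contra! hlt
    have hopen : ∀ᶠ s in 𝓝 t, L * |x - x'| < F s :=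
      (hFc.continuousAt (isOpen_Ioo.mem_nhds ht)).eventually (lt_mem_nhds hlt)
    obtain ⟨s, hs1, hs2, hs3⟩ := ((Measure.dense_of_ae hae).inter_nhds_nonempty
      (inter_mem hopen (isOpen_Ioo.mem_nhds ht)))
    exact absurd (hs1 hs3) (not_le.2 hs2)
  · have ht' : t ∈ Ico 0 T := ⟨ht.1.le, ht.2⟩
    rw [window_eq]
    refine (intervalIntegral.norm_integral_le_integral_norm_uIoc
      (f := fun z => c₀ z t) (μ := volume)).trans ?_
    exact (setIntegral_le_integral (hreg.integrable t ht').norm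
      (ae_of_all _ fun z => norm_nonneg _)).trans (hM t ht')

end

/-- A smooth bump function, constant in time, is an admissible kernel. -/
theorem exists_regular_cutoff {R : ℝ} (hR : 0 < R) {T : ℝ} (hT : T ≤ 2) :
    ∃ c₀ : ℝ → ℝ → ℝ, IsCutoffOfOne T R c₀ ∧ Regular T c₀ force := by
  let φ : ContDiffBump (0 : ℝ) := ⟨R, R + 1, hR, by linarith⟩
  have hc : ContDiff ℝ ∞ φ := φ.contDiff
  have hs : HasCompactSupport φ := φ.hasCompactSupport
  have hi : Integrable φ := hc.continuous.integrable_of_hasCompactSupport hs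
  have hd : Continuous (deriv φ) := hc.continuous_deriv (by simp)
  have hdi : Integrable (deriv φ) := hd.integrable_of_hasCompactSupport hs.deriv
  have hforce : ∀ x, ∀ t ∈ Icc 0 T, |force x t| ≤ 4 := fun x t ht =>
    abs_force_le ⟨ht.1, ht.2.trans hT⟩
  refine ⟨fun x _ => φ x, ⟨⟨R + 1, fun x t _ hx => ?_⟩, fun x t _ hx => ?_⟩, fun t _ => hi,
    fun t _ => by simp [tendsto_const_nhds], ⟨_, fun t _ => le_rfl⟩,
    ⟨∫ x, |deriv φ x|, ae_of_all _ fun t _ => ⟨deriv φ, hdi, ?_, le_rfl⟩⟩, ?_, ⟨4, hforce⟩,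
    ⟨0, fun x y t _ => by simp [force]⟩⟩
  · refine φ.zero_of_le_dist ?_
    rwa [dist_zero_right]
  · refine φ.one_of_mem_closedBall ?_
    rwa [mem_closedBall_zero_iff]
  · intro ψ hψ hψs
    have hψd : Continuous (deriv ψ) := hψ.continuous_deriv (by simp)
    refine integral_mul_deriv_eq_deriv_mul_of_integrable
      (fun x _ => ((hc.differentiable (by simp)) x).hasDerivAt)
      (fun x _ => ((hψ.differentiable (by simp)) x).hasDerivAt) ?_ ?_ ?_
    · exact (hc.continuous.mul hψd).integrable_of_hasCompactSupport hs.mul_right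
    · exact (hd.mul hψ.continuous).integrable_of_hasCompactSupport hψs.mul_left
    · exact (hc.continuous.mul hψ.continuous).integrable_of_hasCompactSupport hs.mul_right
  · unfold force
    fun_prop

/-! ### The nonlocal velocity of an arbitrary weak solution -/

/-- Kernels equal to `1` near the origin, for which phases carried by `[-2, 2]` generate a bounded
velocity. -/
structure LocalKernel (T : ℝ) (c₀ : ℝ → ℝ → ℝ) (M : ℝ) : Prop where
  near : ∀ t ∈ Ico 0 T, ∀ x, |x| ≤ 8 → c₀ x t = 1
  bound : ∀ t ∈ Ioo 0 T, ∀ g : ℝ → ℝ, Measurable g → (∀ y, g y ∈ Icc (0 : ℝ) 1) →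
    (∀ᵐ y, 2 < |y| → g y = 0) → ∀ x, |∫ y, c₀ (x - y) t * g y| ≤ M

theorem localKernel_one {T : ℝ} : LocalKernel T one 4 := by
  refine ⟨fun _ _ _ _ => rfl, fun t _ g _ hg h0 x => ?_⟩
  have h1 : ∀ᵐ y, ‖one (x - y) t * g y‖ ≤ indicator (Icc (-2) 2) (fun _ => 1) y := by
    filter_upwards [h0] with y hy
    have h2 := hg y
    rw [one, one_mul, Real.norm_eq_abs, abs_of_nonneg h2.1]
    by_cases hy2 : y ∈ Icc (-2 : ℝ) 2
    · rw [indicator_of_mem hy2]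
      exact h2.2
    · rw [indicator_of_notMem hy2, hy (by
        by_contra! h3
        exact hy2 (abs_le.1 h3))]
  have h2 : Integrable (indicator (Icc (-2 : ℝ) 2) fun _ => (1 : ℝ)) :=
    (integrable_indicator_iff measurableSet_Icc).2 (integrableOn_const (by simp))
  refine (norm_integral_le_of_norm_le (f := fun y => one (x - y) t * g y) h2 h1).trans ?_
  rw [integral_indicator measurableSet_Icc]
  simp
  norm_num

theorem localKernel_of_regular {T R : ℝ} {c₀ c₁ : ℝ → ℝ → ℝ} (hR : 8 ≤ R)
    (hc : IsCutoffOfOne T R c₀) (hreg : Regular T c₀ c₁) : ∃ M, LocalKernel T c₀ M := by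
  obtain ⟨M, hM⟩ := hreg.bounded
  refine ⟨M, fun t ht x hx => hc.2 x t ht (hx.trans hR), fun t ht g _ hg _ x => ?_⟩
  have ht' : t ∈ Ico 0 T := ⟨ht.1.le, ht.2⟩
  have h1 : Integrable fun y => |c₀ (x - y) t| := ((hreg.integrable t ht').comp_sub_left x).abs
  refine (norm_integral_le_of_norm_le (f := fun y => c₀ (x - y) t * g y) h1
    (ae_of_all _ fun y => ?_)).trans ?_
  · rw [norm_mul, Real.norm_eq_abs (g y), abs_of_nonneg (hg y).1]
    exact mul_le_of_le_one_right (norm_nonneg _) (hg y).2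
  · rw [integral_sub_left_eq_self (fun y => |c₀ y t|) volume x]
    exact hM t ht'

/-- A weak solution `u` together with its phase `χ` and a Lipschitz constant `K`. -/
structure WeakPair (T : ℝ) (c₀ u χ : ℝ → ℝ → ℝ) (K : NNReal) : Prop where
  lip : LipschitzOnWith K (fun z : ℝ × ℝ => u z.1 z.2) (univ ×ˢ Ico 0 T)
  meas : Measurable fun z : ℝ × ℝ => χ z.1 z.2
  mem : ∀ x, ∀ t ∈ Ioo 0 T, χ x t ∈ Icc (0 : ℝ) 1
  between : ∀ᵐ z : ℝ × ℝ ∂(volume.restrict (univ ×ˢ Ioo 0 T)),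
      indPos u z.1 z.2 ≤ χ z.1 z.2 ∧ χ z.1 z.2 ≤ indNonneg u z.1 z.2
  sol : IsL1Solution T (velocity c₀ force χ) datum u

section

variable {T M : ℝ} {c₀ u χ : ℝ → ℝ → ℝ} {K : NNReal}

theorem WeakPair.le_add (hp : WeakPair T c₀ u χ K) {x x' t t' : ℝ} (ht : t ∈ Ico 0 T)
    (ht' : t' ∈ Ico 0 T) : u x t ≤ u x' t' + K * (|x - x'| + |t - t'|) := by
  have h1 := hp.lip.dist_le_mul (x, t) ⟨mem_univ _, ht⟩ (x', t') ⟨mem_univ _, ht'⟩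
  rw [Real.dist_eq, Prod.dist_eq, Real.dist_eq, Real.dist_eq] at h1
  have h2 : max |x - x'| |t - t'| ≤ |x - x'| + |t - t'| :=
    max_le (by linarith [abs_nonneg (t - t')]) (by linarith [abs_nonneg (x - x')])
  have h3 := mul_le_mul_of_nonneg_left h2 K.coe_nonneg
  have h4 := le_abs_self (u x t - u x' t')
  dsimp only at h1 h3
  linarith

theorem WeakPair.initial (hp : WeakPair T c₀ u χ K) (x : ℝ) : u x 0 = 1 - |x| :=
  le_antisymm (hp.sol.1.2.1 x) (hp.sol.2.2.1 x)

/-- The velocity near the origin is controlled by the size of the superlevel sets of `u`: if they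
lie in `[-ξ, ξ]` it is at most `2ξ + c₁`, and if `u > 0` on `[-η, η]` it is at least `2η + c₁`. -/
theorem WeakPair.velocity_bounds (hp : WeakPair T c₀ u χ K) (hT : T ≤ 2)
    (hk : LocalKernel T c₀ M) :
    ∀ᵐ t : ℝ, t ∈ Ioo 0 T → ∀ ξ ∈ Icc (0 : ℝ) 2, (∀ x, ξ < |x| → u x t < 0) →
      (∀ x, |velocity c₀ force χ x t| ≤ M + 4) ∧
      ∀ x, |x| ≤ 4 → force x t ≤ velocity c₀ force χ x t ∧
        velocity c₀ force χ x t ≤ 2 * ξ + force x t ∧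
        ∀ η, (∀ x, |x| ≤ η → 0 < u x t) → 2 * η + force x t ≤ velocity c₀ force χ x t := by
  have hae : ∀ᵐ t : ℝ, ∀ᵐ x : ℝ, t ∈ Ioo 0 T →
      indPos u x t ≤ χ x t ∧ χ x t ≤ indNonneg u x t := by
    have h1 : ∀ᵐ z : ℝ × ℝ, z ∈ (univ ×ˢ Ioo 0 T : Set (ℝ × ℝ)) →
        indPos u z.1 z.2 ≤ χ z.1 z.2 ∧ χ z.1 z.2 ≤ indNonneg u z.1 z.2 :=
      (ae_restrict_iff' (MeasurableSet.univ.prod measurableSet_Ioo)).1 hp.between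
    have h2 : ∀ᵐ w : ℝ × ℝ, w.1 ∈ Ioo 0 T →
        indPos u w.2 w.1 ≤ χ w.2 w.1 ∧ χ w.2 w.1 ≤ indNonneg u w.2 w.1 := by
      have h3 := (Measure.measurePreserving_swap (μ := (volume : Measure ℝ))
        (ν := (volume : Measure ℝ))).quasiMeasurePreserving.ae h1
      filter_upwards [h3] with w hw hw1
      exact hw ⟨mem_univ _, hw1⟩
    exact Measure.ae_ae_of_ae_prod h2
  -- at almost every time the two-sided bound on the phase holds for almost every position
  filter_upwards [hae] with t hslice ht ξ hξ hneg
  have ht2 : t ∈ Icc (0 : ℝ) 2 := ⟨ht.1.le, ht.2.le.trans hT⟩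
  set g : ℝ → ℝ := fun y => χ y t with hg
  have hgm : Measurable g := hp.meas.comp (measurable_id.prodMk measurable_const)
  have hg01 : ∀ y, g y ∈ Icc (0 : ℝ) 1 := fun y => hp.mem y t ht
  have hgle : ∀ᵐ y, g y ≤ indicator (Icc (-ξ) ξ) (fun _ => 1) y := by
    filter_upwards [hslice] with y hy
    by_cases hy2 : y ∈ Icc (-ξ) ξ
    · rw [indicator_of_mem hy2]
      exact (hg01 y).2
    · rw [indicator_of_notMem hy2]
      have h1 : ξ < |y| := by
        by_contra! h1
        exact hy2 (abs_le.1 h1)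
      refine (hy ht).2.trans (le_of_eq ?_)
      have h2 : y ∉ {z | 0 ≤ u z t} := not_le.2 (hneg y h1)
      exact indicator_of_notMem h2 fun _ => (1 : ℝ)
  have hind : ∀ a : ℝ, Integrable (indicator (Icc (-a) a) fun _ => (1 : ℝ)) := fun a =>
    (integrable_indicator_iff measurableSet_Icc).2 (integrableOn_const (by simp))
  have hindval : ∀ a : ℝ, 0 ≤ a → ∫ y, indicator (Icc (-a) a) (fun _ => (1 : ℝ)) y = 2 * a := by
    intro a ha
    rw [integral_indicator measurableSet_Icc]
    simp only [integral_const, MeasurableSet.univ, measureReal_restrict_apply, univ_inter,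
      Real.volume_real_Icc, smul_eq_mul, mul_one]
    rw [max_eq_left (by linarith)]
    ring
  have hgi : Integrable g := by
    refine (hind ξ).mono' hgm.aestronglyMeasurable ?_
    filter_upwards [hgle] with y hy
    rwa [Real.norm_eq_abs, abs_of_nonneg (hg01 y).1]
  have hg2 : ∀ᵐ y, 2 < |y| → g y = 0 := by
    filter_upwards [hgle] with y hy hy2
    have h1 : y ∉ Icc (-ξ) ξ := fun h => by linarith [abs_le.2 h, hξ.2]
    rw [indicator_of_notMem h1] at hy
    exact le_antisymm hy (hg01 y).1
  refine ⟨fun x => ?_, fun x hx => ?_⟩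
  · refine (abs_add_le _ _).trans (add_le_add ?_ (abs_force_le ht2))
    exact hk.bound t ht g hgm hg01 hg2 x
  · have hvel : velocity c₀ force χ x t = (∫ y, g y) + force x t := by
      unfold velocity
      congr 1
      refine integral_congr_ae ?_
      filter_upwards [hg2] with y hy
      by_cases hy2 : 2 < |y|
      · have h1 : χ y t = 0 := hy hy2
        rw [h1, mul_zero, hg]
        exact h1.symm
      · rw [hk.near t ⟨ht.1.le, ht.2⟩ _ ((abs_sub _ _).trans (by linarith)), one_mul]
    rw [hvel]
    have hI0 : 0 ≤ ∫ y, g y := integral_nonneg fun y => (hg01 y).1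
    refine ⟨by linarith, ?_, fun η hη => ?_⟩
    · have := integral_mono_ae hgi (hind ξ) hgle
      rw [hindval ξ hξ.1] at this
      linarith
    · rcases le_total 0 η with h0 | h0
      · have h1 : ∀ᵐ y, indicator (Icc (-η) η) (fun _ => 1) y ≤ g y := by
          filter_upwards [hslice] with y hy
          by_cases hy2 : y ∈ Icc (-η) η
          · rw [indicator_of_mem hy2]
            refine le_trans (le_of_eq ?_) (hy ht).1
            have h2 : y ∈ {z | 0 < u z t} := hη y (abs_le.2 hy2)
            exact (indicator_of_mem h2 fun _ => (1 : ℝ)).symm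
          · rw [indicator_of_notMem hy2]
            exact (hg01 y).1
        have := integral_mono_ae (hind η) hgi h1
        rw [hindval η h0] at this
        linarith
      · linarith

end

/-- Continuation in time: a property known strictly up to time `τ` improves itself, and in the
improved form persists for a time `δ` independent of `τ`. -/
theorem bootstrap {T δ : ℝ} (hδ : 0 < δ) {good strong : ℝ → Prop} (h0 : strong 0)
    (h1 : ∀ τ ∈ Ioc 0 T, (∀ t ∈ Ico 0 τ, good t) → ∀ t ∈ Ico 0 τ, strong t)
    (h2 : ∀ t ∈ Ico 0 T, ∀ t' ∈ Ico 0 T, t ≤ t' → t' ≤ t + δ → strong t → good t') :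
    ∀ t ∈ Ico 0 T, strong t := by
  have key : ∀ n : ℕ, ∀ t ∈ Ico 0 T, t < n * δ → good t := by
    intro n
    induction n with
    | zero =>
      intro t ht hlt
      simp only [Nat.cast_zero, zero_mul] at hlt
      exact absurd ht.1 (not_le.2 hlt)
    | succ n ih =>
      intro t' ht' hlt
      push_cast at hlt
      have h0T : (0 : ℝ) ∈ Ico 0 T := ⟨le_rfl, ht'.1.trans_lt ht'.2⟩
      rcases le_or_gt t' δ with h | h
      · exact h2 0 h0T t' ht' ht'.1 (by linarith) h0
      · have htI : t' - δ ∈ Ico 0 T := ⟨by linarith, by linarith [ht'.2]⟩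
        refine h2 (t' - δ) htI t' ht' (by linarith) (by linarith) ?_
        have hτ : 0 < min (n * δ) T := lt_min (by linarith [htI.1]) (htI.1.trans_lt htI.2)
        exact h1 (min (n * δ) T) ⟨hτ, min_le_right _ _⟩
          (fun t ht => ih t ⟨ht.1, ht.2.trans_le (min_le_right _ _)⟩
            (ht.2.trans_le (min_le_left _ _)))
          (t' - δ) ⟨htI.1, lt_min (by linarith) htI.2⟩
  intro t ht
  obtain ⟨n, hn⟩ := exists_nat_gt (T / δ)
  rw [div_lt_iff₀ hδ] at hn
  exact h1 T ⟨ht.1.trans_lt ht.2, le_rfl⟩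
    (fun s hs => key n s hs (hs.2.trans hn)) t ht

open Real (smoothTransition)

/-! ### Upper bounds for the superlevel set -/

theorem hasDerivAt_smoothTransition (z : ℝ) :
    HasDerivAt smoothTransition (deriv smoothTransition z) z :=
  ((Real.smoothTransition.contDiff (n := 1)).differentiable (by simp) z).hasDerivAt

theorem deriv_smoothTransition_nonneg (z : ℝ) : 0 ≤ deriv smoothTransition z :=
  Real.smoothTransition.monotone.deriv_nonneg

theorem deriv_smoothTransition_of_neg {z : ℝ} (hz : z < 0) : deriv smoothTransition z = 0 := by
  have h : smoothTransition =ᶠ[𝓝 z] fun _ => 0 := by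
    filter_upwards [gt_mem_nhds hz] with w hw
    exact Real.smoothTransition.zero_of_nonpos hw.le
  rw [h.deriv_eq, deriv_const]

theorem deriv_smoothTransition_of_one_lt {z : ℝ} (hz : 1 < z) : deriv smoothTransition z = 0 := by
  have h : smoothTransition =ᶠ[𝓝 z] fun _ => 1 := by
    filter_upwards [lt_mem_nhds hz] with w hw
    exact Real.smoothTransition.one_of_one_le hw.le
  rw [h.deriv_eq, deriv_const]

theorem x₁_le_one {t : ℝ} (ht : t ∈ Icc (0 : ℝ) 2) : x₁ t ≤ 1 := by
  unfold x₁
  nlinarith [ht.1, ht.2]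

theorem hasDerivAt_x₁ (t : ℝ) : HasDerivAt x₁ (2 * (t - 1)) t := by
  have h : HasDerivAt x₁ _ t := ((hasDerivAt_id t).sub_const 1).pow 2
  simpa using h

section

variable {T M : ℝ} {c₀ u χ : ℝ → ℝ → ℝ} {K : NNReal}

theorem WeakPair.le_outer (hp : WeakPair T c₀ u χ K) {x t : ℝ} (ht : t ∈ Ico 0 T) :
    u x t ≤ 1 - |x| + K * t := by
  have h := hp.le_add (x := x) (x' := x) ht ⟨le_rfl, ht.1.trans_lt ht.2⟩
  rw [hp.initial, sub_self, abs_zero, zero_add, sub_zero, abs_of_nonneg ht.1] at h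
  exact h

theorem WeakPair.outer_le (hp : WeakPair T c₀ u χ K) {x t : ℝ} (ht : t ∈ Ico 0 T) :
    1 - |x| - K * t ≤ u x t := by
  have h := hp.le_add (x := x) (x' := x) ⟨le_rfl, ht.1.trans_lt ht.2⟩ ht
  rw [hp.initial, sub_self, abs_zero, zero_add, zero_sub, abs_neg, abs_of_nonneg ht.1] at h
  linarith

/-- One step of the bootstrap: `ξ` is a strict supersolution of the law `ξ' = 2ξ + c₁` of the
largest possible front. -/
theorem WeakPair.outer_step (hp : WeakPair T c₀ u χ K) (hT : T ≤ 2) (hk : LocalKernel T c₀ M)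
    {ε τ : ℝ} (hε : 0 < ε) (hε1 : ε * Real.exp 10 ≤ 1) (hτ : τ ∈ Ioc 0 T)
    (hgood : ∀ t ∈ Ico 0 τ, ∀ x, x₁ t + ε * Real.exp (5 * t) < |x| → u x t < 0) :
    ∀ t ∈ Ico 0 τ, ∀ x, x₁ t + ε * Real.exp (5 * t) ≤ |x| → u x t ≤ -(ε / 4) := by
  set ξ : ℝ → ℝ := fun t => x₁ t + ε * Real.exp (5 * t) with hξ
  have hε2 : ε ≤ 1 := (le_mul_of_one_le_right hε.le (Real.one_le_exp (by norm_num))).trans hε1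
  have hξ2 : ∀ t ∈ Icc (0 : ℝ) 2, ξ t ∈ Icc (0 : ℝ) 2 := by
    intro t ht
    have h1 : Real.exp (5 * t) ≤ Real.exp 10 := Real.exp_le_exp.2 (by linarith [ht.2])
    have h2 := mul_le_mul_of_nonneg_left h1 hε.le
    have h3 : 0 ≤ x₁ t := sq_nonneg _
    have h4 := x₁_le_one ht
    simp only [hξ]
    exact ⟨by positivity, by linarith⟩
  have hξd : ∀ t, HasDerivAt ξ (2 * (t - 1) + ε * (5 * Real.exp (5 * t))) t := by
    intro t
    have h1 : HasDerivAt (fun s : ℝ => Real.exp (5 * s)) (5 * Real.exp (5 * t)) t := by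
      have := ((hasDerivAt_id t).const_mul 5).exp
      simpa [mul_comm] using this
    exact (hasDerivAt_x₁ t).add (h1.const_mul ε)
  have hξs : ContDiff ℝ ∞ ξ := by
    simp only [hξ, x₁]
    fun_prop
  have hvel := hp.velocity_bounds hT hk
  -- for `|x| ≥ B` the Lipschitz bound already gives `u ≤ -2`
  set B : ℝ := 2 * K + 3 with hB
  have hK : (0 : ℝ) ≤ K := K.coe_nonneg
  -- on either side, a smooth step of width `ε / 2` travelling with the front `ξ` is a barrier
  have key : ∀ σ : ℝ, |σ| = 1 → ∀ t ∈ Ico 0 τ, ∀ x ∈ Icc (-B) B, u x t ≤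
      -(ε / 2) + (1 + ε / 2) * smoothTransition ((ξ t - σ * x) / (ε / 2)) + ε / 8 * t := by
    intro σ hσ
    have hσ2 : σ * σ = 1 := by rw [← abs_mul_abs_self, hσ, one_mul]
    have hσx : ∀ x, σ * x ≤ |x| := fun x =>
      (le_abs_self _).trans (by rw [abs_mul, hσ, one_mul])
    have hS0 : ∀ z, 0 ≤ (1 + ε / 2) * smoothTransition z := fun z =>
      mul_nonneg (by linarith) (Real.smoothTransition.nonneg _)
    refine hp.sol.1.le_barrier hp.lip.continuousOn le_rfl hτ.2
      (Φ := fun x t => -(ε / 2) + (1 + ε / 2) * smoothTransition ((ξ t - σ * x) / (ε / 2))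
        + ε / 8 * t) ?_ ?_ ?_ ?_
    · have hS : ContDiff ℝ ∞ smoothTransition := Real.smoothTransition.contDiff
      have h1 : ContDiff ℝ ∞ fun z : ℝ × ℝ => ξ z.2 := hξs.comp contDiff_snd
      have h2 : ContDiff ℝ ∞ fun z : ℝ × ℝ => (ξ z.2 - σ * z.1) / (ε / 2) := by fun_prop
      have h3 := hS.comp h2
      exact (contDiff_const.add (contDiff_const.mul h3)).add (by fun_prop)
    · intro x _
      have h0 : ξ 0 = 1 + ε := by simp [hξ, x₁]
      rw [hp.initial, mul_zero, add_zero, h0]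
      rcases le_total (1 + ε / 2) (σ * x) with h | h
      · linarith [hσx x, hS0 ((1 + ε - σ * x) / (ε / 2))]
      · rw [Real.smoothTransition.one_of_one_le ((one_le_div (by linarith)).2 (by linarith))]
        linarith [abs_nonneg x]
    · intro t ht
      have htT : t ∈ Ico 0 T := ⟨ht.1, ht.2.trans_le hτ.2⟩
      have hlow : ∀ z, -1 ≤ -(ε / 2) + (1 + ε / 2) * smoothTransition z + ε / 8 * t := fun z => by
        have := mul_nonneg (by linarith : 0 ≤ ε / 8) ht.1
        linarith [hS0 z]
      have hKt : K * t ≤ K * 2 := mul_le_mul_of_nonneg_left (by linarith [htT.2]) hK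
      have h1 := hp.le_outer (x := -B) htT
      have h2 := hp.le_outer (x := B) htT
      rw [abs_neg, abs_of_nonneg (by positivity)] at h1
      rw [abs_of_nonneg (by positivity)] at h2
      exact ⟨by linarith [hlow ((ξ t - σ * -B) / (ε / 2))],
        by linarith [hlow ((ξ t - σ * B) / (ε / 2))]⟩
    · intro x₀ _ t₀ ht₀
      set z₀ : ℝ := (ξ t₀ - σ * x₀) / (ε / 2) with hz₀
      set D : ℝ := (1 + ε / 2) * (deriv smoothTransition z₀ / (ε / 2)) with hD
      have hD0 : 0 ≤ D := mul_nonneg (by linarith)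
        (div_nonneg (deriv_smoothTransition_nonneg _) (by linarith))
      have hdx : deriv (fun x => -(ε / 2) + (1 + ε / 2) *
          smoothTransition ((ξ t₀ - σ * x) / (ε / 2)) + ε / 8 * t₀) x₀ = -σ * D := by
        have h1 : HasDerivAt (fun x => (ξ t₀ - σ * x) / (ε / 2)) (-(σ * 1) / (ε / 2)) x₀ :=
          (((hasDerivAt_id x₀).const_mul σ).const_sub (ξ t₀)).div_const _
        have h2 := (hasDerivAt_smoothTransition z₀).comp x₀ h1
        have h3 := ((h2.const_mul (1 + ε / 2)).const_add (-(ε / 2))).add_const (ε / 8 * t₀)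
        refine h3.deriv.trans ?_
        rw [hD]
        ring
      have hdt : deriv (fun t => -(ε / 2) + (1 + ε / 2) *
          smoothTransition ((ξ t - σ * x₀) / (ε / 2)) + ε / 8 * t) t₀ =
          (2 * (t₀ - 1) + ε * (5 * Real.exp (5 * t₀))) * D + ε / 8 := by
        have h1 : HasDerivAt (fun t => (ξ t - σ * x₀) / (ε / 2))
            ((2 * (t₀ - 1) + ε * (5 * Real.exp (5 * t₀))) / (ε / 2)) t₀ :=
          ((hξd t₀).sub_const _).div_const _
        have h2 := (hasDerivAt_smoothTransition z₀).comp t₀ h1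
        have h3 := ((h2.const_mul (1 + ε / 2)).const_add (-(ε / 2))).add
          ((hasDerivAt_id t₀).const_mul (ε / 8))
        refine h3.deriv.trans ?_
        rw [hD]
        ring
      have habs : |-σ * D| = D := by
        rw [abs_mul, abs_neg, hσ, one_mul, abs_of_nonneg hD0]
      rw [hdx, hdt, habs]
      have ht₀2 : t₀ ∈ Icc (0 : ℝ) 2 := ⟨ht₀.1.le, by linarith [ht₀.2, hτ.2]⟩
      rcases lt_or_ge |x₀| 4 with hx | hx
      · refine ⟨2 * (t₀ - 1) + ε * (5 * Real.exp (5 * t₀)), ?_⟩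
        have hcont : ∀ᶠ t in 𝓝 t₀, 2 * (t - 1) + 2 * (ε * Real.exp (5 * t)) <
            2 * (t₀ - 1) + ε * (5 * Real.exp (5 * t₀)) := by
          have h1 : Continuous fun t => 2 * (t - 1) + 2 * (ε * Real.exp (5 * t)) := by fun_prop
          refine h1.continuousAt.eventually_lt continuousAt_const ?_
          have := mul_pos hε (Real.exp_pos (5 * t₀))
          linarith
        obtain ⟨δ, hδ, hδt⟩ := Metric.eventually_nhds_iff.1 hcont
        refine ⟨min δ (4 - |x₀|), lt_min hδ (by linarith), ?_, by linarith⟩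
        filter_upwards [hvel] with t hv ht hlt x hxlt
        have hv' := (hv ⟨ht.1, ht.2.trans_le hτ.2⟩ (ξ t)
          (hξ2 t ⟨ht.1.le, by linarith [ht.2, hτ.2]⟩) (hgood t ⟨ht.1.le, ht.2⟩)).2 x ?_
        · refine hv'.2.1.trans (le_trans (le_of_eq ?_)
            (hδt ((Real.dist_eq _ _).trans_lt (hlt.trans_le (min_le_left _ _)))).le)
          simp only [hξ, x₁, force]
          ring
        · have h1 := abs_sub_abs_le_abs_sub x x₀
          linarith [hxlt.trans_le (min_le_right δ (4 - |x₀|))]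
      · -- far from the front the barrier is flat, and any bound on the velocity will do
        have hDz : D = 0 := by
          have h2 : deriv smoothTransition z₀ = 0 := by
            have hξm := hξ2 t₀ ht₀2
            rcases le_total 0 (σ * x₀) with h | h
            · have h3 : |x₀| = σ * x₀ := by
                rw [← abs_of_nonneg h, abs_mul, hσ, one_mul]
              refine deriv_smoothTransition_of_neg (div_neg_of_neg_of_pos ?_ (by linarith))
              linarith [hξm.2]
            · have h3 : |x₀| = -(σ * x₀) := by
                rw [← abs_of_nonpos h, abs_mul, hσ, one_mul]
              refine deriv_smoothTransition_of_one_lt ((one_lt_div (by linarith)).2 ?_)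
              linarith [hξm.1]
          rw [hD, h2]
          ring
        refine ⟨M + 4, 1, one_pos, ?_, by rw [hDz]; linarith⟩
        filter_upwards [hvel] with t hv ht _ x _
        exact (le_abs_self _).trans ((hv ⟨ht.1, ht.2.trans_le hτ.2⟩ (ξ t)
          (hξ2 t ⟨ht.1.le, by linarith [ht.2, hτ.2]⟩) (hgood t ⟨ht.1.le, ht.2⟩)).1 x)
  intro t ht x hx
  have htT : t ∈ Ico 0 T := ⟨ht.1, ht.2.trans_le hτ.2⟩
  have ht2 : t < 2 := htT.2.trans_le hT
  rcases le_or_gt |x| B with hxB | hxB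
  · obtain ⟨σ, hσ, hσx⟩ : ∃ σ : ℝ, |σ| = 1 ∧ σ * x = |x| := by
      rcases le_total 0 x with h | h
      · exact ⟨1, abs_one, by rw [one_mul, abs_of_nonneg h]⟩
      · exact ⟨-1, by rw [abs_neg, abs_one], by rw [abs_of_nonpos h]; ring⟩
    have h1 := key σ hσ t ht x (abs_le.1 hxB)
    rw [Real.smoothTransition.zero_of_nonpos
      (div_nonpos_of_nonpos_of_nonneg (by rw [hσx]; linarith) (by linarith))] at h1
    nlinarith
  · have h1 := hp.le_outer (x := x) htT
    have hKt : K * t ≤ K * 2 := mul_le_mul_of_nonneg_left ht2.le hK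
    linarith

/-- The superlevel set of a weak solution stays in the shrinking interval `[-x₁, x₁]` before the
fattening time, and in the growing one after it. -/
theorem WeakPair.neg_of_lt_abs (hp : WeakPair T c₀ u χ K) (hT : T ≤ 2) (hk : LocalKernel T c₀ M)
    {t x : ℝ} (ht : t ∈ Ico 0 T) (hx : x₁ t < |x|) : u x t < 0 := by
  obtain ⟨ε, hε, hε1, hεx⟩ : ∃ ε > 0, ε * Real.exp 10 ≤ 1 ∧
      x₁ t + ε * Real.exp (5 * t) ≤ |x| := by
    have he := Real.exp_pos 10
    refine ⟨min 1 (|x| - x₁ t) / Real.exp 10, div_pos (lt_min one_pos (by linarith)) he, ?_, ?_⟩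
    · rw [div_mul_cancel₀ _ he.ne']
      exact min_le_left _ _
    · have h1 : Real.exp (5 * t) ≤ Real.exp 10 := Real.exp_le_exp.2 (by linarith [ht.2])
      have h2 := mul_le_mul_of_nonneg_left h1 (a := min 1 (|x| - x₁ t) / Real.exp 10)
        (div_nonneg (le_min zero_le_one (by linarith)) he.le)
      rw [div_mul_cancel₀ _ he.ne'] at h2
      linarith [min_le_right 1 (|x| - x₁ t)]
  have hK : (0 : ℝ) ≤ K := K.coe_nonneg
  set ξ : ℝ → ℝ := fun t => x₁ t + ε * Real.exp (5 * t) with hξ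
  have key := bootstrap (T := T) (δ := ε / (16 * (K + 1))) (by positivity)
    (good := fun t => ∀ x, ξ t < |x| → u x t < 0)
    (strong := fun t => ∀ x, ξ t ≤ |x| → u x t ≤ -(ε / 4)) ?_
    (fun τ hτ h => hp.outer_step hT hk hε hε1 hτ h) ?_ t ht x hεx
  · linarith
  · intro x hx
    rw [hp.initial]
    simp only [hξ, x₁, mul_zero, Real.exp_zero] at hx
    linarith
  · intro s hs s' hs' hss hsδ hstrong x hx
    have hδK : 3 * K * (s' - s) < ε / 4 := by
      have h1 : s' - s ≤ ε / (16 * (K + 1)) := by linarith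
      rw [le_div_iff₀ (by positivity)] at h1
      nlinarith
    have hdrop : ξ s - ξ s' ≤ 2 * (s' - s) := by
      have h1 : Real.exp (5 * s) ≤ Real.exp (5 * s') := Real.exp_le_exp.2 (by linarith)
      have h2 := mul_le_mul_of_nonneg_left h1 hε.le
      simp only [hξ, x₁]
      nlinarith [hs.1, hs'.1]
    -- the front `ξ` recedes at most with speed `2`: move `x` back to where `u` is known
    obtain ⟨x', hx', hxx⟩ : ∃ x', ξ s ≤ |x'| ∧ |x - x'| ≤ 2 * (s' - s) := by
      rcases le_or_gt (ξ s) |x| with h | h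
      · exact ⟨x, h, by rw [sub_self, abs_zero]; linarith⟩
      · rcases le_total 0 x with h0 | h0
        · rw [abs_of_nonneg h0] at h hx
          refine ⟨ξ s, le_abs_self _, ?_⟩
          rw [abs_of_nonpos (by linarith)]
          linarith
        · rw [abs_of_nonpos h0] at h hx
          refine ⟨-ξ s, by rw [abs_neg]; exact le_abs_self _, ?_⟩
          rw [abs_of_nonneg (by linarith)]
          linarith
    have h1 := hp.le_add (x := x) (x' := x') hs' hs
    rw [abs_of_nonneg (by linarith : 0 ≤ s' - s)] at h1
    have h2 := hstrong x' hx'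
    have h3 := mul_le_mul_of_nonneg_left hxx hK
    nlinarith

/-- After the fattening time no weak solution is positive anywhere. -/
theorem WeakPair.nonpos (hp : WeakPair T c₀ u χ K) (hT : T ∈ Ioc (1 : ℝ) 2)
    (hk : LocalKernel T c₀ M) {t x : ℝ} (ht : t ∈ Ico 1 T) : u x t ≤ 0 := by
  have hIco : ∀ {s}, s ∈ Ico 1 T → s ∈ Ico 0 T := fun hs => ⟨zero_le_one.trans hs.1, hs.2⟩
  have hne : ∀ x, x ≠ 0 → u x 1 < 0 := fun x hx =>
    hp.neg_of_lt_abs hT.2 hk (hIco ⟨le_rfl, hT.1⟩) (by simpa [x₁] using hx)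
  have h1 : ∀ x, u x 1 ≤ 0 := by
    have hclosed : Dense {x : ℝ | x ≠ 0} := dense_compl_singleton 0
    have hcont : Continuous fun x => u x 1 := by
      refine hp.lip.continuousOn.comp_continuous (f := fun x : ℝ => (x, (1 : ℝ))) (by fun_prop)
        fun x => ⟨mem_univ _, hIco ⟨le_rfl, hT.1⟩⟩
    have := hclosed.induction (P := fun x => u x 1 ≤ 0) (fun x hx => (hne x hx).le)
      (isClosed_le hcont continuous_const)
    exact this
  rcases lt_or_ge 2 |x| with hx | hx
  · refine (hp.neg_of_lt_abs hT.2 hk (hIco ht) (hx.trans' ?_)).le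
    linarith [x₁_le_one ⟨(hIco ht).1, ht.2.le.trans hT.2⟩]
  refine le_of_forall_pos_le_add fun η hη => ?_
  have hbar := hp.sol.1.le_barrier hp.lip.continuousOn zero_le_one le_rfl (B := 2)
    (Φ := fun _ t => η / 2 * t) (by fun_prop) ?_ ?_ ?_ t ht x (abs_le.1 hx)
  · have h2 := ht.2.trans_le hT.2
    nlinarith
  · intro x _
    linarith [h1 x]
  · intro s hs
    have h2 : x₁ s < 2 := by linarith [x₁_le_one ⟨(hIco hs).1, hs.2.le.trans hT.2⟩]
    have h3 : 0 ≤ η / 2 * s := mul_nonneg (by linarith) (hIco hs).1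
    exact ⟨(hp.neg_of_lt_abs hT.2 hk (hIco hs) (by norm_num; exact h2)).le.trans h3,
      (hp.neg_of_lt_abs hT.2 hk (hIco hs) (by norm_num; exact h2)).le.trans h3⟩
  · intro x₀ _ t₀ ht₀
    refine ⟨M + 4, 1, one_pos, ?_, ?_⟩
    · filter_upwards [hp.velocity_bounds hT.2 hk] with s hv hs _ x _
      have hs' := hIco ⟨hs.1.le, hs.2⟩
      exact (le_abs_self _).trans ((hv ⟨by linarith [hs.1], hs.2⟩ (x₁ s)
        ⟨sq_nonneg _, by linarith [x₁_le_one ⟨hs'.1, hs.2.le.trans hT.2⟩]⟩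
        fun x hx => hp.neg_of_lt_abs hT.2 hk hs' hx).1 x)
    · have : deriv (fun t : ℝ => η / 2 * t) t₀ = η / 2 := by
        simp
      rw [this, deriv_const, abs_zero, mul_zero]
      linarith

end

open Real (smoothTransition)

/-! ### Lower bounds, and fattening of the zero set -/

/-- The inner barrier uses `√(x² + d²)` as a smooth substitute for `|x|`. -/
theorem hasDerivAt_sqrt_sq_add {d : ℝ} (hd : 0 < d) (x : ℝ) :
    ∃ m, |m| ≤ 1 ∧ HasDerivAt (fun x => √(x ^ 2 + d ^ 2)) m x := by
  have h0 : 0 < x ^ 2 + d ^ 2 := by positivity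
  have h1 : HasDerivAt (fun x : ℝ => x ^ 2 + d ^ 2) (2 * x) x := by
    simpa using ((hasDerivAt_id x).pow 2).add_const (d ^ 2)
  have h2 := Real.sqrt_pos.2 h0
  refine ⟨_, ?_, h1.sqrt h0.ne'⟩
  rw [mul_div_mul_left _ _ two_ne_zero, abs_div, abs_of_pos h2, div_le_one h2]
  exact Real.abs_le_sqrt (by nlinarith [sq_nonneg d])

theorem abs_le_sqrt_sq_add (x d : ℝ) : |x| ≤ √(x ^ 2 + d ^ 2) :=
  Real.abs_le_sqrt (by nlinarith [sq_nonneg d])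

theorem sqrt_sq_add_le {d : ℝ} (hd : 0 ≤ d) (x : ℝ) : √(x ^ 2 + d ^ 2) ≤ |x| + d := by
  refine Real.sqrt_le_iff.2 ⟨by positivity, ?_⟩
  nlinarith [sq_abs x, mul_nonneg (abs_nonneg x) hd]

section

variable {T M : ℝ} {c₀ u χ : ℝ → ℝ → ℝ} {K : NNReal}

theorem WeakPair.velocity_inner (hp : WeakPair T c₀ u χ K) (hT : T ≤ 2)
    (hk : LocalKernel T c₀ M) :
    ∀ᵐ t : ℝ, t ∈ Ioo 0 T → ∀ x, |x| ≤ 4 → force x t ≤ velocity c₀ force χ x t ∧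
      ∀ η, (∀ x, |x| ≤ η → 0 < u x t) → 2 * η + force x t ≤ velocity c₀ force χ x t := by
  filter_upwards [hp.velocity_bounds hT hk] with t hv ht x hx
  have h := (hv ht (x₁ t) ⟨sq_nonneg _, by
    linarith [x₁_le_one ⟨ht.1.le, ht.2.le.trans hT⟩]⟩ fun x hx =>
    hp.neg_of_lt_abs hT hk ⟨ht.1.le, ht.2⟩ hx).2 x hx
  exact ⟨h.1, h.2.2⟩

/-- One step of the bootstrap: `ξ` is a strict subsolution of the law `ξ' = 2ξ + c₁` of the
front before the fattening time. The smoothing of `|x|` costs `ε / 2` of the length of the front. -/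
theorem WeakPair.inner_step (hp : WeakPair T c₀ u χ K) (hT : T ∈ Ioc (1 : ℝ) 2)
    (hk : LocalKernel T c₀ M) {ε τ : ℝ} (hε : 0 < ε) (hε1 : ε ≤ 1) (hτ : τ ∈ Ioc (0 : ℝ) 1)
    (hgood : ∀ t ∈ Ico 0 τ, ∀ x, |x| ≤ x₁ t - ε * Real.exp (4 * t) - ε / 2 → 0 < u x t) :
    ∀ t ∈ Ico 0 τ, ∀ x, |x| ≤ x₁ t - ε * Real.exp (4 * t) - ε / 2 → ε / 4 ≤ u x t := by
  set ξ : ℝ → ℝ := fun t => x₁ t - ε * Real.exp (4 * t) with hξ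
  have hτT : τ ≤ T := hτ.2.trans hT.1.le
  have hξ1 : ∀ t ∈ Icc (0 : ℝ) 2, ξ t ≤ 1 := by
    intro t ht
    have := mul_pos hε (Real.exp_pos (4 * t))
    linarith [x₁_le_one ht]
  have hξd : ∀ t, HasDerivAt ξ (2 * (t - 1) - ε * (4 * Real.exp (4 * t))) t := by
    intro t
    have h1 : HasDerivAt (fun s : ℝ => Real.exp (4 * s)) (4 * Real.exp (4 * t)) t := by
      have := ((hasDerivAt_id t).const_mul 4).exp
      simpa [mul_comm] using this
    exact (hasDerivAt_x₁ t).sub (h1.const_mul ε)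
  have hξs : ContDiff ℝ ∞ ξ := by
    simp only [hξ, x₁]
    fun_prop
  have hvel := hp.velocity_inner hT.2 hk
  have hK : (0 : ℝ) ≤ K := K.coe_nonneg
  have hS0 : ∀ z, 0 ≤ (ε / 2 + 2 + 2 * K) * smoothTransition z := fun z =>
    mul_nonneg (by positivity) (Real.smoothTransition.nonneg _)
  have key : ∀ t ∈ Ico 0 τ, ∀ x ∈ Icc (-3) 3, ε / 2 - (ε / 2 + 2 + 2 * K) *
      smoothTransition ((√(x ^ 2 + (ε / 2) ^ 2) - ξ t) / (ε / 2)) - ε / 8 * t ≤ u x t := by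
    refine hp.sol.2.barrier_le hp.lip.continuousOn le_rfl hτT
      (Φ := fun x t => ε / 2 - (ε / 2 + 2 + 2 * K) *
        smoothTransition ((√(x ^ 2 + (ε / 2) ^ 2) - ξ t) / (ε / 2)) - ε / 8 * t) ?_ ?_ ?_ ?_
    · have hS : ContDiff ℝ ∞ smoothTransition := Real.smoothTransition.contDiff
      have h1 : ContDiff ℝ ∞ fun z : ℝ × ℝ => ξ z.2 := hξs.comp contDiff_snd
      have h2 : ContDiff ℝ ∞ fun z : ℝ × ℝ => √(z.1 ^ 2 + (ε / 2) ^ 2) :=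
        ContDiff.sqrt (by fun_prop) fun z => by positivity
      have h3 := hS.comp ((h2.sub h1).div_const (ε / 2))
      exact (contDiff_const.sub (contDiff_const.mul h3)).sub (by fun_prop)
    · intro x hx
      have h0 : ξ 0 = 1 - ε := by simp [hξ, x₁]
      have h1 : |x| ≤ 3 := abs_le.2 hx
      rw [hp.initial, mul_zero, sub_zero, h0]
      rcases le_total (1 - ε / 2) √(x ^ 2 + (ε / 2) ^ 2) with h | h
      · rw [Real.smoothTransition.one_of_one_le ((one_le_div (by linarith)).2 (by linarith))]
        linarith
      · linarith [abs_le_sqrt_sq_add x (ε / 2), hS0 ((√(x ^ 2 + (ε / 2) ^ 2) - (1 - ε)) / (ε / 2))]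
    · intro t ht
      have htT : t ∈ Ico 0 T := ⟨ht.1, ht.2.trans_le hτT⟩
      have hKt : K * t ≤ K * 2 := mul_le_mul_of_nonneg_left (by linarith [htT.2, hT.2]) hK
      have hεt : 0 ≤ ε / 8 * t := mul_nonneg (by linarith) ht.1
      have h3 : ∀ x : ℝ, |x| = 3 → ε / 2 - (ε / 2 + 2 + 2 * K) *
          smoothTransition ((√(x ^ 2 + (ε / 2) ^ 2) - ξ t) / (ε / 2)) - ε / 8 * t ≤ u x t := by
        intro x hx
        have h4 := abs_le_sqrt_sq_add x (ε / 2)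
        have h5 := hξ1 t ⟨ht.1, htT.2.le.trans hT.2⟩
        have h6 := hp.outer_le (x := x) htT
        rw [Real.smoothTransition.one_of_one_le ((one_le_div (by linarith)).2 (by linarith))]
        linarith
      exact ⟨h3 _ (by norm_num), h3 _ (by norm_num)⟩
    · intro x₀ hx₀ t₀ ht₀
      have hx₀' : |x₀| < 3 := abs_lt.2 hx₀
      obtain ⟨m, hm, hmd⟩ := hasDerivAt_sqrt_sq_add (half_pos hε) x₀
      set z₀ : ℝ := (√(x₀ ^ 2 + (ε / 2) ^ 2) - ξ t₀) / (ε / 2) with hz₀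
      set D : ℝ := (ε / 2 + 2 + 2 * K) * (deriv smoothTransition z₀ / (ε / 2)) with hD
      have hD0 : 0 ≤ D := mul_nonneg (by positivity)
        (div_nonneg (deriv_smoothTransition_nonneg _) (by linarith))
      have hdx : deriv (fun x => ε / 2 - (ε / 2 + 2 + 2 * K) *
          smoothTransition ((√(x ^ 2 + (ε / 2) ^ 2) - ξ t₀) / (ε / 2)) - ε / 8 * t₀) x₀ =
          -(m * D) := by
        have h1 : HasDerivAt (fun x => (√(x ^ 2 + (ε / 2) ^ 2) - ξ t₀) / (ε / 2)) (m / (ε / 2))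
            x₀ := (hmd.sub_const (ξ t₀)).div_const _
        have h2 := (hasDerivAt_smoothTransition z₀).comp x₀ h1
        have h3 := ((h2.const_mul (ε / 2 + 2 + 2 * K)).const_sub (ε / 2)).sub_const (ε / 8 * t₀)
        refine h3.deriv.trans ?_
        rw [hD]
        ring
      have hdt : deriv (fun t => ε / 2 - (ε / 2 + 2 + 2 * K) *
          smoothTransition ((√(x₀ ^ 2 + (ε / 2) ^ 2) - ξ t) / (ε / 2)) - ε / 8 * t) t₀ =
          (2 * (t₀ - 1) - ε * (4 * Real.exp (4 * t₀))) * D - ε / 8 := by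
        have h1 : HasDerivAt (fun t => (√(x₀ ^ 2 + (ε / 2) ^ 2) - ξ t) / (ε / 2))
            (-(2 * (t₀ - 1) - ε * (4 * Real.exp (4 * t₀))) / (ε / 2)) t₀ :=
          ((hξd t₀).const_sub _).div_const _
        have h2 := (hasDerivAt_smoothTransition z₀).comp t₀ h1
        have h3 := ((h2.const_mul (ε / 2 + 2 + 2 * K)).const_sub (ε / 2)).sub
          ((hasDerivAt_id t₀).const_mul (ε / 8))
        refine h3.deriv.trans ?_
        rw [hD]
        ring
      have habs : |-(m * D)| ≤ D := by
        rw [abs_neg, abs_mul, abs_of_nonneg hD0]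
        exact mul_le_of_le_one_left hD0 hm
      rw [hdx, hdt]
      have hexp := mul_pos hε (Real.exp_pos (4 * t₀))
      refine ⟨2 * (t₀ - 1) - ε * (4 * Real.exp (4 * t₀)), ?_⟩
      -- `2 (ξ(t) - ε / 2) + c₁(t) > ξ'(t₀)` for `t` near `t₀`
      have hcont : ∀ᶠ t in 𝓝 t₀, 2 * (t₀ - 1) - ε * (4 * Real.exp (4 * t₀)) <
          2 * (t - 1) - 2 * (ε * Real.exp (4 * t)) - ε := by
        have h1 : Continuous fun t => 2 * (t - 1) - 2 * (ε * Real.exp (4 * t)) - ε := by fun_prop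
        refine continuousAt_const.eventually_lt h1.continuousAt ?_
        have h2 := mul_le_mul_of_nonneg_left
          (Real.one_le_exp (by linarith [ht₀.1] : (0 : ℝ) ≤ 4 * t₀)) hε.le
        linarith
      obtain ⟨δ, hδ, hδt⟩ := Metric.eventually_nhds_iff.1 hcont
      refine ⟨min δ 1, lt_min hδ one_pos, ?_, ?_⟩
      · filter_upwards [hvel] with t hv ht hlt x hxlt
        have hx : |x| ≤ 4 := by
          have h1 := abs_sub_abs_le_abs_sub x x₀
          linarith [hxlt.trans_le (min_le_right δ 1)]
        refine ((hδt ((Real.dist_eq _ _).trans_lt (hlt.trans_le (min_le_left _ _)))).le.trans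
          (le_of_eq ?_)).trans ((hv ⟨ht.1, ht.2.trans_le hτT⟩ x hx).2 _
            (hgood t ⟨ht.1.le, ht.2⟩))
        simp only [x₁, force]
        ring
      · have hneg : 2 * (t₀ - 1) - ε * (4 * Real.exp (4 * t₀)) ≤ 0 := by
          linarith [ht₀.2, hτ.2]
        have := mul_le_mul_of_nonpos_left habs hneg
        linarith
  intro t ht x hx
  have hexp := mul_pos hε (Real.exp_pos (4 * t))
  have h2 : t ∈ Icc (0 : ℝ) 2 := ⟨ht.1, by linarith [ht.2, hτ.2]⟩
  have h1 := key t ht x (abs_le.1 (by linarith [x₁_le_one h2]))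
  have h3 := sqrt_sq_add_le (half_pos hε).le x
  rw [Real.smoothTransition.zero_of_nonpos
    (div_nonpos_of_nonpos_of_nonneg (by linarith) (by linarith))] at h1
  have h4 : ε / 8 * t ≤ ε / 8 * 2 := mul_le_mul_of_nonneg_left h2.2 (by linarith)
  linarith

/-- Before the fattening time the origin belongs to the positivity set. -/
theorem WeakPair.pos_at_zero (hp : WeakPair T c₀ u χ K) (hT : T ∈ Ioc (1 : ℝ) 2)
    (hk : LocalKernel T c₀ M) {t : ℝ} (ht : t ∈ Ico (0 : ℝ) 1) : 0 < u 0 t := by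
  have hK : (0 : ℝ) ≤ K := K.coe_nonneg
  have ht1 : 0 < (1 - t) ^ 2 := by
    have : 0 < 1 - t := by linarith [ht.2]
    positivity
  have he := Real.exp_pos 4
  obtain ⟨ε, hε, hε1, hεt⟩ : ∃ ε > 0, ε ≤ 1 ∧ |(0 : ℝ)| ≤ x₁ t - ε * Real.exp (4 * t) - ε / 2 := by
    refine ⟨(1 - t) ^ 2 / (Real.exp 4 + 1), by positivity, ?_, ?_⟩
    · rw [div_le_one (by positivity)]
      nlinarith [ht.1, ht.2]
    · have h1 : Real.exp (4 * t) ≤ Real.exp 4 := Real.exp_le_exp.2 (by linarith [ht.2])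
      have h2 := mul_le_mul_of_nonneg_left h1 (a := (1 - t) ^ 2 / (Real.exp 4 + 1))
        (by positivity)
      have h3 : (1 - t) ^ 2 / (Real.exp 4 + 1) * (Real.exp 4 + 1) = (1 - t) ^ 2 :=
        div_mul_cancel₀ _ (by positivity)
      have h4 : 0 ≤ (1 - t) ^ 2 / (Real.exp 4 + 1) := by positivity
      rw [abs_zero, x₁]
      linarith
  have key := bootstrap (T := 1) (δ := ε / (8 * (K + 1))) (by positivity)
    (good := fun t => ∀ x, |x| ≤ x₁ t - ε * Real.exp (4 * t) - ε / 2 → 0 < u x t)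
    (strong := fun t => ∀ x, |x| ≤ x₁ t - ε * Real.exp (4 * t) - ε / 2 → ε / 4 ≤ u x t) ?_
    (fun τ hτ h => hp.inner_step hT hk hε hε1 hτ h) ?_ t ht 0 hεt
  · linarith
  · intro x hx
    rw [hp.initial]
    simp only [x₁, mul_zero, Real.exp_zero] at hx
    linarith
  · intro s hs s' hs' hss hsδ hstrong x hx
    have hIco : ∀ {r}, r ∈ Ico (0 : ℝ) 1 → r ∈ Ico 0 T := fun hr => ⟨hr.1, hr.2.trans hT.1⟩
    have hδK : K * (s' - s) < ε / 4 := by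
      have h1 : s' - s ≤ ε / (8 * (K + 1)) := by linarith
      rw [le_div_iff₀ (by positivity)] at h1
      nlinarith
    have h1 := hstrong x (hx.trans (by
      have h1 : Real.exp (4 * s) ≤ Real.exp (4 * s') := Real.exp_le_exp.2 (by linarith)
      have h2 := mul_le_mul_of_nonneg_left h1 hε.le
      simp only [x₁]
      nlinarith [hs.2, hs'.2]))
    have h2 := hp.le_add (x := x) (x' := x) (hIco hs) (hIco hs')
    rw [sub_self, abs_zero, zero_add, abs_of_nonpos (by linarith : s - s' ≤ 0)] at h2
    linarith

theorem WeakPair.nonneg_at_fattening (hp : WeakPair T c₀ u χ K) (hT : T ∈ Ioc (1 : ℝ) 2)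
    (hk : LocalKernel T c₀ M) : 0 ≤ u 0 1 := by
  have hK : (0 : ℝ) ≤ K := K.coe_nonneg
  refine le_of_forall_pos_le_add fun η hη => ?_
  obtain ⟨d, hd, hd1, hdK⟩ : ∃ d > 0, d ≤ 1 ∧ K * d ≤ η := by
    refine ⟨min 1 (η / (K + 1)), by positivity, min_le_left _ _, ?_⟩
    have h1 : min 1 (η / (K + 1)) * (K + 1) ≤ η :=
      (le_div_iff₀ (by positivity)).1 (min_le_right _ _)
    have h2 : 0 ≤ min 1 (η / (K + 1)) := by positivity
    nlinarith
  have h1 := hp.pos_at_zero hT hk (t := 1 - d) ⟨by linarith, by linarith⟩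
  have h2 := hp.le_add (x := 0) (x' := 0) (t := 1 - d) (t' := 1)
    ⟨by linarith, by linarith [hT.1]⟩ ⟨zero_le_one, hT.1⟩
  rw [sub_self, abs_zero, zero_add, abs_of_nonpos (by linarith : 1 - d - 1 ≤ 0)] at h2
  linarith

theorem force_nonneg (x : ℝ) {t : ℝ} (ht : t ∈ Icc (1 : ℝ) 2) : 0 ≤ force x t :=
  mul_nonneg (by linarith [ht.1]) (by linarith [ht.2])

/-- After the fattening time `u` is nonnegative on the interval swept out from the origin by the
driving force alone: a parabola sliding along a trajectory `a y₀` of speed at most `c₁` stays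
below `u`. -/
theorem WeakPair.nonneg_of_le (hp : WeakPair T c₀ u χ K) (hT : T ∈ Ioc (1 : ℝ) 2)
    (hk : LocalKernel T c₀ M) {t x : ℝ} (ht : t ∈ Ico 1 T)
    (hx : |x| ≤ (t - 1) ^ 2 - 2 / 3 * (t - 1) ^ 3) : 0 ≤ u x t := by
  have hK : (0 : ℝ) ≤ K := K.coe_nonneg
  have hIco : ∀ {s}, s ∈ Ico 1 T → s ∈ Ico 0 T := fun hs => ⟨zero_le_one.trans hs.1, hs.2⟩
  set y₀ : ℝ → ℝ := fun t => (t - 1) ^ 2 - 2 / 3 * (t - 1) ^ 3 with hy₀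
  have hyd : ∀ t, HasDerivAt y₀ (force 0 t) t := by
    intro t
    have h1 : HasDerivAt (fun t : ℝ => t - 1) 1 t := (hasDerivAt_id t).sub_const 1
    have h2 : HasDerivAt y₀ _ t := (h1.pow 2).sub ((h1.pow 3).const_mul (2 / 3))
    convert h2 using 1
    simp only [force]
    push_cast
    ring
  have hy01 : ∀ t ∈ Icc (1 : ℝ) 2, 0 ≤ y₀ t ∧ y₀ t ≤ 1 := by
    intro t ht
    have h1 : 0 ≤ t - 1 := by linarith [ht.1]
    have h2 : t - 1 ≤ 1 := by linarith [ht.2]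
    simp only [hy₀]
    constructor
    · nlinarith [mul_nonneg (mul_nonneg h1 h1) (by linarith : 0 ≤ 1 - 2 / 3 * (t - 1))]
    · nlinarith [mul_nonneg (mul_nonneg h1 h1) h1]
  obtain ⟨a, ha, rfl⟩ : ∃ a, |a| ≤ 1 ∧ a * y₀ t = x := by
    have h0 := (hy01 t ⟨ht.1, ht.2.le.trans hT.2⟩).1
    rcases h0.eq_or_lt with h | h
    · refine ⟨0, by simp, ?_⟩
      have h1 : y₀ t = 0 := h.symm
      have h2 : |x| ≤ 0 := hx.trans_eq h1
      rw [zero_mul, abs_nonpos_iff.1 h2]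
    · refine ⟨x / y₀ t, ?_, div_mul_cancel₀ _ h.ne'⟩
      rw [abs_div, abs_of_pos h, div_le_one h]
      exact hx
  refine le_of_forall_pos_le_add fun η hη => ?_
  -- `N` makes the parabola lie below `u` at `t = 1`, where `u x 1 ≥ -K |x|`, and at `|x| = 3`
  set N : ℝ := K ^ 2 / (η / 2) + 1 + K with hN
  have hN0 : 0 ≤ N := by positivity
  have hNK : ∀ r, K * r ≤ N * r ^ 2 + η / 2 := by
    intro r
    have h1 : K ^ 2 / (η / 2) * (η / 2) = K ^ 2 := div_mul_cancel₀ _ (by positivity)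
    have h2 : 0 ≤ (K : ℝ) ^ 2 / (η / 2) := by positivity
    have h3 : K * r ≤ K ^ 2 / (η / 2) * r ^ 2 + η / 2 := by
      have h4 : K * r * (η / 2) ≤ K ^ 2 * r ^ 2 + (η / 2) * (η / 2) := by
        nlinarith [sq_nonneg (K * r - η / 2), sq_nonneg (K * r + η / 2)]
      have h5 : (K ^ 2 / (η / 2) * r ^ 2 + η / 2) * (η / 2)
          = K ^ 2 * r ^ 2 + (η / 2) * (η / 2) := by
        rw [← h1]
        field_simp
      exact le_of_mul_le_mul_right (h4.trans_eq h5.symm) (by positivity)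
    have h6 : 0 ≤ (1 + K) * r ^ 2 := by positivity
    have h7 : N * r ^ 2 = K ^ 2 / (η / 2) * r ^ 2 + (1 + K) * r ^ 2 := by rw [hN]; ring
    linarith
  have hX1 : ∀ s ∈ Icc (1 : ℝ) 2, |a * y₀ s| ≤ 1 := by
    intro s hs
    rw [abs_mul, abs_of_nonneg (hy01 s hs).1]
    exact mul_le_one₀ ha (hy01 s hs).1 (hy01 s hs).2
  have hbar := hp.sol.2.barrier_le hp.lip.continuousOn zero_le_one le_rfl (B := 3)
    (Φ := fun x s => -N * (x - a * y₀ s) ^ 2 - η / 2 * s) ?_ ?_ ?_ ?_ t ht (a * y₀ t) ?_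
  · have h2 := ht.2.trans_le hT.2
    rw [sub_self] at hbar
    nlinarith
  · simp only [hy₀]
    fun_prop
  · intro x _
    have h1 := hp.le_add (x := 0) (x' := x) (t := 1) (t' := 1)
      ⟨zero_le_one, hT.1⟩ ⟨zero_le_one, hT.1⟩
    rw [sub_self, abs_zero, add_zero, zero_sub, abs_neg] at h1
    have h2 := hNK |x|
    rw [sq_abs] at h2
    have h3 : y₀ 1 = 0 := by simp [hy₀]
    rw [h3, mul_zero, sub_zero]
    linarith [hp.nonneg_at_fattening hT hk]
  · intro s hs
    have hs2 := hX1 s ⟨hs.1, hs.2.le.trans hT.2⟩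
    have hKs : K * s ≤ K * 2 := mul_le_mul_of_nonneg_left (by linarith [hs.2, hT.2]) hK
    have hηs : 0 ≤ η / 2 * s := mul_nonneg (by linarith) (hIco hs).1
    have hN1 : 1 + K ≤ N := by
      have : 0 ≤ (K : ℝ) ^ 2 / (η / 2) := by positivity
      linarith
    have h3 : ∀ x : ℝ, |x| = 3 → -N * (x - a * y₀ s) ^ 2 - η / 2 * s ≤ u x s := by
      intro x hx
      have h4 := hp.outer_le (x := x) (hIco hs)
      have h5 : 2 ≤ |x - a * y₀ s| := by linarith [abs_sub_abs_le_abs_sub x (a * y₀ s)]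
      have h6 : 4 ≤ (x - a * y₀ s) ^ 2 := by
        rw [← sq_abs]
        nlinarith
      have h7 := mul_le_mul_of_nonneg_left h6 hN0
      linarith
    exact ⟨h3 _ (by norm_num), h3 _ (by norm_num)⟩
  · intro x₀ hx₀ t₀ ht₀
    have hx₀' : |x₀| < 3 := abs_lt.2 hx₀
    set A : ℝ := 2 * N * |x₀ - a * y₀ t₀| with hA
    have hA0 : 0 ≤ A := by positivity
    have hf0 : 0 ≤ force 0 t₀ := force_nonneg 0 ⟨ht₀.1.le, ht₀.2.le.trans hT.2⟩
    have hdx : deriv (fun x => -N * (x - a * y₀ t₀) ^ 2 - η / 2 * t₀) x₀ =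
        -(2 * N * (x₀ - a * y₀ t₀)) := by
      have h1 := ((((hasDerivAt_id x₀).sub_const (a * y₀ t₀)).pow 2).const_mul (-N)).sub_const
        (η / 2 * t₀)
      refine h1.deriv.trans ?_
      simp
      ring
    have hdt : deriv (fun t => -N * (x₀ - a * y₀ t) ^ 2 - η / 2 * t) t₀ =
        2 * N * (x₀ - a * y₀ t₀) * a * force 0 t₀ - η / 2 := by
      have h1 := (((((hyd t₀).const_mul a).const_sub x₀).pow 2).const_mul (-N)).sub
        ((hasDerivAt_id t₀).const_mul (η / 2))
      refine h1.deriv.trans ?_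
      simp
      ring
    have habs : |-(2 * N * (x₀ - a * y₀ t₀))| = A := by
      rw [abs_neg, abs_mul, abs_of_nonneg (by positivity : 0 ≤ 2 * N)]
    rw [hdx, hdt, habs]
    set μ : ℝ := η / 2 / (A + 1) with hμ
    have hμ0 : 0 < μ := by positivity
    refine ⟨force 0 t₀ - μ, ?_⟩
    have hcont : ∀ᶠ s in 𝓝 t₀, force 0 t₀ - μ < force 0 s := by
      have h1 : Continuous fun s => force 0 s := by
        simp only [force]
        fun_prop
      exact continuousAt_const.eventually_lt h1.continuousAt (by linarith)
    obtain ⟨δ, hδ, hδt⟩ := Metric.eventually_nhds_iff.1 hcont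
    refine ⟨min δ 1, lt_min hδ one_pos, ?_, ?_⟩
    · filter_upwards [hp.velocity_inner hT.2 hk] with s hv hs hlt x hxlt
      have hx : |x| ≤ 4 := by
        have h1 := abs_sub_abs_le_abs_sub x x₀
        linarith [hxlt.trans_le (min_le_right δ 1)]
      exact (hδt ((Real.dist_eq _ _).trans_lt (hlt.trans_le (min_le_left _ _)))).le.trans
        (hv ⟨zero_lt_one.trans hs.1, hs.2⟩ x hx).1
    · have h1 : 2 * N * (x₀ - a * y₀ t₀) * a ≤ A := by
        refine (le_abs_self _).trans ?_
        rw [abs_mul, abs_mul, abs_of_nonneg (by positivity : 0 ≤ 2 * N)]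
        exact mul_le_of_le_one_right hA0 ha
      have h2 := mul_le_mul_of_nonneg_right h1 hf0
      have h3 : μ * (A + 1) = η / 2 := div_mul_cancel₀ _ (by positivity)
      nlinarith
  · exact abs_le.1 ((hX1 t ⟨ht.1, ht.2.le.trans hT.2⟩).trans (by norm_num))

end

/-- Every weak solution vanishes on a nonempty open set. -/
theorem not_exists_isClassicalSolution {T M : ℝ} {c₀ : ℝ → ℝ → ℝ} (hT : T ∈ Ioc (1 : ℝ) 2)
    (hk : LocalKernel T c₀ M) : ¬ ∃ u, IsClassicalSolution T c₀ force datum u := by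
  rintro ⟨u, ⟨⟨K, hlip⟩, χ, hm, hmem, hbet, hsol⟩, hclass⟩
  have hp : WeakPair T c₀ u χ K := ⟨hlip, hm, hmem, hbet, hsol⟩
  set O : Set (ℝ × ℝ) :=
    {z | (1 < z.2 ∧ z.2 < T) ∧ |z.1| < (z.2 - 1) ^ 2 - 2 / 3 * (z.2 - 1) ^ 3} with hO
  have hopen : IsOpen O := by
    have h1 : Continuous fun z : ℝ × ℝ => |z.1| := by fun_prop
    have h2 : Continuous fun z : ℝ × ℝ => (z.2 - 1) ^ 2 - 2 / 3 * (z.2 - 1) ^ 3 := by fun_prop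
    exact ((isOpen_lt continuous_const continuous_snd).inter
      (isOpen_lt continuous_snd continuous_const)).inter (isOpen_lt h1 h2)
  have hne : O.Nonempty := by
    refine ⟨(0, (1 + T) / 2), ⟨by dsimp only; linarith [hT.1], by dsimp only; linarith [hT.1]⟩, ?_⟩
    have h1 : 0 < (1 + T) / 2 - 1 := by linarith [hT.1]
    have h2 : (1 + T) / 2 - 1 ≤ 1 := by linarith [hT.2]
    dsimp only
    rw [abs_zero]
    nlinarith [mul_pos (mul_pos h1 h1) (by linarith : 0 < 1 - 2 / 3 * ((1 + T) / 2 - 1))]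
  have hae : ∀ᵐ z : ℝ × ℝ, z ∈ (univ ×ˢ Ioo 0 T : Set (ℝ × ℝ)) →
      indPos u z.1 z.2 = indNonneg u z.1 z.2 :=
    (ae_restrict_iff' (MeasurableSet.univ.prod measurableSet_Ioo)).1 hclass
  obtain ⟨z, hzO, hz⟩ := (Measure.dense_of_ae hae).inter_open_nonempty O hopen hne
  have hz1 : z.2 ∈ Ico 1 T := ⟨hzO.1.1.le, hzO.1.2⟩
  have h0 := hp.nonneg_of_le hT hk hz1 hzO.2.le
  have h1 := hp.nonpos hT hk (x := z.1) hz1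
  have h2 := hz ⟨mem_univ _, by linarith [hz1.1], hz1.2⟩
  rw [indPos, indNonneg, indicator_of_notMem (s := {w | 0 < u w z.2}) (not_lt.2 h1),
    indicator_of_mem (s := {w | 0 ≤ u w z.2}) h0] at h2
  exact zero_ne_one h2

/-! ### The family `U_γ` -/

theorem U_eq_sub_abs {y : ℝ → ℝ} {x t : ℝ} (ht : t ∈ Icc (0 : ℝ) 1) : U y x t = x₁ t - |x| := by
  rw [U_eq_min ⟨ht.1, ht.2.trans one_le_two⟩, len, if_pos ht.2, cap_of_le ht.2]
  exact min_eq_left (sub_le_self _ (abs_nonneg x))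

theorem U_eq_min_sub_abs {γ y : ℝ → ℝ} (hy : IsFront γ y) {x t : ℝ} (ht : t ∈ Icc (1 : ℝ) 2) :
    U y x t = min (y t - |x|) 0 := by
  rw [U_eq_min ⟨zero_le_one.trans ht.1, ht.2⟩, cap_of_ge ht.1]
  congr 2
  rcases ht.1.eq_or_lt with rfl | h
  · rw [len, if_pos le_rfl, hy.one, x₁, sub_self, zero_pow two_ne_zero]
  · rw [len, if_neg (not_le.2 h), min_eq_left ht.2]

theorem exists_isWeakSolution_eq_U {T L M r : ℝ} {c₀ : ℝ → ℝ → ℝ} {γ y : ℝ → ℝ}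
    (hγ : Admissible γ) (hy : IsFront γ y) (hT : T ∈ Ioc (1 : ℝ) 2)
    (hw : RegularWindow T c₀ y L M) (hr : 0 ≤ r)
    (hc : ∀ t ∈ Ico 0 T, ∀ x, |x| ≤ r + 3 → c₀ x t = 1) :
    ∃ V, IsWeakSolution T c₀ force datum V ∧
      ∀ x, ∀ t ∈ Ico 0 T, |x| ≤ r → V x t = U y x t :=
  ⟨_, isWeakSolution_bump hγ hy hT hw fun t ht x hx => hc t ht x (by linarith),
    fun _ _ ht hx => bump_field_eq_U hγ hy hT hw hr hc ht (by linarith)⟩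

theorem isWeakSolution_U {T : ℝ} {γ y : ℝ → ℝ} (hγ : Admissible γ) (hy : IsFront γ y)
    (hT : T ∈ Ioc (1 : ℝ) 2) : IsWeakSolution T one force datum (U y) := by
  have hw : RegularWindow T one y 0 2 := regularWindow_one hγ hy hT.2
  refine (isWeakSolution_bump hγ hy hT hw fun _ _ _ _ => rfl).congr
    (zero_lt_one.trans hT.1) fun t ht x => ?_
  exact bump_field_eq_U hγ hy hT hw (abs_nonneg x) (fun _ _ _ _ => rfl) ht (by linarith)

/-- The parameters `parameter θ` give pairwise different fronts at every time after `1`; the point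
`x = 2` lies outside all of them, so that the value there reveals the front. -/
theorem infinite_values_of_exists_eq_U {T : ℝ} {c₀ : ℝ → ℝ → ℝ} (hT : T ≤ 2)
    (h : ∀ γ y : ℝ → ℝ, Admissible γ → IsFront γ y → ∃ V, IsWeakSolution T c₀ force datum V ∧
      ∀ x, ∀ t ∈ Ico 0 T, |x| ≤ 2 → V x t = U y x t) {t : ℝ} (ht : t ∈ Ioo 1 T) :
    {f : ℝ → ℝ | ∃ u : ℝ → ℝ → ℝ, IsWeakSolution T c₀ force datum u ∧
      f = fun x => u x t}.Infinite := by
  have h1 : ∀ θ : Icc (0 : ℝ) 1, ∃ V, IsWeakSolution T c₀ force datum V ∧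
      V 2 t = (t - 1) ^ 2 - 2 / 3 * θ * (t - 1) ^ 3 - 2 := by
    intro θ
    have hγ := admissible_parameter θ.2
    have hy := isFront_parameter θ.2
    have ht' : t ∈ Icc (1 : ℝ) 2 := ⟨ht.1.le, ht.2.le.trans hT⟩
    obtain ⟨V, hV, hVU⟩ := h _ _ hγ hy
    refine ⟨V, hV, ?_⟩
    rw [hVU 2 t ⟨zero_le_one.trans ht'.1, ht.2⟩ (by norm_num), U_eq_min_sub_abs hy ht',
      abs_of_pos two_pos]
    refine min_eq_left ?_
    have h2 := hy.le_sq hγ ht'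
    have h3 : (t - 1) ^ 2 ≤ 1 := x₁_le_one ⟨zero_le_one.trans ht'.1, ht'.2⟩
    linarith
  choose V hV hV2 using h1
  have hinf : (univ : Set (Icc (0 : ℝ) 1)).Infinite := by
    rw [infinite_univ_iff]
    exact (Icc_infinite zero_lt_one).to_subtype
  refine infinite_of_injOn_mapsTo (f := fun θ => fun x => V θ x t) ?_
    (fun θ _ => ⟨V θ, hV θ, rfl⟩) hinf
  intro θ _ θ' _ heq
  have h2 : V θ 2 t = V θ' 2 t := congrFun heq 2
  rw [hV2, hV2] at h2
  have h3 : 0 < (t - 1) ^ 3 := pow_pos (by linarith [ht.1]) 3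
  have h4 : (θ : ℝ) * (t - 1) ^ 3 = θ' * (t - 1) ^ 3 := by linarith
  exact Subtype.ext (mul_right_cancel₀ h3.ne' h4)

end Dislocation

theorem mainTheorem6 :
    -- the functions `U_γ`, for the kernel `c₀ ≡ 1`
    (∀ γ : ℝ → ℝ, Dislocation.Admissible γ →
      (∃ y, Dislocation.IsFront γ y) ∧
      (∀ y z, Dislocation.IsFront γ y → Dislocation.IsFront γ z → EqOn y z (Icc 1 2)) ∧
      ∀ y, Dislocation.IsFront γ y →
        (∀ t ∈ Icc (0 : ℝ) 1,
          {x | 0 < Dislocation.U y x t} = Ioo (-Dislocation.x₁ t) (Dislocation.x₁ t) ∧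
          {x | 0 ≤ Dislocation.U y x t} = Icc (-Dislocation.x₁ t) (Dislocation.x₁ t)) ∧
        (∀ t ∈ Icc (1 : ℝ) 2,
          {x | 0 < Dislocation.U y x t} = ∅ ∧
          {x | 0 ≤ Dislocation.U y x t} = Icc (-y t) (y t) ∧
          {x | Dislocation.U y x t = 0} = Icc (-y t) (y t)) ∧
        (∀ t ∈ Ioc (1 : ℝ) 2, 0 < y t) ∧
        ∀ T ∈ Ioc (1 : ℝ) 2,
          Dislocation.IsWeakSolution T Dislocation.one Dislocation.force Dislocation.datum
            (Dislocation.U y)) ∧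
    -- non-uniqueness after `t = 1`, and no classical solution, for `c₀ ≡ 1`
    (∀ T ∈ Ioc (1 : ℝ) 2,
      (∀ t ∈ Ioo 1 T, {f : ℝ → ℝ | ∃ u : ℝ → ℝ → ℝ,
        Dislocation.IsWeakSolution T Dislocation.one Dislocation.force Dislocation.datum u ∧
          f = fun x => u x t}.Infinite) ∧
      ¬ ∃ u : ℝ → ℝ → ℝ,
        Dislocation.IsClassicalSolution T Dislocation.one Dislocation.force
          Dislocation.datum u) ∧
    -- the same with a compactly supported kernel, equal to `1` on a large ball
    (∀ ρ : ℝ, 0 < ρ → ∃ R₀ : ℝ, ∀ R ≥ R₀, ∀ T ∈ Ioc (1 : ℝ) 2,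
      (∃ c₀ : ℝ → ℝ → ℝ,
        Dislocation.IsCutoffOfOne T R c₀ ∧ Dislocation.Regular T c₀ Dislocation.force) ∧
      ∀ c₀ : ℝ → ℝ → ℝ, Dislocation.IsCutoffOfOne T R c₀ →
        Dislocation.Regular T c₀ Dislocation.force →
        (∀ γ y : ℝ → ℝ, Dislocation.Admissible γ → Dislocation.IsFront γ y →
          ∃ V : ℝ → ℝ → ℝ,
            Dislocation.IsWeakSolution T c₀ Dislocation.force Dislocation.datum V ∧
            ∀ x, ∀ t ∈ Ico 0 T, |x| ≤ ρ → V x t = Dislocation.U y x t) ∧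
        (∀ t ∈ Ioo 1 T, {f : ℝ → ℝ | ∃ u : ℝ → ℝ → ℝ,
          Dislocation.IsWeakSolution T c₀ Dislocation.force Dislocation.datum u ∧
            f = fun x => u x t}.Infinite) ∧
        ¬ ∃ u : ℝ → ℝ → ℝ,
          Dislocation.IsClassicalSolution T c₀ Dislocation.force Dislocation.datum u) := by
  refine ⟨fun γ hγ => ⟨Dislocation.exists_isFront hγ, fun y z hy hz => hy.eqOn hγ hz,
    fun y hy => ⟨fun t ht => ?_, fun t ht => ?_, fun t ht => hy.pos hγ ht,
      fun T hT => Dislocation.isWeakSolution_U hγ hy hT⟩⟩, fun T hT => ⟨fun t ht => ?_, ?_⟩,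
    fun ρ _ => ⟨max ρ 3 + 5, fun R hR T hT => ⟨?_, fun c₀ hc hreg => ?_⟩⟩⟩
  · simp only [Dislocation.U_eq_sub_abs ht, sub_pos, sub_nonneg, abs_lt, abs_le]
    exact ⟨rfl, rfl⟩
  · simp only [Dislocation.U_eq_min_sub_abs hy ht, lt_min_iff, le_min_iff, lt_irrefl, and_false,
      le_refl, and_true, min_eq_right_iff, sub_nonneg, abs_le]
    exact ⟨rfl, rfl, rfl⟩
  · exact Dislocation.infinite_values_of_exists_eq_U hT.2
      (fun γ y hγ hy => ⟨_, Dislocation.isWeakSolution_U hγ hy hT, fun _ _ _ _ => rfl⟩) ht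
  · exact Dislocation.not_exists_isClassicalSolution hT Dislocation.localKernel_one
  · have h3 := le_max_right ρ 3
    exact Dislocation.exists_regular_cutoff (by linarith) hT.2
  · have h3 := le_max_right ρ 3
    have key : ∀ γ y : ℝ → ℝ, Dislocation.Admissible γ → Dislocation.IsFront γ y →
        ∃ V, Dislocation.IsWeakSolution T c₀ Dislocation.force Dislocation.datum V ∧
          ∀ x, ∀ t ∈ Ico 0 T, |x| ≤ max ρ 3 → V x t = Dislocation.U y x t := by
      intro γ y hγ hy
      obtain ⟨L, M, hw⟩ := Dislocation.regularWindow_of_regular hγ hy hT.2 hreg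
      exact Dislocation.exists_isWeakSolution_eq_U hγ hy hT hw (by linarith)
        fun t ht x hx => hc.2 x t ht (by linarith)
    refine ⟨fun γ y hγ hy => ?_, fun t ht => ?_, ?_⟩
    · obtain ⟨V, hV, hVU⟩ := key γ y hγ hy
      exact ⟨V, hV, fun x t ht hx => hVU x t ht (hx.trans (le_max_left _ _))⟩
    · refine Dislocation.infinite_values_of_exists_eq_U hT.2 (fun γ y hγ hy => ?_) ht
      obtain ⟨V, hV, hVU⟩ := key γ y hγ hy
      exact ⟨V, hV, fun x t ht hx => hVU x t ht (by linarith)⟩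
    · obtain ⟨M, hk⟩ := Dislocation.localKernel_of_regular (by linarith) hc hreg
      exact Dislocation.not_exists_isClassicalSolution hT hk
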